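/- Let $\mathfrak g$ be a finite-dimensional complex simple Lie algebra with Cartan subalgebra $\mathfrak h$, simple roots $\alpha_1,\dots,\alpha_l$ and Cartan matrix $a_{ij}=\alpha_j(\alpha_i^\vee)$, where $\alpha_i^\vee$ is the simple coroot. Let $d_1,\dots,d_l$ be coprime positive integers such that $b_{ij}=d_ia_{ij}$ is symmetric, and equip $\mathfrak h^*$ with the form $(\alpha_i,\alpha_j)=b_{ij}$. Put $q=e^h$, $q_i=e^{d_ih}$, $K_i=e^{d_ihH_i}$, $Y_i=\sum_j d_i(a^{-1})_{ij}H_j$. Write $[n]_t=\frac{t^n-t^{-n}}{t-t^{-1}}$, $[n]_t!=[n]_t\cdots[1]_t$ and $\left[{m\atop r}\right]_t=\frac{[m]_t!}{[r]_t!\,[m-r]_t!}$. For $\pi\in S_l$ let $s_\pi=s_{\pi(1)}\cdots s_{\pi(l)}$ be the corresponding Coxeter element and $c_{ij}=\left(\frac{1+s_\pi}{1-s_\pi}\alpha_i,\alpha_j\right)$. Let $U_h^{s_\pi}(\mathfrak g)$ be the $\mathbb C[[h]]$-algebra topologically generated (in the $h$-adic topology) by $H_i,e_i,f_i$, $1\le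 i\le l$, with defining relations $$[H_i,H_j]=0,\quad [H_i,e_j]=a_{ij}e_j,\quad [H_i,f_j]=-a_{ij}f_j,\quad e_if_j-q^{c_{ji}}f_je_i=\delta_{ij}\frac{K_i-K_i^{-1}}{q_i-q_i^{-1}},$$ $$\sum_{r=0}^{1-a_{ij}}(-1)^rq^{rc_{ij}}\left[{1-a_{ij}\atop r}\right]_{q_i}x_i^{1-a_{ij}-r}x_jx_i^r=0\qquad(i\ne j,\ x=e\text{ or }x=f).$$ Let $U_h(\mathfrak g)$ be the standard quantum group: the algebra topologically generated by $H_i,X_i^+,X_i^-$ with the same relations in which all $c_{ij}$ are replaced by $0$, $e_i$ by $X_i^+$ and $f_i$ by $X_i^-$. It is a topological Hopf algebra (tensor products are completed $h$-adically) with $$\Delta_h(H_i)=H_i\otimes1+1\otimes H_i,\quad \Delta_h(X_i^+)=X_i^+\otimes K_i+1\otimes X_i^+,\quad \Delta_h(X_i^-)=X_i^-\otimes1+K_i^{-1}\otimes X_i^-,$$ counit $\varepsilon_h$ vanishing on all generators, and antipode $S_h(H_i)=-H_i$, $S_h(X_i^+)=-X_i^+K_i^{-1}$, $S_h(X_i^-)=-K_iX_i^-$.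 Let $n_{ij}\in\mathbb C$ be any solution of $d_jn_{ij}-d_in_{ji}=c_{ij}$. Let $\psi:U_h^{s_\pi}(\mathfrak g)\to U_h(\mathfrak g)$ be the algebra isomorphism given by $$\psi(e_i)=X_i^+\prod_{p}e^{hn_{ip}Y_p},\quad \psi(f_i)=\prod_{p}e^{-hn_{ip}Y_p}\,X_i^-,\quad \psi(H_i)=H_i,$$ and let $\mathcal F=\exp\left(-h\sum_{i,j}\frac{n_{ji}}{d_j}Y_i\otimes Y_j\right)$, an invertible element of the completed tensor square of $U_h(\mathfrak g)$. Then $\Delta_{s_\pi}(x)=(\psi^{-1}\otimes\psi^{-1})\left(\mathcal F\,\Delta_h(\psi(x))\,\mathcal F^{-1}\right)$ and the counit $\varepsilon_h\circ\psi$ make $U_h^{s_\pi}(\mathfrak g)$ a topological Hopf algebra, and the square of its antipode $S^{s_\pi}$ is the inner automorphism $$(S^{s_\pi})^2(x)=e^{2h\rho^\vee}\,x\,e^{-2h\rho^\vee}\quad\text{for all }x\in U_h^{s_\pi}(\mathfrak g),\qquad \rho^\vee=\sum_{i=1}^lY_i .$$ -/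

import Mathlib

open scoped TensorProduct

noncomputable section

/-! ## Modules and algebras over the ring of formal power series `ℂ[[h]]` -/

/-- The ring `ℂ[[h]]`; the indeterminate `h` is `PowerSeries.X`. -/
abbrev Ch : Type := PowerSeries ℂ

namespace HAdic

section Completion

variable (A : Type*) [Ring A] [Algebra Ch A]

/-- The two-sided ideal `h ^ n A`. -/
def hIdeal (n : ℕ) : Ideal A where
  carrier := {x | ∃ y, x = (PowerSeries.X ^ n : Ch) • y}
  add_mem' := by
    rintro _ _ ⟨a, rfl⟩ ⟨b, rfl⟩
    exact ⟨a + b, (smul_add _ _ _).symm⟩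
  zero_mem' := ⟨0, (smul_zero _).symm⟩
  smul_mem' := by
    rintro c _ ⟨a, rfl⟩
    exact ⟨c * a, by simp⟩

instance (n : ℕ) : (hIdeal A n).IsTwoSided :=
  ⟨by rintro _ b ⟨a, rfl⟩; exact ⟨a * b, by simp⟩⟩

theorem hIdeal_anti {m n : ℕ} (h : m ≤ n) : hIdeal A n ≤ hIdeal A m := by
  rintro _ ⟨a, rfl⟩
  exact ⟨(PowerSeries.X ^ (n - m) : Ch) • a, by rw [smul_smul, ← pow_add, Nat.add_sub_cancel' h]⟩

/-- The `h`-adic completion of a (not necessarily commutative) `ℂ[[h]]`-algebra, realised as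
the inverse limit of the algebras `A / h ^ n A` inside their product. -/
def completionSubalgebra : Subalgebra Ch (∀ n, A ⧸ hIdeal A n) where
  carrier := {f | ∀ ⦃m n : ℕ⦄ (h : m ≤ n), Ideal.Quotient.factor (hIdeal_anti A h) (f n) = f m}
  mul_mem' := by
    intro f g hf hg m n h
    simp [hf h, hg h]
  add_mem' := by
    intro f g hf hg m n h
    simp [hf h, hg h]
  algebraMap_mem' := by
    intro r m n h
    rfl

/-- The `h`-adic completion. -/
abbrev Completion : Type _ := completionSubalgebra A

/-- The canonical map from an algebra to its completion. -/
def of : A →ₐ[Ch] Completion A :=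
  AlgHom.codRestrict (AlgHom.pi fun n => Ideal.Quotient.mkₐ Ch (hIdeal A n))
    (completionSubalgebra A) (by intro x m n h; rfl)

/-- The projection of the completion to `A / h ^ n A`. -/
def proj (n : ℕ) : Completion A →ₐ[Ch] A ⧸ hIdeal A n :=
  (Pi.evalAlgHom Ch (fun n => A ⧸ hIdeal A n) n).comp (completionSubalgebra A).val

variable {A} {B C D : Type*} [Ring B] [Algebra Ch B] [Ring C] [Algebra Ch C] [Ring D]
  [Algebra Ch D]

/-- The map `A / h ^ n A → B / h ^ n B` induced by a linear map `A → B^`. -/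
def levelMap (φ : A →ₗ[Ch] Completion B) (n : ℕ) : (A ⧸ hIdeal A n) →ₗ[Ch] (B ⧸ hIdeal B n) :=
  Submodule.liftQ ((hIdeal A n).restrictScalars Ch) ((proj B n).toLinearMap ∘ₗ φ) (by
    rintro _ ⟨y, rfl⟩
    rw [LinearMap.mem_ker, map_smul]
    obtain ⟨z, hz⟩ := Ideal.Quotient.mk_surjective (((proj B n).toLinearMap ∘ₗ φ) y)
    rw [← hz]
    exact Ideal.Quotient.eq_zero_iff_mem.mpr ⟨z, rfl⟩)

theorem levelMap_mk (φ : A →ₗ[Ch] Completion B) (n : ℕ) (a : A) :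
    levelMap φ n (Ideal.Quotient.mk _ a) = proj B n (φ a) := rfl

/-- The unique (automatically continuous) linear extension `A^ → B^` of a linear map
`A → B^`. -/
def extend (φ : A →ₗ[Ch] Completion B) : Completion A →ₗ[Ch] Completion B :=
  LinearMap.codRestrict (Subalgebra.toSubmodule (completionSubalgebra B))
    (LinearMap.pi fun n => levelMap φ n ∘ₗ (proj A n).toLinearMap) (by
      intro f m n h
      have hf : Ideal.Quotient.factor (hIdeal_anti A h) (proj A n f) = proj A m f := f.2 h
      obtain ⟨a, ha⟩ := Ideal.Quotient.mk_surjective (proj A n f)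
      change Ideal.Quotient.factor (hIdeal_anti B h) (levelMap φ n (proj A n f))
        = levelMap φ m (proj A m f)
      rw [← hf, ← ha, Ideal.Quotient.factor_mk, levelMap_mk, levelMap_mk]
      exact (φ a).2 h)

/-- The map `A^ → B^` between completions that is induced by a linear map `A → B`. -/
def mapHat (f : A →ₗ[Ch] B) : Completion A →ₗ[Ch] Completion B :=
  extend ((of B).toLinearMap ∘ₗ f)

theorem extend_of (φ : A →ₗ[Ch] Completion B) (a : A) : extend φ (of A a) = φ a := rfl

/-- The bilinear pairing `(x, y) ↦ x ⊗ y` from `B^` and `D^` to the completed tensor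
product. -/
def pairing : Completion B →ₗ[Ch] Completion D →ₗ[Ch] Completion (B ⊗[Ch] D) :=
  (LinearMap.mul Ch (Completion (B ⊗[Ch] D))).compl₁₂
    (mapHat (Algebra.TensorProduct.includeLeft : B →ₐ[Ch] B ⊗[Ch] D).toLinearMap)
    (mapHat (Algebra.TensorProduct.includeRight : D →ₐ[Ch] B ⊗[Ch] D).toLinearMap)

/-- The completed tensor product `φ ⊗ χ` of two linear maps with values in completions. -/
def tensorHat (φ : A →ₗ[Ch] Completion B) (χ : C →ₗ[Ch] Completion D) :
    Completion (A ⊗[Ch] C) →ₗ[Ch] Completion (B ⊗[Ch] D) :=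
  extend (TensorProduct.lift (pairing.compl₁₂ φ χ))

theorem tensorHat_of (φ : A →ₗ[Ch] Completion B) (χ : C →ₗ[Ch] Completion D) (a : A) (c : C) :
    tensorHat φ χ (of _ (a ⊗ₜ c)) = pairing (φ a) (χ c) := rfl

theorem pairing_of (b : B) (d : D) : pairing (of B b) (of D d) = of _ (b ⊗ₜ[Ch] d) := by
  change of _ (b ⊗ₜ[Ch] (1 : D)) * of _ ((1 : B) ⊗ₜ[Ch] d) = _
  rw [← map_mul]
  simp

/-- The exponential `e ^ {h x}` as an element of the completion: modulo `h ^ n` it is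
`∑_{k < n} h ^ k x ^ k / k!`. -/
def expHat (x : A) : Completion A :=
  ⟨fun n => Ideal.Quotient.mk _
      (∑ k ∈ Finset.range n, (PowerSeries.monomial k ((k.factorial : ℂ)⁻¹) : Ch) • x ^ k), by
    intro m n h
    rw [Ideal.Quotient.factor_mk, Ideal.Quotient.mk_eq_mk_iff_sub_mem,
      ← Finset.sum_range_add_sum_Ico _ h, add_sub_cancel_left]
    refine Ideal.sum_mem _ fun k hk => ⟨(PowerSeries.monomial (k - m)
      ((k.factorial : ℂ)⁻¹) : Ch) • x ^ k, ?_⟩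
    rw [smul_smul, PowerSeries.X_pow_eq, PowerSeries.monomial_mul_monomial, one_mul,
      Nat.add_sub_cancel' (Finset.mem_Ico.mp hk).1]⟩

variable (A) in
/-- A topological Hopf algebra over `ℂ[[h]]`: an `h`-adically complete algebra with a Hopf
algebra structure in which algebraic tensor products are replaced by completed ones. Linear maps
over `ℂ[[h]]` are automatically `h`-adically continuous. -/
structure TopHopf where
  complete : IsAdicComplete (Ideal.span {(PowerSeries.X : Ch)}) A
  comul : A →ₐ[Ch] Completion (A ⊗[Ch] A)
  counit : A →ₐ[Ch] Ch
  antipode : A →ₗ[Ch] A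
  coassoc : ∀ x,
    mapHat (TensorProduct.assoc Ch A A A).toLinearMap
        (tensorHat comul.toLinearMap (of A).toLinearMap (comul x))
      = tensorHat (of A).toLinearMap comul.toLinearMap (comul x)
  counit_left : ∀ x,
    mapHat ((TensorProduct.lid Ch A).toLinearMap ∘ₗ
      TensorProduct.map counit.toLinearMap LinearMap.id) (comul x) = of A x
  counit_right : ∀ x,
    mapHat ((TensorProduct.rid Ch A).toLinearMap ∘ₗ
      TensorProduct.map LinearMap.id counit.toLinearMap) (comul x) = of A x
  antipode_left : ∀ x,
    mapHat (LinearMap.mul' Ch A ∘ₗ TensorProduct.map antipode LinearMap.id) (comul x)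
      = of A (algebraMap Ch A (counit x))
  antipode_right : ∀ x,
    mapHat (LinearMap.mul' Ch A ∘ₗ TensorProduct.map LinearMap.id antipode) (comul x)
      = of A (algebraMap Ch A (counit x))

/-- The closure, in the `h`-adic topology, of the two-sided ideal generated by a set. -/
def closedIdeal (s : Set A) : Ideal A where
  carrier := {x | ∀ n : ℕ, ∃ y ∈ TwoSidedIdeal.span s, ∃ z, x = y + (PowerSeries.X ^ n : Ch) • z}
  add_mem' := by
    intro a b ha hb n
    obtain ⟨y, hy, z, rfl⟩ := ha n
    obtain ⟨y₂, hy₂, z₂, rfl⟩ := hb n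
    exact ⟨y + y₂, add_mem hy hy₂, z + z₂, by rw [smul_add]; abel⟩
  zero_mem' := fun n => ⟨0, zero_mem _, 0, by simp⟩
  smul_mem' := by
    intro c a ha n
    obtain ⟨y, hy, z, rfl⟩ := ha n
    exact ⟨c * y, TwoSidedIdeal.mul_mem_left _ _ _ hy, c * z, by simp [mul_add]⟩

instance (s : Set A) : (closedIdeal s).IsTwoSided :=
  ⟨by
    intro a b ha n
    obtain ⟨y, hy, z, rfl⟩ := ha n
    exact ⟨y * b, TwoSidedIdeal.mul_mem_right _ _ _ hy, z * b, by simp [add_mul]⟩⟩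

end Completion

end HAdic

/-! ## Quantum groups by generators and relations -/

namespace QGroup

open HAdic

/-- The power series `f / h`, for `f` with vanishing constant term. -/
def divh {R : Type*} [Semiring R] (f : PowerSeries R) : PowerSeries R :=
  PowerSeries.mk fun k => PowerSeries.coeff (k + 1) f

/-- `q ^ c = e ^ {c h}` in `ℂ[[h]]`. -/
def qpow (c : ℂ) : Ch := PowerSeries.mk fun k => c ^ k / (k.factorial : ℂ)

/-- The quantum integer `[n] = (t ^ n - t ^ {-n}) / (t - t ^ {-1})` for `t = q ^ d`; both
differences are divisible by `h`, and the quotient is taken after division by `h`. -/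
def qint (d n : ℕ) : Ch :=
  divh (qpow (n * d) - qpow (-(n * d))) * (divh (qpow d - qpow (-d)))⁻¹

/-- The quantum factorial `[n]!` for `t = q ^ d`. -/
def qfact (d n : ℕ) : Ch := ∏ k ∈ Finset.range n, qint d (k + 1)

/-- The quantum binomial coefficient `[m choose r]` for `t = q ^ d`. -/
def qbinom (d m r : ℕ) : Ch := qfact d m * (qfact d r * qfact d (m - r))⁻¹

/-- Symbols for the generators: Cartan generators, and raising and lowering generators. -/
inductive Gen (l : ℕ) : Type
  | H (i : Fin l)
  | E (i : Fin l)
  | F (i : Fin l)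

/-- The free associative `ℂ`-algebra on the generators. -/
abbrev Free (l : ℕ) : Type := FreeAlgebra ℂ (Gen l)

/-- The `h`-adically completed free `ℂ[[h]]`-algebra on the generators: power series in the
central indeterminate `h` with coefficients in the free `ℂ`-algebra. -/
abbrev FreeTop (l : ℕ) : Type := PowerSeries (Free l)

instance (l : ℕ) : Algebra Ch (FreeTop l) :=
  RingHom.toAlgebra' (PowerSeries.map (algebraMap ℂ (Free l))) (by
    intro c x
    ext n
    simp only [PowerSeries.coeff_mul, PowerSeries.coeff_map]
    rw [← Finset.Nat.sum_antidiagonal_swap]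
    exact Finset.sum_congr rfl fun p _ => Algebra.commutes _ _)

section Data

variable {l : ℕ}

/-- The exponential `e ^ {h y}` in the completed free algebra. -/
def fexp (y : Free l) : FreeTop l := PowerSeries.mk fun k => ((k.factorial : ℂ)⁻¹) • y ^ k

/-- A generator as an element of the free algebra. -/
def gen (g : Gen l) : Free l := FreeAlgebra.ι ℂ g

/-- A generator as an element of the completed free algebra. -/
def tgen (g : Gen l) : FreeTop l := PowerSeries.C (gen g)

/-- The relators of the quantum group attached to a Cartan matrix `A`, symmetrised by `d`, and
to an exponent matrix `c`. -/
inductive IsRelator (A : Matrix (Fin l) (Fin l) ℤ) (d : Fin l → ℕ) (c : Matrix (Fin l) (Fin l) ℂ) :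
    FreeTop l → Prop
  /-- `[H_i, H_j] = 0` -/
  | cartan (i j : Fin l) : IsRelator A d c
      (tgen (.H i) * tgen (.H j) - tgen (.H j) * tgen (.H i))
  /-- `[H_i, e_j] = a_ij e_j` -/
  | raise (i j : Fin l) : IsRelator A d c
      (tgen (.H i) * tgen (.E j) - tgen (.E j) * tgen (.H i) - A i j • tgen (.E j))
  /-- `[H_i, f_j] = - a_ij f_j` -/
  | lower (i j : Fin l) : IsRelator A d c
      (tgen (.H i) * tgen (.F j) - tgen (.F j) * tgen (.H i) + A i j • tgen (.F j))
  /-- `e_i f_i - q ^ {c_ii} f_i e_i = (K_i - K_i ^ {-1}) / (q_i - q_i ^ {-1})`, where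
  `K_i = e ^ {d_i h H_i}`, `q_i = e ^ {d_i h}`, and the quotient is taken after division of
  numerator and denominator by `h` -/
  | cross_same (i : Fin l) : IsRelator A d c
      (tgen (.E i) * tgen (.F i) - qpow (c i i) • (tgen (.F i) * tgen (.E i))
        - (divh (qpow (d i) - qpow (-(d i : ℂ))))⁻¹ •
          divh (fexp ((d i : ℂ) • gen (.H i)) - fexp (-((d i : ℂ) • gen (.H i)))))
  /-- `e_i f_j - q ^ {c_ji} f_j e_i = 0` for `i ≠ j` -/
  | cross_ne (i j : Fin l) (hij : i ≠ j) : IsRelator A d c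
      (tgen (.E i) * tgen (.F j) - qpow (c j i) • (tgen (.F j) * tgen (.E i)))
  /-- the quantum Serre relation for the `e_i` -/
  | serre_raise (i j : Fin l) (hij : i ≠ j) : IsRelator A d c
      (∑ r ∈ Finset.range ((1 - A i j).toNat + 1),
        ((-1) ^ r * qpow (r * c i j) * qbinom (d i) (1 - A i j).toNat r) •
          (tgen (.E i) ^ ((1 - A i j).toNat - r) * tgen (.E j) * tgen (.E i) ^ r))
  /-- the quantum Serre relation for the `f_i` -/
  | serre_lower (i j : Fin l) (hij : i ≠ j) : IsRelator A d c
      (∑ r ∈ Finset.range ((1 - A i j).toNat + 1),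
        ((-1) ^ r * qpow (r * c i j) * qbinom (d i) (1 - A i j).toNat r) •
          (tgen (.F i) ^ ((1 - A i j).toNat - r) * tgen (.F j) * tgen (.F i) ^ r))

variable (A : Matrix (Fin l) (Fin l) ℤ) (d : Fin l → ℕ) (c : Matrix (Fin l) (Fin l) ℂ)

/-- The `ℂ[[h]]`-algebra topologically generated by `H_i, e_i, f_i` with the relations above: the
completed free algebra modulo the closed two-sided ideal generated by the relators. -/
def Uq : Type := FreeTop l ⧸ closedIdeal {x : FreeTop l | IsRelator A d c x}

instance : Ring (Uq A d c) :=
  inferInstanceAs (Ring (FreeTop l ⧸ closedIdeal {x : FreeTop l | IsRelator A d c x}))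

instance : Algebra Ch (Uq A d c) :=
  inferInstanceAs (Algebra Ch (FreeTop l ⧸ closedIdeal {x : FreeTop l | IsRelator A d c x}))

/-- The standard quantum group `U_h(g)`: the relations with all exponents `c_ij` equal to `0`. -/
abbrev Ustd : Type := Uq A d 0

/-- The matrix, in the basis of simple roots, of the simple reflection
`s_i(α_j) = α_j - a_ij α_i`. -/
def simpleReflection (i : Fin l) : Matrix (Fin l) (Fin l) ℂ :=
  Matrix.of fun k j => (if k = j then 1 else 0) - (if k = i then (A i j : ℂ) else 0)

/-- The Coxeter element `s_π = s_{π(1)} ⋯ s_{π(l)}` in the basis of simple roots. -/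
def coxeter (π : Equiv.Perm (Fin l)) : Matrix (Fin l) (Fin l) ℂ :=
  (List.ofFn fun k => simpleReflection A (π k)).prod

/-- The matrix of the Cayley transform `(1 + s_π) / (1 - s_π)` in the basis of simple roots. -/
def cayley (π : Equiv.Perm (Fin l)) : Matrix (Fin l) (Fin l) ℂ :=
  (1 + coxeter A π) * (1 - coxeter A π)⁻¹

/-- `c_ij = ((1 + s_π) / (1 - s_π) α_i, α_j)`, where `(α_k, α_j) = d_k a_kj`. -/
def cayleyCoeff (π : Equiv.Perm (Fin l)) : Matrix (Fin l) (Fin l) ℂ :=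
  Matrix.of fun i j => ∑ k, cayley A π k i * ((d k : ℂ) * (A k j : ℂ))

/-- The Coxeter realization `U_h^{s_π}(g)`. -/
abbrev Ucox (π : Equiv.Perm (Fin l)) : Type := Uq A d (cayleyCoeff A d π)

/-- The weight-type element `Y_i = ∑_j d_i (a⁻¹)_ij H_j` of the free algebra. -/
def weightGen (i : Fin l) : Free l :=
  ∑ j, ((d i : ℂ) * ((A.map (Int.cast : ℤ → ℂ))⁻¹ i j)) • gen (.H j)

namespace Uq

/-- The quotient map from the completed free algebra. -/
def mk : FreeTop l →ₐ[Ch] Uq A d c := Ideal.Quotient.mkₐ Ch _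

/-- The generator `H_i`. -/
def H (i : Fin l) : Uq A d c := mk A d c (tgen (.H i))

/-- The raising generator `e_i` (denoted `X_i^+` in the standard quantum group). -/
def E (i : Fin l) : Uq A d c := mk A d c (tgen (.E i))

/-- The lowering generator `f_i` (denoted `X_i^-` in the standard quantum group). -/
def F (i : Fin l) : Uq A d c := mk A d c (tgen (.F i))

/-- The exponential `e ^ {h y}`. -/
def exp (y : Free l) : Uq A d c := mk A d c (fexp y)

/-- `K_i = e ^ {d_i h H_i}`. -/
def K (i : Fin l) : Uq A d c := exp A d c ((d i : ℂ) • gen (.H i))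

/-- `K_i ^ {-1} = e ^ {- d_i h H_i}`. -/
def Kinv (i : Fin l) : Uq A d c := exp A d c (-((d i : ℂ) • gen (.H i)))

/-- The element `Y_i`. -/
def Y (i : Fin l) : Uq A d c := mk A d c (PowerSeries.C (weightGen A d i))

/-- `L_i ^ t = e ^ {t h Y_i}` for a complex number `t`. -/
def Lpow (i : Fin l) (t : ℂ) : Uq A d c := exp A d c (t • weightGen A d i)

end Uq

open Uq

variable {A d}

/-- A topological Hopf algebra structure on `U_h(g)` is the standard one if it is given by the
standard formulas on the generators. -/
structure IsStandardHopf (S : TopHopf (Ustd A d)) : Prop where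
  comul_H : ∀ i, S.comul (H A d 0 i) = of _ (H A d 0 i ⊗ₜ 1 + 1 ⊗ₜ H A d 0 i)
  comul_E : ∀ i, S.comul (E A d 0 i) = of _ (E A d 0 i ⊗ₜ K A d 0 i + 1 ⊗ₜ E A d 0 i)
  comul_F : ∀ i, S.comul (F A d 0 i) = of _ (F A d 0 i ⊗ₜ 1 + Kinv A d 0 i ⊗ₜ F A d 0 i)
  counit_H : ∀ i, S.counit (H A d 0 i) = 0
  counit_E : ∀ i, S.counit (E A d 0 i) = 0
  counit_F : ∀ i, S.counit (F A d 0 i) = 0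
  antipode_H : ∀ i, S.antipode (H A d 0 i) = -H A d 0 i
  antipode_E : ∀ i, S.antipode (E A d 0 i) = -(E A d 0 i * Kinv A d 0 i)
  antipode_F : ∀ i, S.antipode (F A d 0 i) = -(K A d 0 i * F A d 0 i)

/-- The isomorphism `ψ_{n}` from the Coxeter realization to the standard quantum group. -/
structure IsCoxeterIso {π : Equiv.Perm (Fin l)} (n : Matrix (Fin l) (Fin l) ℂ)
    (ψ : Ucox A d π ≃ₐ[Ch] Ustd A d) : Prop where
  map_E : ∀ i, ψ (E A d _ i) = E A d 0 i * (List.ofFn fun p => Lpow A d 0 p (n i p)).prod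
  map_F : ∀ i, ψ (F A d _ i) = (List.ofFn fun p => Lpow A d 0 p (-n i p)).prod * F A d 0 i
  map_H : ∀ i, ψ (H A d _ i) = H A d 0 i

variable (A d)

/-- The twisting element `exp (- h ∑_{i,j} (n_ji / d_j) Y_i ⊗ Y_j)` of the completed tensor square
of `U_h(g)`. -/
def twist (n : Matrix (Fin l) (Fin l) ℂ) : Completion (Ustd A d ⊗[Ch] Ustd A d) :=
  expHat (-∑ i, ∑ j, (PowerSeries.C (n j i / (d j : ℂ)) : Ch) • (Y A d 0 i ⊗ₜ[Ch] Y A d 0 j))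

variable {A d}

/-- A topological Hopf algebra structure on the Coxeter realization is the twisted one (for the
solution `n`) if its comultiplication and counit are transported, along the isomorphism `ψ_{n}`,
from the Drinfeld twist `Δ^F(a) = F Δ(a) F⁻¹` of the standard structure of `U_h(g)`. -/
def IsTwistedHopf {π : Equiv.Perm (Fin l)} (n : Matrix (Fin l) (Fin l) ℂ)
    (S : TopHopf (Ucox A d π)) : Prop :=
  ∃ (S₀ : TopHopf (Ustd A d)) (ψ : Ucox A d π ≃ₐ[Ch] Ustd A d)
    (𝓕 : (Completion (Ustd A d ⊗[Ch] Ustd A d))ˣ),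
    IsStandardHopf S₀ ∧ IsCoxeterIso n ψ ∧
    (𝓕 : Completion (Ustd A d ⊗[Ch] Ustd A d)) = twist A d n ∧
    (∀ x, S.comul x =
      mapHat (TensorProduct.map ψ.symm.toLinearMap ψ.symm.toLinearMap)
        (𝓕 * S₀.comul (ψ x) * (𝓕⁻¹ : (Completion (Ustd A d ⊗[Ch] Ustd A d))ˣ))) ∧
    ∀ x, S.counit x = S₀.counit (ψ x)

end Data

/-- The Cartan matrix `a_ij = α_j(H_i)` of a complex semisimple Lie algebra with respect to a
Cartan subalgebra, a base of its root system, and a numbering of the simple roots. -/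
def cartanMatrix {𝔤 : Type*} [LieRing 𝔤] [LieAlgebra ℂ 𝔤] [FiniteDimensional ℂ 𝔤]
    [LieAlgebra.IsKilling ℂ 𝔤] {𝔥 : LieSubalgebra ℂ 𝔤} [𝔥.IsCartanSubalgebra]
    (b : (LieAlgebra.IsKilling.rootSystem 𝔥).Base) {l : ℕ} (e : Fin l ≃ b.support) :
    Matrix (Fin l) (Fin l) ℤ :=
  Matrix.of fun i j => b.cartanMatrix (e j) (e i)

end QGroup

end

/-!
For an antisymmetric exponent matrix `c` the algebra `Uq A d c` carries an explicit Hopf structure,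
and the twisted structure is this one. Let `γ_i = ∑ⱼ (c_ij / d_j) Y_j` be the Cartan element on
which the simple root `αⱼ` takes the value `c_ij`. The comultiplication sends `H_i` to
`H_i ⊗ 1 + 1 ⊗ H_i`, `e_i` to `e_i ⊗ e ^ {h (d_i H_i + γ_i)} + 1 ⊗ e_i` and `f_i` to
`f_i ⊗ e ^ {- h γ_i} + K_i⁻¹ ⊗ f_i`, the counit kills the generators, and the antipode sends `H_i` to
`- H_i`, `e_i` to `- e_i e ^ {- h (d_i H_i + γ_i)}` and `f_i` to `- K_i f_i e ^ {h γ_i}`.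

To see that these maps exist, one checks the defining relations (`IsRep`) for the images of the
generators; the quotient by the closed ideal of relators then has the expected universal property
with respect to `h`-adically complete algebras (`Uq.lift`). The check never divides by `h`, so
nothing about a basis or torsion-freeness of the algebra is needed: the series
`(e ^ {h x} - e ^ {- h x}) / h` is defined by formal division (`hsinh`), and its addition formula is
an identity of formal series. For the Serre relations the `q`-Pascal identities factor the quantum
Serre expression into operators `u ↦ x u - q ^ s u x` (`serreSum_succ`). Hence a `q`-commuting summand
of `x` is invisible to the expression (`serreSum_add_left`), so that on the comultiplied generators
the expression splits into its values on the two tensor factors (`serreSum_add_add`), while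
multiplying the generators by `q`-commuting exponentials only shifts its parameter
(`exists_serreSum_mul`). The Hopf axioms are verified on generators: algebra homomorphisms are
determined there (`Uq.algHom_ext`), and the antipode axioms are stable under products and
`h`-adic limits (`convolution_left_mul`, `convolution_right_mul`, `Uq.mem_of_closed`). The result
is `hopf`.

For `c = 0` this is the standard Hopf algebra (`isStandardHopf_hopf`). The isomorphism `ψ` multiplies
the generators by exponentials of Cartan elements, again by `exists_serreSum_mul` (`twistIso`).
Conjugation by `𝓕`, the exponential of a combination of the `Y_i ⊗ Y_j`, multiplies `x ⊗ 1` and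
`1 ⊗ x`, for a weight vector `x`, by exponentials of Cartan elements in the other tensor factor
(`conj_twist_skew`). On the generators the twisted comultiplication is therefore the explicit one, the
equation `d_j n_ij - d_i n_ji = c_ij` being exactly what produces `γ_i` (`twisted_comul_eq`).

An antipode is unique (`TopHopf.antipode_unique`), so the antipode of any twisted structure is the
explicit one. Its square fixes `H_i` and multiplies `e_i` and `f_i` by `q ^ {2 d_i}` and
`q ^ {- 2 d_i}`, the shift `γ_i` dropping out because `αᵢ(γ_i) = c_ii = 0`. Conjugation by
`e ^ {2 h ρ^∨}` does the same, since `αᵢ(ρ^∨) = d_i` (`antipode_antipode`).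
-/

noncomputable section

namespace HAdic

/-! ### Complete algebras and evaluation of power series at `h` -/

section Complete

variable {B B' : Type*} [Ring B] [Algebra Ch B] [Ring B'] [Algebra Ch B']

/-- `s` is the sum of the `h`-adic series `∑ₖ hᵏ pₖ`, where `pₖ` are the coefficients of `p`, in
the sense that it agrees with each partial sum `∑_{k < n} hᵏ pₖ` modulo `hⁿ`. -/
def IsSum (p : PowerSeries B) (s : B) : Prop :=
  ∀ n : ℕ, ∃ y, s = ∑ k ∈ Finset.range n, (PowerSeries.X ^ k : Ch) • PowerSeries.coeff k p +
    (PowerSeries.X ^ n : Ch) • y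

variable (B) in
/-- An algebra over `ℂ[[h]]` that is `h`-adically Hausdorff and in which every series
`∑ₖ hᵏ bₖ` converges. -/
class HComplete : Prop where
  haus : ∀ x : B, (∀ n : ℕ, ∃ y, x = (PowerSeries.X ^ n : Ch) • y) → x = 0
  exists_sum : ∀ p : PowerSeries B, ∃ s, IsSum p s

theorem eq_of_forall_sub [HComplete B] {x y : B}
    (h : ∀ n : ℕ, ∃ z, x - y = (PowerSeries.X ^ n : Ch) • z) : x = y :=
  sub_eq_zero.1 (HComplete.haus _ h)

theorem IsSum.unique [HComplete B] {p : PowerSeries B} {s t : B} (hs : IsSum p s)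
    (ht : IsSum p t) : s = t := by
  refine eq_of_forall_sub fun n => ?_
  obtain ⟨y, hy⟩ := hs n
  obtain ⟨z, hz⟩ := ht n
  exact ⟨y - z, by rw [hy, hz, smul_sub]; abel⟩

theorem IsSum.add {p q : PowerSeries B} {s t : B} (hs : IsSum p s) (ht : IsSum q t) :
    IsSum (p + q) (s + t) := by
  intro n
  obtain ⟨y, hy⟩ := hs n
  obtain ⟨z, hz⟩ := ht n
  refine ⟨y + z, ?_⟩
  simp only [map_add, smul_add, Finset.sum_add_distrib]
  nth_rewrite 1 [hy]
  nth_rewrite 1 [hz]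
  abel

theorem IsSum.mul {p q : PowerSeries B} {s t : B} (hs : IsSum p s) (ht : IsSum q t) :
    IsSum (p * q) (s * t) := by
  intro n
  obtain ⟨y, hy⟩ := hs n
  obtain ⟨z, hz⟩ := ht n
  set a : ℕ → B := fun k => PowerSeries.coeff k p
  set b : ℕ → B := fun k => PowerSeries.coeff k q
  have key : (∑ k ∈ Finset.range n, (PowerSeries.X ^ k : Ch) • PowerSeries.coeff k (p * q)) =
      ∑ i ∈ Finset.range n, ∑ j ∈ Finset.range (n - i),
        (PowerSeries.X ^ (i + j) : Ch) • (a i * b j) := by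
    rw [← Finset.sum_range_diag_flip n
      (fun i j => (PowerSeries.X ^ (i + j) : Ch) • (a i * b j))]
    refine Finset.sum_congr rfl fun k _ => ?_
    rw [PowerSeries.coeff_mul, Finset.smul_sum,
      Finset.Nat.sum_antidiagonal_eq_sum_range_succ_mk]
    refine Finset.sum_congr rfl fun i hi => ?_
    rw [Nat.add_sub_cancel' (Nat.lt_succ_iff.1 (Finset.mem_range.1 hi))]
  have prod : (∑ i ∈ Finset.range n, (PowerSeries.X ^ i : Ch) • a i) *
      (∑ j ∈ Finset.range n, (PowerSeries.X ^ j : Ch) • b j) =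
      (∑ i ∈ Finset.range n, ∑ j ∈ Finset.range (n - i),
        (PowerSeries.X ^ (i + j) : Ch) • (a i * b j)) + (PowerSeries.X ^ n : Ch) •
      ∑ i ∈ Finset.range n, ∑ j ∈ Finset.Ico (n - i) n,
        (PowerSeries.X ^ (i + j - n) : Ch) • (a i * b j) := by
    rw [Finset.sum_mul_sum, Finset.smul_sum, ← Finset.sum_add_distrib]
    refine Finset.sum_congr rfl fun i hi => ?_
    rw [Finset.smul_sum, ← Finset.sum_range_add_sum_Ico _ (Nat.sub_le n i)]
    congr 1
    · exact Finset.sum_congr rfl fun j _ => by rw [smul_mul_smul_comm, ← pow_add]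
    · refine Finset.sum_congr rfl fun j hj => ?_
      rw [smul_mul_smul_comm, ← pow_add, smul_smul, ← pow_add]
      have := (Finset.mem_Ico.1 hj).1
      congr 2
      omega
  refine ⟨(∑ i ∈ Finset.range n, ∑ j ∈ Finset.Ico (n - i) n,
        (PowerSeries.X ^ (i + j - n) : Ch) • (a i * b j)) + y * t +
        (∑ i ∈ Finset.range n, (PowerSeries.X ^ i : Ch) • a i) * z, ?_⟩
  rw [key, smul_add, smul_add, ← add_assoc, ← add_assoc, ← prod]
  conv_lhs => rw [hy, add_mul]
  nth_rewrite 1 [hz]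
  rw [mul_add, mul_smul_comm, smul_mul_assoc]
  abel

theorem IsSum.map {p : PowerSeries B} {s : B} (hs : IsSum p s) (φ : B →ₐ[Ch] B') :
    IsSum (PowerSeries.map (φ : B →+* B') p) (φ s) := by
  intro n
  obtain ⟨y, hy⟩ := hs n
  exact ⟨φ y, by simp [hy]⟩

theorem isSum_C (b : B) : IsSum (PowerSeries.C b) b := by
  rintro (_ | n)
  · exact ⟨b, by simp⟩
  · refine ⟨0, ?_⟩
    rw [Finset.sum_range_succ', Finset.sum_eq_zero]
    · simp
    · intro k _
      rw [PowerSeries.coeff_C, if_neg (Nat.succ_ne_zero k), smul_zero]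

variable [HComplete B] [HComplete B']

variable (B) in
/-- Evaluation of a power series at the indeterminate `h`: the sum of `∑ₖ hᵏ pₖ`. -/
def ev : PowerSeries B →+* B where
  toFun p := (HComplete.exists_sum p).choose
  map_one' := IsSum.unique (HComplete.exists_sum _).choose_spec (by
    rw [← map_one (PowerSeries.C (R := B))]; exact isSum_C 1)
  map_zero' := IsSum.unique (HComplete.exists_sum _).choose_spec (by
    rw [← map_zero (PowerSeries.C (R := B))]; exact isSum_C 0)
  map_mul' p q := IsSum.unique (HComplete.exists_sum _).choose_spec
    ((HComplete.exists_sum p).choose_spec.mul (HComplete.exists_sum q).choose_spec)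
  map_add' p q := IsSum.unique (HComplete.exists_sum _).choose_spec
    ((HComplete.exists_sum p).choose_spec.add (HComplete.exists_sum q).choose_spec)

theorem isSum_ev (p : PowerSeries B) : IsSum p (ev B p) := (HComplete.exists_sum p).choose_spec

theorem IsSum.ev_eq {p : PowerSeries B} {s : B} (h : IsSum p s) : ev B p = s :=
  (isSum_ev p).unique h

@[simp] theorem ev_C (b : B) : ev B (PowerSeries.C b) = b := (isSum_C b).ev_eq

theorem map_ev (φ : B →ₐ[Ch] B') (p : PowerSeries B) :
    φ (ev B p) = ev B' (PowerSeries.map (φ : B →+* B') p) :=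
  (((isSum_ev p).map φ).ev_eq).symm

end Complete

/-! ### Examples of complete algebras -/

section Examples

theorem powerSeries_eq_sum_add {R : Type*} [Semiring R] (p : PowerSeries R) (n : ℕ) :
    p = ∑ k ∈ Finset.range n, PowerSeries.X ^ k * PowerSeries.C (PowerSeries.coeff k p) +
      PowerSeries.X ^ n * PowerSeries.mk fun i => PowerSeries.coeff (i + n) p := by
  ext m
  simp only [map_add, map_sum, PowerSeries.coeff_X_pow_mul', PowerSeries.coeff_mk,
    PowerSeries.coeff_C]
  by_cases h : n ≤ m
  · rw [Finset.sum_eq_zero, if_pos h, Nat.sub_add_cancel h, zero_add]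
    intro k hk
    have := Finset.mem_range.1 hk
    rw [if_neg (show ¬ m - k = 0 by omega), ite_self]
  · rw [if_neg h, add_zero, Finset.sum_eq_single m]
    · simp
    · intro k _ hk
      by_cases hkm : k ≤ m
      · rw [if_pos hkm, if_neg (show ¬ m - k = 0 by omega)]
      · rw [if_neg hkm]
    · intro hm
      exact absurd (Finset.mem_range.2 (not_le.1 h)) hm

section PowerSeries

variable {R : Type*} [Ring R] [Algebra Ch (PowerSeries R)]

/-- A power series algebra on which `h` acts as the variable is complete. -/
theorem hComplete_powerSeries
    (hX : ∀ (n : ℕ) (p : PowerSeries R), (PowerSeries.X ^ n : Ch) • p = PowerSeries.X ^ n * p) :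
    HComplete (PowerSeries R) where
  haus p hp := by
    ext m
    obtain ⟨y, rfl⟩ := hp (m + 1)
    rw [hX, PowerSeries.coeff_X_pow_mul', if_neg (by omega), map_zero]
  exists_sum P := by
    refine ⟨PowerSeries.mk fun m => ∑ k ∈ Finset.range (m + 1),
      PowerSeries.coeff (m - k) (PowerSeries.coeff k P), fun n => ⟨PowerSeries.mk fun m =>
      ∑ k ∈ Finset.range (m + 1), PowerSeries.coeff (m - k) (PowerSeries.coeff (n + k) P), ?_⟩⟩
    ext m
    simp only [hX, map_add, map_sum, PowerSeries.coeff_X_pow_mul', PowerSeries.coeff_mk]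
    by_cases h : n ≤ m
    · rw [if_pos h, show m + 1 = n + (m - n + 1) by omega, Finset.sum_range_add]
      congr 1
      · refine Finset.sum_congr rfl fun k hk => ?_
        have := Finset.mem_range.1 hk
        rw [if_pos (show k ≤ m by omega)]
      · exact Finset.sum_congr rfl fun k hk => by rw [Nat.sub_add_eq]
    · rw [if_neg h, add_zero]
      have hmn : m + 1 ≤ n := by omega
      rw [← Finset.sum_range_add_sum_Ico _ hmn]
      rw [Finset.sum_eq_zero (s := Finset.Ico (m + 1) n), add_zero]
      · refine Finset.sum_congr rfl fun k hk => ?_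
        have := Finset.mem_range.1 hk
        rw [if_pos (show k ≤ m by omega)]
      · intro k hk
        have := (Finset.mem_Ico.1 hk).1
        rw [if_neg (by omega)]

/-- Every power series is the `h`-adic sum of its own coefficients, taken as constant series. -/
theorem isSum_map_C
    (hX : ∀ (n : ℕ) (p : PowerSeries R), (PowerSeries.X ^ n : Ch) • p = PowerSeries.X ^ n * p)
    (p : PowerSeries R) : IsSum (PowerSeries.map (PowerSeries.C (R := R)) p) p := by
  intro n
  refine ⟨PowerSeries.mk fun i => PowerSeries.coeff (i + n) p, ?_⟩
  simpa only [hX, PowerSeries.coeff_map] using powerSeries_eq_sum_add p n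

end PowerSeries

instance : HComplete Ch := hComplete_powerSeries fun _ _ => rfl

/-- The coefficientwise scalar map `ℂ[[h]] → B[[h]]` followed by evaluation is the structure
map. -/
theorem ev_map_C {B : Type*} [Ring B] [Algebra Ch B] [HComplete B] (p : Ch) :
    ev B (PowerSeries.map ((algebraMap Ch B).comp (PowerSeries.C (R := ℂ))) p) =
      algebraMap Ch B p := by
  have h := map_ev (Algebra.ofId Ch B) (PowerSeries.map (PowerSeries.C (R := ℂ)) p)
  rw [(isSum_map_C (fun _ _ => rfl) p).ev_eq] at h
  rw [← Algebra.ofId_apply, h]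
  rfl

variable {A : Type*} [Ring A] [Algebra Ch A]

instance [HComplete A] : HComplete Aᵐᵒᵖ where
  haus x hx := by
    rw [← MulOpposite.unop_eq_zero_iff]
    refine HComplete.haus _ fun n => ?_
    obtain ⟨y, rfl⟩ := hx n
    exact ⟨y.unop, rfl⟩
  exists_sum p := by
    obtain ⟨s, hs⟩ := HComplete.exists_sum
      (PowerSeries.mk fun k => (PowerSeries.coeff k p).unop : PowerSeries A)
    refine ⟨MulOpposite.op s, fun n => ?_⟩
    obtain ⟨y, hy⟩ := hs n
    refine ⟨MulOpposite.op y, MulOpposite.unop_injective ?_⟩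
    simp only [MulOpposite.unop_op, MulOpposite.unop_add, MulOpposite.unop_smul,
      Finset.unop_sum, hy, PowerSeries.coeff_mk]

theorem subset_closedIdeal {s : Set A} {x : A} (hx : x ∈ s) : x ∈ closedIdeal s :=
  fun _ => ⟨x, TwoSidedIdeal.subset_span hx, 0, by simp⟩

instance [HComplete A] (s : Set A) : HComplete (A ⧸ closedIdeal s) where
  haus x hx := by
    obtain ⟨a, rfl⟩ := Ideal.Quotient.mk_surjective x
    refine Ideal.Quotient.eq_zero_iff_mem.2 fun n => ?_
    obtain ⟨y, hy⟩ := hx n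
    obtain ⟨b, rfl⟩ := Ideal.Quotient.mk_surjective y
    have hab : Ideal.Quotient.mk (closedIdeal s) a =
        Ideal.Quotient.mk (closedIdeal s) ((PowerSeries.X ^ n : Ch) • b) := hy
    obtain ⟨z, hz, w, hw⟩ := (Ideal.Quotient.mk_eq_mk_iff_sub_mem _ _).1 hab n
    exact ⟨z, hz, w + b, by rw [smul_add, ← add_assoc, ← hw, sub_add_cancel]⟩
  exists_sum p := by
    obtain ⟨q, rfl⟩ := PowerSeries.map_surjective
      (Ideal.Quotient.mk (closedIdeal s)) Ideal.Quotient.mk_surjective p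
    obtain ⟨t, ht⟩ := HComplete.exists_sum q
    exact ⟨_, ht.map (Ideal.Quotient.mkₐ Ch (closedIdeal s))⟩

theorem proj_smul_X_pow (n : ℕ) (x : Completion A) :
    proj A n ((PowerSeries.X ^ n : Ch) • x) = 0 := by
  rw [map_smul]
  obtain ⟨a, ha⟩ := Ideal.Quotient.mk_surjective (proj A n x)
  rw [← ha]
  exact Ideal.Quotient.eq_zero_iff_mem.2 ⟨a, rfl⟩

theorem completion_ext {x y : Completion A} (h : ∀ n, proj A n x = proj A n y) : x = y :=
  Subtype.ext (funext h)

theorem factor_proj {m n : ℕ} (h : m ≤ n) (x : Completion A) :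
    Ideal.Quotient.factor (hIdeal_anti A h) (proj A n x) = proj A m x := x.2 h

/-- Elements of the completion are approximated by elements of the algebra. -/
theorem exists_proj_eq_proj_of (x : Completion A) (n : ℕ) : ∃ a, proj A n x = proj A n (of A a) := by
  obtain ⟨a, ha⟩ := Ideal.Quotient.mk_surjective (proj A n x)
  exact ⟨a, ha.symm⟩

theorem proj_sum_range {p : PowerSeries (Completion A)} {m n : ℕ} (h : m ≤ n) :
    proj A m (∑ k ∈ Finset.range n, (PowerSeries.X ^ k : Ch) • PowerSeries.coeff k p) =
      proj A m (∑ k ∈ Finset.range m, (PowerSeries.X ^ k : Ch) • PowerSeries.coeff k p) := by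
  rw [← Finset.sum_range_add_sum_Ico _ h, map_add, add_eq_left, map_sum]
  refine Finset.sum_eq_zero fun k hk => ?_
  obtain ⟨j, rfl⟩ := Nat.exists_eq_add_of_le (Finset.mem_Ico.1 hk).1
  rw [pow_add, mul_smul, proj_smul_X_pow]

/-- The sum of an `h`-adic series in a completion, computed level by level. -/
def completionSum (p : PowerSeries (Completion A)) : Completion A :=
  ⟨fun n => proj A n (∑ k ∈ Finset.range n, (PowerSeries.X ^ k : Ch) • PowerSeries.coeff k p), by
    intro m n h
    rw [factor_proj h, proj_sum_range h]⟩

theorem proj_completionSum (p : PowerSeries (Completion A)) (n : ℕ) :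
    proj A n (completionSum p) =
      proj A n (∑ k ∈ Finset.range n, (PowerSeries.X ^ k : Ch) • PowerSeries.coeff k p) := rfl

instance : HComplete (Completion A) where
  haus x hx := by
    refine completion_ext fun n => ?_
    obtain ⟨y, rfl⟩ := hx n
    rw [proj_smul_X_pow, map_zero]
  exists_sum p := by
    refine ⟨completionSum p, fun n => ⟨completionSum
      (PowerSeries.mk fun k => PowerSeries.coeff (n + k) p), completion_ext fun m => ?_⟩⟩
    rw [map_add, map_smul, proj_completionSum, proj_completionSum, ← map_smul, ← map_add,
      ← proj_sum_range (p := p) (Nat.le_add_left m n), Finset.sum_range_add, Finset.smul_sum]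
    simp only [PowerSeries.coeff_mk, smul_smul, pow_add]

theorem of_injective [HComplete A] : Function.Injective (of A) := by
  rw [injective_iff_map_eq_zero]
  intro a ha
  refine HComplete.haus a fun n => ?_
  have h : proj A n (of A a) = 0 := by rw [ha, map_zero]
  exact Ideal.Quotient.eq_zero_iff_mem.1 h

theorem HComplete.isAdicComplete [HComplete A] :
    IsAdicComplete (Ideal.span {(PowerSeries.X : Ch)}) A := by
  have key : ∀ (n : ℕ) (x y : A), x ≡ y [SMOD ((Ideal.span {(PowerSeries.X : Ch)}) ^ n • ⊤ :
      Submodule Ch A)] ↔ ∃ z, x - y = (PowerSeries.X ^ n : Ch) • z := by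
    intro n x y
    rw [SModEq.sub_mem, Ideal.span_singleton_pow, Submodule.ideal_span_singleton_smul,
      Submodule.mem_smul_pointwise_iff_exists]
    simp only [Submodule.mem_top, true_and, eq_comm]
  refine { haus' := fun x hx => ?_, prec' := fun f hf => ?_ }
  · refine HComplete.haus x fun n => ?_
    obtain ⟨z, hz⟩ := (key n x 0).1 (hx n)
    exact ⟨z, by rw [← hz, sub_zero]⟩
  · have hg : ∀ n, ∃ z, f (n + 1) - f n = (PowerSeries.X ^ n : Ch) • z := fun n => by
      obtain ⟨z, hz⟩ := (key n _ _).1 (hf (Nat.le_succ n))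
      exact ⟨-z, by rw [smul_neg, ← hz, neg_sub]⟩
    choose g hg using hg
    obtain ⟨s, hs⟩ := HComplete.exists_sum (PowerSeries.mk g)
    refine ⟨f 0 + s, fun n => (key n _ _).2 ?_⟩
    obtain ⟨y, hy⟩ := hs n
    refine ⟨-y, ?_⟩
    simp only [PowerSeries.coeff_mk, ← hg, Finset.sum_range_sub] at hy
    rw [hy, smul_neg]
    abel

end Examples

/-! ### The exponential series -/

section Exp

variable {B B' : Type*} [Ring B] [Algebra Ch B] [Ring B'] [Algebra Ch B']

/-- The formal exponential series `∑ₖ xᵏ tᵏ / k!` in `B[[t]]`. -/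
def expSeries (x : B) : PowerSeries B :=
  PowerSeries.mk fun k => (PowerSeries.C ((k.factorial : ℂ)⁻¹) : Ch) • x ^ k

/-- The formal series `(e ^ {t x} - e ^ {- t x}) / t` in `B[[t]]`. -/
def sinhSeries (x : B) : PowerSeries B := QGroup.divh (expSeries x - expSeries (-x))

theorem X_mul_divh {R : Type*} [Semiring R] {f : PowerSeries R}
    (hf : PowerSeries.coeff 0 f = 0) : PowerSeries.X * QGroup.divh f = f := by
  ext (_ | n)
  · simpa using hf.symm
  · simp [QGroup.divh, PowerSeries.coeff_succ_X_mul]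

theorem map_divh {R S : Type*} [Semiring R] [Semiring S] (φ : R →+* S) (f : PowerSeries R) :
    PowerSeries.map φ (QGroup.divh f) = QGroup.divh (PowerSeries.map φ f) := by
  ext n
  simp [QGroup.divh]

theorem divh_neg {R : Type*} [Ring R] (f : PowerSeries R) :
    QGroup.divh (-f) = -QGroup.divh f := by
  ext n
  simp [QGroup.divh]

theorem map_expSeries (φ : B →ₐ[Ch] B') (x : B) :
    PowerSeries.map (φ : B →+* B') (expSeries x) = expSeries (φ x) := by
  ext n
  simp [expSeries]

theorem map_sinhSeries (φ : B →ₐ[Ch] B') (x : B) :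
    PowerSeries.map (φ : B →+* B') (sinhSeries x) = sinhSeries (φ x) := by
  rw [sinhSeries, map_divh, map_sub, map_expSeries, map_expSeries, map_neg, sinhSeries]

theorem expSeries_add {x y : B} (h : Commute x y) :
    expSeries (x + y) = expSeries x * expSeries y := by
  ext n
  rw [PowerSeries.coeff_mul]
  simp only [expSeries, PowerSeries.coeff_mk]
  rw [h.add_pow', Finset.smul_sum]
  refine Finset.sum_congr rfl fun p hp => ?_
  rw [smul_mul_smul_comm, ← map_mul, ← Nat.cast_smul_eq_nsmul Ch, smul_smul]
  congr 1
  rw [← map_natCast (PowerSeries.C (R := ℂ)), ← map_mul]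
  congr 1
  obtain rfl := Finset.HasAntidiagonal.mem_antidiagonal.1 hp
  have h1 : (p.1.factorial : ℂ) ≠ 0 := by exact_mod_cast p.1.factorial_ne_zero
  have h2 : (p.2.factorial : ℂ) ≠ 0 := by exact_mod_cast p.2.factorial_ne_zero
  have h3 : ((p.1 + p.2).factorial : ℂ) ≠ 0 := by exact_mod_cast (p.1 + p.2).factorial_ne_zero
  have h4 : (((p.1 + p.2).choose p.1 : ℕ) : ℂ) * p.1.factorial * p.2.factorial =
      (p.1 + p.2).factorial := by
    rw [Nat.choose_symm_add]
    exact_mod_cast Nat.add_choose_mul_factorial_mul_factorial p.1 p.2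
  field_simp
  rw [← h4]

theorem expSeries_zero : expSeries (0 : B) = 1 := by
  ext (_ | n)
  · simp [expSeries]
  · simp [expSeries, PowerSeries.coeff_one]

theorem coeff_zero_expSeries (x : B) : PowerSeries.coeff 0 (expSeries x) = 1 := by
  simp [expSeries]

theorem X_mul_sinhSeries (x : B) :
    PowerSeries.X * sinhSeries x = expSeries x - expSeries (-x) :=
  X_mul_divh (by rw [map_sub, coeff_zero_expSeries, coeff_zero_expSeries, sub_self])

theorem sinhSeries_neg (x : B) : sinhSeries (-x) = -sinhSeries x := by
  rw [sinhSeries, sinhSeries, ← divh_neg, neg_neg, neg_sub]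

theorem sinhSeries_add {x y : B} (h : Commute x y) :
    sinhSeries (x + y) = sinhSeries x * expSeries y + expSeries (-x) * sinhSeries y := by
  refine PowerSeries.X_mul_cancel ?_
  have hc : PowerSeries.X * (expSeries (-x) * sinhSeries y) =
      expSeries (-x) * (PowerSeries.X * sinhSeries y) := by
    rw [← mul_assoc, ← mul_assoc, (PowerSeries.commute_X _).eq]
  rw [mul_add, hc, ← mul_assoc, X_mul_sinhSeries, X_mul_sinhSeries, X_mul_sinhSeries, neg_add,
    expSeries_add h, expSeries_add (h.neg_left.neg_right), sub_mul, mul_sub]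
  abel

theorem expSeries_mul_C {y z y' : B} (h : y * z = z * y') :
    expSeries y * PowerSeries.C z = PowerSeries.C z * expSeries y' := by
  ext n
  have hn : y ^ n * z = z * y' ^ n :=
    (SemiconjBy.pow_right (a := z) (x := y') (y := y) h.symm n).symm
  simp [expSeries, hn]

variable [HComplete B] [HComplete B']

/-- The exponential `e ^ {h x}` in a complete algebra. -/
def hexp (x : B) : B := ev B (expSeries x)

/-- The element `(e ^ {h x} - e ^ {- h x}) / h` of a complete algebra, where the division is
performed on the level of formal series. -/
def hsinh (x : B) : B := ev B (sinhSeries x)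

theorem map_hexp (φ : B →ₐ[Ch] B') (x : B) : φ (hexp x) = hexp (φ x) := by
  rw [hexp, map_ev, map_expSeries, hexp]

theorem map_hsinh (φ : B →ₐ[Ch] B') (x : B) : φ (hsinh x) = hsinh (φ x) := by
  rw [hsinh, map_ev, map_sinhSeries, hsinh]

theorem hexp_zero : hexp (0 : B) = 1 := by rw [hexp, expSeries_zero, map_one]

theorem hexp_add {x y : B} (h : Commute x y) : hexp (x + y) = hexp x * hexp y := by
  rw [hexp, expSeries_add h, map_mul, hexp, hexp]

theorem hexp_mul_hexp_neg (x : B) : hexp x * hexp (-x) = 1 := by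
  rw [← hexp_add (Commute.refl x).neg_right, add_neg_cancel, hexp_zero]

theorem hsinh_neg (x : B) : hsinh (-x) = -hsinh x := by
  rw [hsinh, sinhSeries_neg, map_neg, hsinh]

theorem hsinh_zero : hsinh (0 : B) = 0 := by
  have h : sinhSeries (0 : B) = 0 := by
    rw [sinhSeries, neg_zero, sub_self]
    ext n
    simp [QGroup.divh]
  rw [hsinh, h, map_zero]

theorem hsinh_add {x y : B} (h : Commute x y) :
    hsinh (x + y) = hsinh x * hexp y + hexp (-x) * hsinh y := by
  rw [hsinh, sinhSeries_add h, map_add, map_mul, map_mul, hsinh, hexp, hexp, hsinh]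

/-- If `y z = z y'` then `e ^ {h y} z = z e ^ {h y'}`. -/
theorem hexp_mul {y z y' : B} (h : y * z = z * y') : hexp y * z = z * hexp y' := by
  have := congrArg (ev B) (expSeries_mul_C h)
  rwa [map_mul, map_mul, ev_C] at this

theorem hexp_algebraMap (c : ℂ) :
    hexp (algebraMap Ch B (PowerSeries.C c)) = algebraMap Ch B (QGroup.qpow c) := by
  have h : QGroup.qpow c = hexp (PowerSeries.C c) := by
    refine (IsSum.ev_eq ?_).symm
    convert isSum_map_C (fun _ _ => rfl) (QGroup.qpow c) using 1
    ext1 n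
    simp [expSeries, QGroup.qpow, PowerSeries.coeff_map, div_eq_inv_mul]
  rw [h]
  exact (map_hexp (Algebra.ofId Ch B) _).symm

/-- The exponential defined level by level in a completion is the sum of the exponential
series. -/
theorem expHat_eq_hexp {A : Type*} [Ring A] [Algebra Ch A] (x : A) : expHat x = hexp (of A x) := by
  refine completion_ext fun n => ?_
  obtain ⟨y, hy⟩ := isSum_ev (expSeries (of A x)) n
  rw [hexp, hy, map_add, proj_smul_X_pow, add_zero]
  change proj A n (of A _) = _
  congr 1
  rw [map_sum]
  refine Finset.sum_congr rfl fun k _ => ?_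
  rw [map_smul, map_pow, expSeries, PowerSeries.coeff_mk, smul_smul, PowerSeries.X_pow_eq,
    ← PowerSeries.monomial_zero_eq_C_apply, PowerSeries.monomial_mul_monomial, one_mul, add_zero]

end Exp

end HAdic
end

noncomputable section

namespace HAdic

/-! ### Functoriality of completions -/

section Functor

variable {A B C D : Type*} [Ring A] [Algebra Ch A] [Ring B] [Algebra Ch B] [Ring C]
  [Algebra Ch C] [Ring D] [Algebra Ch D]

/-- The kernel of the projection of the completion to `A / hⁿ A` is generated by `hⁿ`. -/
theorem exists_smul_of_proj_eq_zero {x : Completion A} {n : ℕ} (hx : proj A n x = 0) :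
    ∃ y, x = (PowerSeries.X ^ n : Ch) • y := by
  choose a ha using fun m => exists_proj_eq_proj_of x m
  have hb : ∀ m, ∃ b, a (m + 1) - a m = (PowerSeries.X ^ m : Ch) • b := by
    intro m
    have h1 : proj A m (of A (a (m + 1))) = proj A m (of A (a m)) := by
      rw [← ha, ← factor_proj (Nat.le_succ m), ← factor_proj (Nat.le_succ m), ← ha]
    exact (Ideal.Quotient.mk_eq_mk_iff_sub_mem _ _).1 h1
  choose b hb using hb
  obtain ⟨c, hc⟩ : ∃ c, a n = (PowerSeries.X ^ n : Ch) • c := by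
    rw [ha n] at hx
    exact Ideal.Quotient.eq_zero_iff_mem.1 hx
  refine ⟨of A c + completionSum (PowerSeries.mk fun k => of A (b (n + k))),
    completion_ext fun m => ?_⟩
  rw [← factor_proj (Nat.le_add_left m n), ← factor_proj (Nat.le_add_left m n) (_ • _)]
  congr 1
  have ham : a (n + m) =
      a n + ∑ k ∈ Finset.range m, (PowerSeries.X ^ (n + k) : Ch) • b (n + k) := by
    have := Finset.sum_range_sub (fun k => a (n + k)) m
    rw [add_zero] at this
    rw [← add_sub_cancel (a n) (a (n + m)), ← this]
    simp only [← hb, ← add_assoc]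
  rw [ha, ham, hc]
  have hsum : proj A (n + m) ((PowerSeries.X ^ n : Ch) • ∑ k ∈ Finset.range (n + m),
      (PowerSeries.X ^ k : Ch) • of A (b (n + k))) = proj A (n + m) (of A
        (∑ k ∈ Finset.range m, (PowerSeries.X ^ (n + k) : Ch) • b (n + k))) := by
    have h0 : proj A (m + n) ((PowerSeries.X ^ n : Ch) • ∑ x ∈ Finset.range n,
        (PowerSeries.X ^ (m + x) : Ch) • of A (b (n + (m + x)))) = 0 := by
      rw [Finset.smul_sum, map_sum]
      refine Finset.sum_eq_zero fun k _ => ?_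
      rw [smul_smul, ← pow_add, show n + (m + k) = (m + n) + k by omega, pow_add, mul_smul,
        proj_smul_X_pow]
    rw [add_comm n m, Finset.sum_range_add, smul_add, map_add, h0, add_zero, map_sum,
      Finset.smul_sum]
    simp only [smul_smul, ← pow_add, map_smul]
  have hCS : proj A (n + m) ((PowerSeries.X ^ n : Ch) • completionSum
      (PowerSeries.mk fun k => of A (b (n + k)))) = proj A (n + m) (of A
        (∑ k ∈ Finset.range m, (PowerSeries.X ^ (n + k) : Ch) • b (n + k))) := by
    rw [map_smul, proj_completionSum, ← map_smul]
    simpa only [PowerSeries.coeff_mk] using hsum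
  rw [smul_add, map_add (of A), map_add (proj A (n + m)), map_add (proj A (n + m)), hCS,
    map_smul (of A)]

/-- Linear maps out of a completion are automatically continuous, hence determined by their
values on the dense subalgebra. -/
theorem linearMap_ext_of {f g : Completion A →ₗ[Ch] Completion B}
    (h : ∀ a, f (of A a) = g (of A a)) : f = g := by
  ext1 x
  refine eq_of_forall_sub fun n => ?_
  obtain ⟨a, ha⟩ := exists_proj_eq_proj_of x n
  obtain ⟨y, hy⟩ := exists_smul_of_proj_eq_zero (x := x - of A a) (n := n)
    (by rw [map_sub, ha, sub_self])
  refine ⟨f y - g y, ?_⟩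
  rw [smul_sub, ← map_smul, ← map_smul, ← hy, map_sub, map_sub, h]
  abel

theorem linearMap_ext_of_tmul {f g : Completion (A ⊗[Ch] C) →ₗ[Ch] Completion B}
    (h : ∀ a c, f (of _ (a ⊗ₜ c)) = g (of _ (a ⊗ₜ c))) : f = g := by
  refine linearMap_ext_of fun t => ?_
  induction t with
  | zero => simp
  | tmul a c => exact h a c
  | add x y hx hy => rw [map_add, map_add, map_add, hx, hy]

theorem mapHat_of (f : A →ₗ[Ch] B) (a : A) : mapHat f (of A a) = of B (f a) := rfl

theorem proj_extend (φ : A →ₗ[Ch] Completion B) (n : ℕ) (x : Completion A) :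
    proj B n (extend φ x) = levelMap φ n (proj A n x) := rfl

/-- The extension of an algebra homomorphism `A → B^` to the completion of `A`. -/
def extendAlg (φ : A →ₐ[Ch] Completion B) : Completion A →ₐ[Ch] Completion B :=
  AlgHom.ofLinearMap (extend φ.toLinearMap)
    (by rw [← map_one (of A), extend_of, AlgHom.toLinearMap_apply, map_one])
    (by
      intro x y
      refine completion_ext fun n => ?_
      obtain ⟨a, ha⟩ := exists_proj_eq_proj_of x n
      obtain ⟨b, hb⟩ := exists_proj_eq_proj_of y n
      have hx : proj B n (extend φ.toLinearMap x) = proj B n (φ a) := by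
        rw [proj_extend, ha]
        rfl
      have hy : proj B n (extend φ.toLinearMap y) = proj B n (φ b) := by
        rw [proj_extend, hb]
        rfl
      have hxy : proj B n (extend φ.toLinearMap (x * y)) = proj B n (φ (a * b)) := by
        rw [proj_extend, map_mul, ha, hb, ← map_mul, ← map_mul]
        rfl
      rw [hxy, map_mul φ, map_mul (proj B n), map_mul (proj B n), hx, hy])

theorem extendAlg_apply (φ : A →ₐ[Ch] Completion B) (x : Completion A) :
    extendAlg φ x = extend φ.toLinearMap x := rfl

/-- The algebra homomorphism between completions induced by an algebra homomorphism. -/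
def mapHatAlg (f : A →ₐ[Ch] B) : Completion A →ₐ[Ch] Completion B :=
  extendAlg ((of B).comp f)

theorem mapHatAlg_apply (f : A →ₐ[Ch] B) (x : Completion A) :
    mapHatAlg f x = mapHat f.toLinearMap x := rfl

theorem mapHatAlg_of (f : A →ₐ[Ch] B) (a : A) : mapHatAlg f (of A a) = of B (f a) := rfl

theorem pairing_apply (x : Completion A) (y : Completion B) :
    pairing x y = mapHatAlg (Algebra.TensorProduct.includeLeft : A →ₐ[Ch] A ⊗[Ch] B) x *
      mapHatAlg (Algebra.TensorProduct.includeRight : B →ₐ[Ch] A ⊗[Ch] B) y := rfl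

theorem commute_mapHatAlg_include (x : Completion A) (y : Completion B) :
    Commute (mapHatAlg (Algebra.TensorProduct.includeLeft : A →ₐ[Ch] A ⊗[Ch] B) x)
      (mapHatAlg (Algebra.TensorProduct.includeRight : B →ₐ[Ch] A ⊗[Ch] B) y) := by
  refine completion_ext fun n => ?_
  obtain ⟨a, ha⟩ := exists_proj_eq_proj_of x n
  obtain ⟨b, hb⟩ := exists_proj_eq_proj_of y n
  rw [map_mul, map_mul, mapHatAlg, mapHatAlg, extendAlg_apply, extendAlg_apply, proj_extend,
    proj_extend, ha, hb, ← proj_extend, ← proj_extend, extend_of, extend_of, ← map_mul, ← map_mul]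
  simp [← map_mul]

theorem commute_comp_include (φ : A →ₐ[Ch] Completion B) (χ : C →ₐ[Ch] Completion D) (a : A)
    (c : C) : Commute
      (((mapHatAlg (Algebra.TensorProduct.includeLeft : B →ₐ[Ch] B ⊗[Ch] D)).comp φ) a)
      (((mapHatAlg (Algebra.TensorProduct.includeRight : D →ₐ[Ch] B ⊗[Ch] D)).comp χ) c) :=
  commute_mapHatAlg_include (φ a) (χ c)

/-- The completed tensor product of two algebra homomorphisms. -/
def tensorHatAlg (φ : A →ₐ[Ch] Completion B) (χ : C →ₐ[Ch] Completion D) :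
    Completion (A ⊗[Ch] C) →ₐ[Ch] Completion (B ⊗[Ch] D) :=
  extendAlg (Algebra.TensorProduct.lift
    ((mapHatAlg (Algebra.TensorProduct.includeLeft : B →ₐ[Ch] B ⊗[Ch] D)).comp φ)
    ((mapHatAlg (Algebra.TensorProduct.includeRight : D →ₐ[Ch] B ⊗[Ch] D)).comp χ)
    (commute_comp_include φ χ))

theorem tensorHatAlg_apply (φ : A →ₐ[Ch] Completion B) (χ : C →ₐ[Ch] Completion D)
    (x : Completion (A ⊗[Ch] C)) :
    tensorHatAlg φ χ x = tensorHat φ.toLinearMap χ.toLinearMap x := by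
  have : (tensorHatAlg φ χ).toLinearMap = tensorHat φ.toLinearMap χ.toLinearMap :=
    linearMap_ext_of_tmul fun a c => by
      change extend _ (of _ _) = tensorHat _ _ _
      rw [extend_of, tensorHat_of, pairing_apply]
      rw [AlgHom.toLinearMap_apply, Algebra.TensorProduct.lift_tmul]
      rfl
  exact LinearMap.congr_fun this x

end Functor

/-! ### Antipodes -/

section Antipode

variable {A : Type*} [Ring A] [Algebra Ch A]

/-- If `S` reverses products and `∑ S(p₁) p₂` is a scalar `r`, then
`∑ S((pq)₁) (pq)₂ = r ∑ S(q₁) q₂`. -/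
theorem convolution_left_mul {S : A →ₗ[Ch] A} (hS : ∀ a b, S (a * b) = S b * S a)
    {P Q : Completion (A ⊗[Ch] A)} {r s : Ch}
    (hP : mapHat (LinearMap.mul' Ch A ∘ₗ TensorProduct.map S LinearMap.id) P =
      of A (algebraMap Ch A r))
    (hQ : mapHat (LinearMap.mul' Ch A ∘ₗ TensorProduct.map S LinearMap.id) Q =
      of A (algebraMap Ch A s)) :
    mapHat (LinearMap.mul' Ch A ∘ₗ TensorProduct.map S LinearMap.id) (P * Q) =
      of A (algebraMap Ch A (r * s)) := by
  set T := mapHat (LinearMap.mul' Ch A ∘ₗ TensorProduct.map S LinearMap.id) with hT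
  have h1 : ∀ b b' : A, T ∘ₗ LinearMap.mulRight Ch (of _ (b ⊗ₜ b')) =
      LinearMap.mulLeft Ch (of A (S b)) ∘ₗ LinearMap.mulRight Ch (of A b') ∘ₗ T := by
    intro b b'
    refine linearMap_ext_of_tmul fun a a' => ?_
    simp only [LinearMap.comp_apply, LinearMap.mulRight_apply, LinearMap.mulLeft_apply, hT,
      ← map_mul, mapHat_of, Algebra.TensorProduct.tmul_mul_tmul, TensorProduct.map_tmul,
      LinearMap.mul'_apply, hS, LinearMap.id_apply]
    simp only [mul_assoc]
  have h2 : T ∘ₗ LinearMap.mulLeft Ch P = r • T := by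
    refine linearMap_ext_of_tmul fun b b' => ?_
    have := LinearMap.congr_fun (h1 b b') P
    simp only [LinearMap.comp_apply, LinearMap.mulRight_apply, LinearMap.mulLeft_apply, hP]
      at this
    rw [LinearMap.comp_apply, LinearMap.mulLeft_apply, this, LinearMap.smul_apply, hT, mapHat_of,
      ← map_mul, ← map_mul, ← map_smul, Algebra.commutes, ← mul_assoc,
      ← Algebra.commutes, Algebra.smul_def]
    simp
  have := LinearMap.congr_fun h2 Q
  rw [LinearMap.comp_apply, LinearMap.mulLeft_apply, LinearMap.smul_apply, hQ, ← map_smul] at this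
  rw [this, map_mul, Algebra.smul_def]

/-- If `S` reverses products and `∑ q₁ S(q₂)` is a scalar `s`, then
`∑ (pq)₁ S((pq)₂) = s ∑ p₁ S(p₂)`. -/
theorem convolution_right_mul {S : A →ₗ[Ch] A} (hS : ∀ a b, S (a * b) = S b * S a)
    {P Q : Completion (A ⊗[Ch] A)} {r s : Ch}
    (hP : mapHat (LinearMap.mul' Ch A ∘ₗ TensorProduct.map LinearMap.id S) P =
      of A (algebraMap Ch A r))
    (hQ : mapHat (LinearMap.mul' Ch A ∘ₗ TensorProduct.map LinearMap.id S) Q =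
      of A (algebraMap Ch A s)) :
    mapHat (LinearMap.mul' Ch A ∘ₗ TensorProduct.map LinearMap.id S) (P * Q) =
      of A (algebraMap Ch A (r * s)) := by
  set T := mapHat (LinearMap.mul' Ch A ∘ₗ TensorProduct.map LinearMap.id S) with hT
  have h1 : ∀ b b' : A, T ∘ₗ LinearMap.mulLeft Ch (of _ (b ⊗ₜ b')) =
      LinearMap.mulLeft Ch (of A b) ∘ₗ LinearMap.mulRight Ch (of A (S b')) ∘ₗ T := by
    intro b b'
    refine linearMap_ext_of_tmul fun a a' => ?_
    simp only [LinearMap.comp_apply, LinearMap.mulRight_apply, LinearMap.mulLeft_apply, hT,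
      ← map_mul, mapHat_of, Algebra.TensorProduct.tmul_mul_tmul, TensorProduct.map_tmul,
      LinearMap.mul'_apply, hS, LinearMap.id_apply]
    simp only [mul_assoc]
  have h2 : T ∘ₗ LinearMap.mulRight Ch Q = s • T := by
    refine linearMap_ext_of_tmul fun b b' => ?_
    have := LinearMap.congr_fun (h1 b b') Q
    simp only [LinearMap.comp_apply, LinearMap.mulRight_apply, LinearMap.mulLeft_apply, hQ]
      at this
    rw [LinearMap.comp_apply, LinearMap.mulRight_apply, this, LinearMap.smul_apply, hT, mapHat_of,
      ← map_mul, ← map_mul, ← map_smul, Algebra.commutes, ← mul_assoc,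
      ← Algebra.commutes, Algebra.smul_def]
    simp
  have := LinearMap.congr_fun h2 P
  rw [LinearMap.comp_apply, LinearMap.mulRight_apply, LinearMap.smul_apply, hP, ← map_smul] at this
  rw [this, mul_comm, map_mul, Algebra.smul_def]

/-- The antipode of a topological Hopf algebra is determined by comultiplication and counit. -/
theorem TopHopf.antipode_unique [HComplete A] {S S' : TopHopf A} (hΔ : S.comul = S'.comul)
    (hε : S.counit = S'.counit) : S.antipode = S'.antipode := by
  ext1 x
  refine of_injective ?_
  -- the map `a ⊗ b ⊗ c ↦ S(a) b S'(c)`, applied to the two sides of coassociativity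
  let N : A ⊗[Ch] A →ₗ[Ch] A := LinearMap.mul' Ch A ∘ₗ TensorProduct.map LinearMap.id S'.antipode
  let N' : A ⊗[Ch] A →ₗ[Ch] A := LinearMap.mul' Ch A ∘ₗ TensorProduct.map S.antipode LinearMap.id
  let M : A ⊗[Ch] (A ⊗[Ch] A) →ₗ[Ch] A := LinearMap.mul' Ch A ∘ₗ TensorProduct.map S.antipode N
  have h1 : ∀ (a : A) (P : Completion (A ⊗[Ch] A)),
      mapHat M (pairing (of A a) P) = of A (S.antipode a) * mapHat N P := by
    intro a P
    have : mapHat M ∘ₗ pairing (of A a) =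
        LinearMap.mulLeft Ch (of A (S.antipode a)) ∘ₗ mapHat N := by
      refine linearMap_ext_of fun t => ?_
      rw [LinearMap.comp_apply, LinearMap.comp_apply, pairing_of, mapHat_of, mapHat_of,
        LinearMap.mulLeft_apply, ← map_mul]
      simp [M]
    exact LinearMap.congr_fun this P
  have h2 : ∀ (a : A) (P : Completion (A ⊗[Ch] A)),
      mapHat M (mapHat (TensorProduct.assoc Ch A A A).toLinearMap (pairing P (of A a))) =
        mapHat N' P * of A (S'.antipode a) := by
    intro a P
    have : mapHat M ∘ₗ mapHat (TensorProduct.assoc Ch A A A).toLinearMap ∘ₗ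
        pairing.flip (of A a) = LinearMap.mulRight Ch (of A (S'.antipode a)) ∘ₗ mapHat N' := by
      refine linearMap_ext_of_tmul fun b c => ?_
      rw [LinearMap.comp_apply, LinearMap.comp_apply, LinearMap.comp_apply, LinearMap.flip_apply,
        pairing_of, mapHat_of, mapHat_of, mapHat_of, LinearMap.mulRight_apply, ← map_mul]
      simp [M, N, N', mul_assoc]
    exact LinearMap.congr_fun this P
  have key : mapHat M (mapHat (TensorProduct.assoc Ch A A A).toLinearMap
        (tensorHat S.comul.toLinearMap (of A).toLinearMap (S.comul x))) =
      mapHat M (tensorHat (of A).toLinearMap S.comul.toLinearMap (S.comul x)) := by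
    rw [S.coassoc]
  have hR : mapHat M ∘ₗ tensorHat (of A).toLinearMap S.comul.toLinearMap =
      mapHat S.antipode ∘ₗ mapHat ((TensorProduct.rid Ch A).toLinearMap ∘ₗ
        TensorProduct.map LinearMap.id S.counit.toLinearMap) := by
    refine linearMap_ext_of_tmul fun a b => ?_
    rw [LinearMap.comp_apply, LinearMap.comp_apply, tensorHat_of, AlgHom.toLinearMap_apply,
      AlgHom.toLinearMap_apply, h1, hΔ, S'.antipode_right, mapHat_of, mapHat_of, ← map_mul, hε,
      ← Algebra.commutes, ← Algebra.smul_def]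
    simp only [LinearMap.comp_apply, TensorProduct.map_tmul, LinearEquiv.coe_coe,
      TensorProduct.rid_tmul, LinearMap.id_apply, AlgHom.toLinearMap_apply, map_smul]
  have hL : mapHat M ∘ₗ mapHat (TensorProduct.assoc Ch A A A).toLinearMap ∘ₗ
        tensorHat S.comul.toLinearMap (of A).toLinearMap =
      mapHat S'.antipode ∘ₗ mapHat ((TensorProduct.lid Ch A).toLinearMap ∘ₗ
        TensorProduct.map S.counit.toLinearMap LinearMap.id) := by
    refine linearMap_ext_of_tmul fun a b => ?_
    rw [LinearMap.comp_apply, LinearMap.comp_apply, LinearMap.comp_apply, tensorHat_of,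
      AlgHom.toLinearMap_apply, AlgHom.toLinearMap_apply, h2, S.antipode_left, mapHat_of,
      mapHat_of, ← map_mul, ← Algebra.smul_def]
    simp only [LinearMap.comp_apply, TensorProduct.map_tmul, LinearEquiv.coe_coe,
      TensorProduct.lid_tmul, LinearMap.id_apply, AlgHom.toLinearMap_apply, map_smul]
  have hR' := LinearMap.congr_fun hR (S.comul x)
  have hL' := LinearMap.congr_fun hL (S.comul x)
  simp only [LinearMap.comp_apply] at hR' hL'
  have e1 := S.counit_right x
  have e2 := S.counit_left x
  rw [hR', hL', e1, e2, mapHat_of, mapHat_of] at key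
  exact key.symm

end Antipode

end HAdic
end

noncomputable section

namespace QGroup

open HAdic

/-! ### Quantum integers -/

theorem qpow_eq_hexp (c : ℂ) : qpow c = hexp (PowerSeries.C c : Ch) :=
  (hexp_algebraMap (B := Ch) c).symm

@[simp] theorem qpow_zero : qpow 0 = 1 := by rw [qpow_eq_hexp, map_zero, hexp_zero]

theorem qpow_add (a b : ℂ) : qpow (a + b) = qpow a * qpow b := by
  rw [qpow_eq_hexp, map_add, hexp_add (Commute.all _ _), ← qpow_eq_hexp, ← qpow_eq_hexp]

theorem qpow_natCast_mul (n : ℕ) (c : ℂ) : qpow (n * c) = qpow c ^ n := by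
  induction n with
  | zero => simp
  | succ n ih => rw [Nat.cast_succ, add_one_mul, qpow_add, ih, pow_succ]

theorem qpow_neg_mul_qpow (c : ℂ) : qpow (-c) * qpow c = 1 := by
  rw [← qpow_add, neg_add_cancel, qpow_zero]

theorem X_mul_divh_qpow (a b : ℂ) :
    PowerSeries.X * divh (qpow a - qpow b) = qpow a - qpow b :=
  X_mul_divh (by simp [qpow])

theorem constantCoeff_divh_qpow (c : ℂ) :
    PowerSeries.constantCoeff (divh (qpow c - qpow (-c))) = 2 * c := by
  rw [← PowerSeries.coeff_zero_eq_constantCoeff_apply]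
  simp [divh, qpow]
  ring

section QInt

variable {d : ℕ}

theorem sub_mul_qint (hd : 0 < d) (n : ℕ) :
    (qpow d - qpow (-d)) * qint d n = qpow (n * d) - qpow (-(n * d)) := by
  have h : PowerSeries.constantCoeff (divh (qpow d - qpow (-d))) ≠ 0 := by
    rw [constantCoeff_divh_qpow]
    simp [hd.ne']
  have h' := PowerSeries.mul_inv_cancel _ h
  rw [qint]
  linear_combination (-(divh (qpow (n * d) - qpow (-(n * d))) *
      (divh (qpow d - qpow (-d)))⁻¹)) * X_mul_divh_qpow d (-d) +
    X_mul_divh_qpow (n * d) (-(n * d)) +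
    PowerSeries.X * divh (qpow (n * d) - qpow (-(n * d))) * h'

theorem qpow_sub_qpow_neg_ne_zero (hd : 0 < d) : qpow d - qpow (-d) ≠ 0 := by
  intro h
  have h1 := constantCoeff_divh_qpow d
  rw [h] at h1
  have : (divh 0 : Ch) = 0 := by ext; simp [divh]
  rw [this, map_zero] at h1
  simp [hd.ne'] at h1

theorem constantCoeff_qint (hd : 0 < d) (n : ℕ) : PowerSeries.constantCoeff (qint d n) = n := by
  have hd' : (d : ℂ) ≠ 0 := by exact_mod_cast hd.ne'
  rw [qint, map_mul, PowerSeries.constantCoeff_inv, constantCoeff_divh_qpow,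
    constantCoeff_divh_qpow]
  field_simp

/-- The addition formula for quantum integers; by the symmetry `q ↦ q⁻¹` it holds for both signs
of the exponent. -/
theorem qint_add (hd : 0 < d) {δ : ℂ} (hδ : δ = d ∨ δ = -d) (a b : ℕ) :
    qint d (a + b) = qpow (b * δ) * qint d a + qpow (-(a * δ)) * qint d b := by
  refine mul_left_cancel₀ (qpow_sub_qpow_neg_ne_zero hd) ?_
  rw [mul_add, mul_left_comm, mul_left_comm _ (qpow (-(a * δ))), sub_mul_qint hd, sub_mul_qint hd,
    sub_mul_qint hd]
  rcases hδ with rfl | rfl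
  · rw [mul_sub, mul_sub, ← qpow_add, ← qpow_add, ← qpow_add, ← qpow_add, Nat.cast_add]
    ring_nf
  · rw [mul_sub, mul_sub, ← qpow_add, ← qpow_add, ← qpow_add, ← qpow_add, Nat.cast_add]
    ring_nf

theorem qfact_succ (d n : ℕ) : qfact d (n + 1) = qfact d n * qint d (n + 1) :=
  Finset.prod_range_succ _ _

theorem constantCoeff_qfact_ne_zero (hd : 0 < d) (n : ℕ) :
    PowerSeries.constantCoeff (qfact d n) ≠ 0 := by
  rw [qfact, map_prod]
  refine Finset.prod_ne_zero_iff.2 fun k _ => ?_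
  rw [constantCoeff_qint hd]
  exact_mod_cast Nat.succ_ne_zero k

theorem qfact_ne_zero (hd : 0 < d) (n : ℕ) : qfact d n ≠ 0 := fun h =>
  constantCoeff_qfact_ne_zero hd n (by rw [h, map_zero])

theorem qbinom_mul (hd : 0 < d) (m r : ℕ) :
    qbinom d m r * (qfact d r * qfact d (m - r)) = qfact d m := by
  rw [qbinom, mul_assoc, PowerSeries.inv_mul_cancel, mul_one]
  rw [map_mul]
  exact mul_ne_zero (constantCoeff_qfact_ne_zero hd _) (constantCoeff_qfact_ne_zero hd _)

theorem qbinom_zero_right (hd : 0 < d) (m : ℕ) : qbinom d m 0 = 1 := by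
  refine mul_right_cancel₀ (mul_ne_zero (qfact_ne_zero hd 0) (qfact_ne_zero hd (m - 0))) ?_
  rw [qbinom_mul hd]
  simp [qfact]

theorem qbinom_self (hd : 0 < d) (m : ℕ) : qbinom d m m = 1 := by
  refine mul_right_cancel₀ (mul_ne_zero (qfact_ne_zero hd m) (qfact_ne_zero hd (m - m))) ?_
  rw [qbinom_mul hd]
  simp [qfact]

theorem qbinom_symm {m r : ℕ} (h : r ≤ m) : qbinom d m (m - r) = qbinom d m r := by
  rw [qbinom, qbinom, Nat.sub_sub_self h, mul_comm (qfact d (m - r))]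

/-- The two `q`-Pascal identities, one for each sign of `δ`. -/
theorem qbinom_succ_succ (hd : 0 < d) {δ : ℂ} (hδ : δ = d ∨ δ = -d) {m r : ℕ} (h : r < m) :
    qbinom d (m + 1) (r + 1) = qpow ((r + 1 : ℕ) * δ) * qbinom d m (r + 1) +
      qpow (-((m - r : ℕ) * δ)) * qbinom d m r := by
  refine mul_right_cancel₀ (mul_ne_zero (qfact_ne_zero hd (r + 1)) (qfact_ne_zero hd (m - r))) ?_
  have h1 := qbinom_mul hd (m + 1) (r + 1)
  rw [Nat.add_sub_add_right] at h1
  have h2 := qbinom_mul hd m (r + 1)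
  have h3 := qbinom_mul hd m r
  have e1 : qfact d (m - r) = qfact d (m - (r + 1)) * qint d (m - r) := by
    rw [show m - r = m - (r + 1) + 1 by omega, qfact_succ]
  rw [h1, qfact_succ, show m + 1 = (m - r) + (r + 1) by omega, qint_add hd hδ]
  have : m - r + (r + 1) - 1 = m := by omega
  calc _ = qpow ((r + 1 : ℕ) * δ) * (qfact d m * qint d (m - r)) +
        qpow (-((m - r : ℕ) * δ)) * (qfact d m * qint d (r + 1)) := by ring
    _ = qpow ((r + 1 : ℕ) * δ) * (qbinom d m (r + 1) * (qfact d (r + 1) * qfact d (m - (r + 1)))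
          * qint d (m - r)) + qpow (-((m - r : ℕ) * δ)) *
          (qbinom d m r * (qfact d r * qfact d (m - r)) * qint d (r + 1)) := by rw [h2, h3]
    _ = _ := by rw [e1, qfact_succ d r]; ring

end QInt

/-! ### The quantum Serre expression -/

section Serre

variable {B B' : Type*} [Ring B] [Algebra Ch B] [Ring B'] [Algebra Ch B']

/-- The quantum Serre expression `∑ᵣ (-1)ʳ q ^ {r t} [m choose r] x ^ {m - r} z x ^ r`, where the
binomial coefficient is taken at `q ^ d`. -/
def serreSum (d m : ℕ) (t : ℂ) (x z : B) : B :=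
  ∑ r ∈ Finset.range (m + 1),
    ((-1) ^ r * qpow (r * t) * qbinom d m r : Ch) • (x ^ (m - r) * z * x ^ r)

theorem map_serreSum (φ : B →ₐ[Ch] B') (d m : ℕ) (t : ℂ) (x z : B) :
    φ (serreSum d m t x z) = serreSum d m t (φ x) (φ z) := by
  simp [serreSum]

theorem serreSum_add_right (d m : ℕ) (t : ℂ) (x z w : B) :
    serreSum d m t x (z + w) = serreSum d m t x z + serreSum d m t x w := by
  simp only [serreSum, mul_add, add_mul, smul_add, Finset.sum_add_distrib]

theorem serreSum_zero_right (d m : ℕ) (t : ℂ) (x : B) : serreSum d m t x 0 = 0 := by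
  simp [serreSum]

variable {d : ℕ} (hd : 0 < d)
include hd

theorem serreSum_zero (t : ℂ) (x z : B) : serreSum d 0 t x z = z := by
  simp [serreSum, qbinom_zero_right hd]

/-- The inductive form of the factorisation of the quantum Serre expression into operators
`u ↦ x u - q ^ s u x`; there is one for each sign of `δ`, corresponding to the two orders of
the factors. -/
theorem serreSum_succ {δ : ℂ} (hδ : δ = d ∨ δ = -d) (m : ℕ) (t : ℂ) (x z : B) :
    serreSum d (m + 1) t x z = x * serreSum d m (t + δ) x z -
      qpow (t - δ * m) • (serreSum d m (t + δ) x z * x) := by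
  have hx : x * serreSum d m (t + δ) x z = (x ^ (m + 1) * z) + ∑ r ∈ Finset.range m,
      ((-1) ^ (r + 1) * qpow ((r + 1 : ℕ) * (t + δ)) * qbinom d m (r + 1) : Ch) •
        (x ^ (m - r) * z * x ^ (r + 1)) := by
    rw [serreSum, Finset.mul_sum, Finset.sum_range_succ', add_comm]
    congr 1
    · simp [qbinom_zero_right hd, pow_succ', mul_assoc]
    · refine Finset.sum_congr rfl fun r hr => ?_
      have := Finset.mem_range.1 hr
      rw [mul_smul_comm, show m - r = m - (r + 1) + 1 by omega, pow_succ' x (m - (r + 1))]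
      simp only [mul_assoc]
  have hy : qpow (t - δ * m) • (serreSum d m (t + δ) x z * x) =
      (∑ r ∈ Finset.range m, (qpow (t - δ * m) *
        ((-1) ^ r * qpow (r * (t + δ)) * qbinom d m r) : Ch) •
        (x ^ (m - r) * z * x ^ (r + 1))) +
      ((-1) ^ m * qpow ((m + 1 : ℕ) * t) : Ch) • (z * x ^ (m + 1)) := by
    rw [serreSum, Finset.sum_mul, Finset.smul_sum, Finset.sum_range_succ]
    congr 1
    · refine Finset.sum_congr rfl fun r hr => ?_
      rw [smul_mul_assoc, smul_smul, pow_succ x r]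
      simp only [mul_assoc]
    · rw [smul_mul_assoc, smul_smul, qbinom_self hd, mul_one, Nat.sub_self, pow_zero, one_mul,
        mul_assoc, ← pow_succ, mul_left_comm, ← qpow_add]
      congr 3
      push_cast
      ring
  rw [hx, hy, serreSum, Finset.sum_range_succ', Finset.sum_range_succ]
  have hmid : ∀ r ∈ Finset.range m,
      ((-1) ^ (r + 1) * qpow ((r + 1 : ℕ) * t) * qbinom d (m + 1) (r + 1) : Ch) •
        (x ^ (m + 1 - (r + 1)) * z * x ^ (r + 1)) =
      ((-1) ^ (r + 1) * qpow ((r + 1 : ℕ) * (t + δ)) * qbinom d m (r + 1) : Ch) •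
        (x ^ (m - r) * z * x ^ (r + 1)) - (qpow (t - δ * m) *
        ((-1) ^ r * qpow (r * (t + δ)) * qbinom d m r) : Ch) •
        (x ^ (m - r) * z * x ^ (r + 1)) := by
    intro r hr
    have hr' := Finset.mem_range.1 hr
    rw [← sub_smul, Nat.add_sub_add_right, qbinom_succ_succ hd hδ hr']
    congr 1
    have e1 : qpow ((r + 1 : ℕ) * (t + δ)) = qpow ((r + 1 : ℕ) * t) * qpow ((r + 1 : ℕ) * δ) := by
      rw [← qpow_add, mul_add]
    have e2 : qpow ((r + 1 : ℕ) * t) * qpow (-((m - r : ℕ) * δ)) =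
        qpow (t - δ * m) * qpow (r * (t + δ)) := by
      rw [← qpow_add, ← qpow_add]
      congr 1
      rw [Nat.cast_sub hr'.le]
      push_cast
      ring
    rw [e1]
    linear_combination (-1) ^ (r + 1) * qbinom d m r * e2
  rw [Finset.sum_congr rfl hmid, Finset.sum_sub_distrib, qbinom_zero_right hd, qbinom_self hd]
  simp only [Nat.sub_self, pow_zero, one_mul, Nat.cast_zero, zero_mul, qpow_zero, mul_one,
    one_smul, Nat.sub_zero, pow_succ (-1 : Ch) m, mul_neg, neg_mul, neg_smul]
  abel

/-- An element that `q`-commutes with `x` and `z` `q`-commutes with their quantum Serre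
expression. -/
theorem mul_serreSum {a b : Ch} {x z y : B} (hz : y * z = a • (z * y)) (hx : y * x = b • (x * y))
    (m : ℕ) (t : ℂ) :
    y * serreSum d m t x z = (a * b ^ m) • (serreSum d m t x z * y) := by
  induction m generalizing t with
  | zero => rw [serreSum_zero hd, hz, pow_zero, mul_one]
  | succ m ih =>
    rw [serreSum_succ hd (Or.inl rfl)]
    set S := serreSum d m (t + d) x z
    have h1 : y * (x * S) = (a * b ^ (m + 1)) • (x * S * y) := by
      rw [← mul_assoc, hx, smul_mul_assoc, mul_assoc, ih, mul_smul_comm, smul_smul, mul_assoc]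
      congr 1
      ring
    have h2 : y * (S * x) = (a * b ^ (m + 1)) • (S * x * y) := by
      rw [← mul_assoc, ih, smul_mul_assoc, mul_assoc, hx, mul_smul_comm, smul_smul, mul_assoc S,
        mul_assoc a, ← pow_succ]
    rw [mul_sub, h1, mul_smul_comm, h2, sub_mul, smul_sub, smul_mul_assoc, smul_comm]

/-- A summand `y` of the first argument that `q`-commutes suitably with `x` and `z` drops out of
the quantum Serre expression: each of the factors `u ↦ (x + y) u - q ^ s u (x + y)` is
applied to an element `u` with `y u = q ^ s u y`. -/
theorem serreSum_add_left {δ : ℂ} (hδ : δ = d ∨ δ = -d) {m : ℕ} {t : ℂ} {x y z : B}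
    (hz : y * z = qpow (t + δ * (m - 1)) • (z * y)) (hx : y * x = qpow (-(2 * δ)) • (x * y)) :
    serreSum d m t (x + y) z = serreSum d m t x z := by
  induction m generalizing t with
  | zero => rw [serreSum_zero hd, serreSum_zero hd]
  | succ m ih =>
    rw [serreSum_succ hd hδ, serreSum_succ hd hδ, ih]
    · have h := mul_serreSum hd hz hx m (t + δ)
      rw [← qpow_natCast_mul, ← qpow_add] at h
      have e : t + δ * ((m + 1 : ℕ) - 1) + m * (-(2 * δ)) = t - δ * m := by
        push_cast
        ring
      rw [e] at h
      rw [add_mul, mul_add, h, smul_add]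
      abel
    · rw [hz]
      congr 2
      push_cast
      ring

/-- Additivity of the quantum Serre expression on pairs of `q`-commuting arguments. -/
theorem serreSum_add_add {m : ℕ} {t : ℂ} {x y z w : B}
    (hz : y * z = qpow (t + d * (m - 1)) • (z * y))
    (hx : y * x = qpow (-(2 * d)) • (x * y))
    (hw : x * w = qpow (t - d * (m - 1)) • (w * x)) :
    serreSum d m t (x + y) (z + w) = serreSum d m t x z + serreSum d m t y w := by
  rw [serreSum_add_right, serreSum_add_left hd (Or.inl rfl) hz hx, add_comm x y,
    serreSum_add_left hd (Or.inr rfl)]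
  · rw [hw]
    congr 2
    ring
  · rw [hx, smul_smul, ← qpow_add]
    simp

/-- Replacing `x` and `z` by multiples `x L` and `z M` with `q`-commuting factors shifts the
parameter of the quantum Serre expression. -/
theorem exists_serreSum_mul {α β μ : ℂ} {x z L M : B} (hz : L * z = qpow α • (z * L))
    (hx : L * x = qpow μ • (x * L)) (hM : M * x = qpow β • (x * M)) (hLM : Commute L M)
    (m : ℕ) (t : ℂ) :
    ∃ κ : Ch, serreSum d m t (x * L) (z * M) =
      κ • (serreSum d m (t + β - α) x z * (M * L ^ m)) := by
  induction m generalizing t with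
  | zero => exact ⟨1, by simp [serreSum_zero hd]⟩
  | succ m ih =>
    obtain ⟨κ, hκ⟩ := ih (t + d)
    have e : t + d + β - α = t + β - α + d := by ring
    rw [e] at hκ
    refine ⟨κ * (qpow α * qpow μ ^ m), ?_⟩
    rw [serreSum_succ hd (Or.inl rfl), hκ, serreSum_succ hd (Or.inl rfl)]
    have hS := mul_serreSum hd hz hx m (t + β - α + d)
    set S := serreSum d m (t + β - α + d) x z
    have hL : ∀ k : ℕ, L ^ k * x = qpow μ ^ k • (x * L ^ k) := by
      intro k
      induction k with
      | zero => simp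
      | succ k ihk =>
        rw [pow_succ', mul_assoc, ihk, mul_smul_comm, ← mul_assoc, hx, smul_mul_assoc, smul_smul,
          mul_assoc, ← pow_succ]
    have h1 : x * L * (κ • (S * (M * L ^ m))) =
        (κ * (qpow α * qpow μ ^ m)) • (x * S * (M * L ^ (m + 1))) := by
      rw [mul_smul_comm, ← smul_smul]
      congr 1
      calc x * L * (S * (M * L ^ m)) = x * (L * S) * (M * L ^ m) := by noncomm_ring
        _ = _ := by
          rw [hS, mul_smul_comm, smul_mul_assoc]
          congr 1
          rw [mul_assoc, mul_assoc S, ← mul_assoc L, hLM.eq, mul_assoc M, ← pow_succ', ← mul_assoc]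
    have h2 : κ • (S * (M * L ^ m)) * (x * L) =
        (κ * (qpow β * qpow μ ^ m)) • (S * x * (M * L ^ (m + 1))) := by
      rw [smul_mul_assoc, ← smul_smul]
      congr 1
      calc S * (M * L ^ m) * (x * L) = S * (M * (L ^ m * x)) * L := by noncomm_ring
        _ = (qpow μ ^ m) • (S * (M * x) * (L ^ m * L)) := by
          rw [hL, mul_smul_comm, mul_smul_comm, smul_mul_assoc]
          congr 1
          noncomm_ring
        _ = _ := by
          rw [hM, mul_smul_comm, smul_mul_assoc, smul_smul, mul_comm (qpow β), ← pow_succ]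
          congr 1
          noncomm_ring
    have e3 : qpow (t - d * m) * qpow β = qpow α * qpow (t + β - α - d * m) := by
      rw [← qpow_add, ← qpow_add]
      congr 1
      ring
    rw [h1, h2, sub_mul, smul_sub, smul_mul_assoc, smul_smul, smul_smul]
    congr 2
    linear_combination κ * qpow μ ^ m * e3

omit hd in
/-- Reading the quantum Serre expression in the opposite order inverts its parameter. -/
theorem serreSum_reverse (m : ℕ) (t : ℂ) (x z : B) :
    ∑ r ∈ Finset.range (m + 1),
      ((-1) ^ r * qpow (r * t) * qbinom d m r : Ch) • (x ^ r * z * x ^ (m - r)) =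
    ((-1) ^ m * qpow (m * t) : Ch) • serreSum d m (-t) x z := by
  rw [serreSum, ← Finset.sum_range_reflect, Finset.smul_sum]
  refine Finset.sum_congr rfl fun r hr => ?_
  have hr' : r ≤ m := Nat.lt_succ_iff.1 (Finset.mem_range.1 hr)
  rw [Nat.add_sub_cancel, Nat.sub_sub_self hr', qbinom_symm hr', smul_smul]
  congr 1
  have e1 : qpow ((m - r : ℕ) * t) = qpow (m * t) * qpow (r * -t) := by
    rw [← qpow_add, Nat.cast_sub hr']
    congr 1
    ring
  have e2 : (-1 : Ch) ^ (m - r) = (-1) ^ m * (-1) ^ r := by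
    obtain ⟨k, rfl⟩ := Nat.exists_eq_add_of_le hr'
    rw [Nat.add_sub_cancel_left, ← pow_add, show r + k + r = k + 2 * r by ring, pow_add, pow_mul]
    simp
  rw [e1, e2]
  ring

omit hd in
/-- The quantum Serre relation passes to the opposite algebra with the inverse parameter. -/
theorem serreSum_op {m : ℕ} {t : ℂ} {x z : B} (h : serreSum d m (-t) x z = 0) :
    serreSum d m t (MulOpposite.op x) (MulOpposite.op z) = 0 := by
  have key : serreSum d m t (MulOpposite.op x) (MulOpposite.op z) =
      MulOpposite.op (∑ r ∈ Finset.range (m + 1),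
        ((-1) ^ r * qpow (r * t) * qbinom d m r : Ch) • (x ^ r * z * x ^ (m - r))) := by
    rw [Finset.op_sum, serreSum]
    refine Finset.sum_congr rfl fun r _ => ?_
    simp only [MulOpposite.op_smul, MulOpposite.op_mul, MulOpposite.op_pow, mul_assoc]
  rw [key, serreSum_reverse, h, smul_zero, MulOpposite.op_zero]

end Serre

end QGroup
end

noncomputable section

namespace QGroup

open HAdic

/-! ### The universal property of algebras given by generators and relations -/

section Universal

variable {l : ℕ} {B : Type*} [Ring B] [Algebra Ch B]

theorem X_pow_smul_freeTop (n : ℕ) (p : FreeTop l) :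
    (PowerSeries.X ^ n : Ch) • p = PowerSeries.X ^ n * p := by
  rw [Algebra.smul_def]
  congr 1
  change PowerSeries.map (algebraMap ℂ (Free l)) (PowerSeries.X ^ n) = _
  rw [map_pow, PowerSeries.map_X]

theorem algebraMap_freeTop (r : Ch) :
    algebraMap Ch (FreeTop l) r = PowerSeries.map (algebraMap ℂ (Free l)) r := rfl

instance : HComplete (FreeTop l) := hComplete_powerSeries X_pow_smul_freeTop

theorem map_C_fexp (y : Free l) :
    PowerSeries.map PowerSeries.C (fexp y) = expSeries (PowerSeries.C y : FreeTop l) := by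
  ext1 k
  rw [PowerSeries.coeff_map, fexp, expSeries, PowerSeries.coeff_mk, PowerSeries.coeff_mk,
    Algebra.smul_def, Algebra.smul_def, algebraMap_freeTop, PowerSeries.map_C, map_mul, map_pow]

theorem fexp_eq_hexp (y : Free l) : fexp y = hexp (PowerSeries.C y : FreeTop l) := by
  rw [hexp, ← map_C_fexp, (isSum_map_C X_pow_smul_freeTop (fexp y)).ev_eq]

theorem divh_fexp_eq_hsinh (y : Free l) :
    divh (fexp y - fexp (-y)) = hsinh (PowerSeries.C y : FreeTop l) := by
  have h : sinhSeries (PowerSeries.C y : FreeTop l) =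
      PowerSeries.map PowerSeries.C (divh (fexp y - fexp (-y))) := by
    rw [sinhSeries, map_divh, map_sub, map_C_fexp, map_C_fexp, map_neg]
  rw [hsinh, h, (isSum_map_C X_pow_smul_freeTop _).ev_eq]

/-- The ring homomorphism from the free `ℂ`-algebra to a `ℂ[[h]]`-algebra with given values on
the generators. -/
def freeLift (g : Gen l → B) : Free l →+* B :=
  letI : Algebra ℂ B := Algebra.compHom B (PowerSeries.C : ℂ →+* Ch)
  (FreeAlgebra.lift ℂ g : Free l →ₐ[ℂ] B)

theorem freeLift_gen (g : Gen l → B) (x : Gen l) : freeLift g (gen x) = g x :=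
  letI : Algebra ℂ B := Algebra.compHom B (PowerSeries.C : ℂ →+* Ch)
  FreeAlgebra.lift_ι_apply g x

theorem freeLift_algebraMap (g : Gen l → B) (a : ℂ) :
    freeLift g (algebraMap ℂ (Free l) a) = algebraMap Ch B (PowerSeries.C a) :=
  letI : Algebra ℂ B := Algebra.compHom B (PowerSeries.C : ℂ →+* Ch)
  AlgHom.commutes (FreeAlgebra.lift ℂ g : Free l →ₐ[ℂ] B) a

omit [Algebra Ch B] in
theorem free_ringHom_ext {φ ψ : Free l →+* B}
    (hs : ∀ a, φ (algebraMap ℂ (Free l) a) = ψ (algebraMap ℂ (Free l) a))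
    (hg : ∀ x, φ (gen x) = ψ (gen x)) : φ = ψ := by
  ext y
  induction y using FreeAlgebra.induction with
  | grade0 a => exact hs a
  | grade1 x => exact hg x
  | mul a b ha hb => rw [map_mul, map_mul, ha, hb]
  | add a b ha hb => rw [map_add, map_add, ha, hb]

variable [HComplete B]

/-- The algebra homomorphism from the completed free algebra to a complete algebra with given
values on the generators. -/
def liftTop (g : Gen l → B) : FreeTop l →ₐ[Ch] B where
  toRingHom := (ev B).comp (PowerSeries.map (freeLift g))
  commutes' r := by
    change ev B (PowerSeries.map (freeLift g) (PowerSeries.map (algebraMap ℂ (Free l)) r)) = _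
    rw [← ev_map_C r]
    congr 1
    ext1 n
    simp only [PowerSeries.coeff_map, freeLift_algebraMap, RingHom.comp_apply]

theorem liftTop_tgen (g : Gen l → B) (x : Gen l) : liftTop g (tgen x) = g x := by
  change ev B (PowerSeries.map (freeLift g) (PowerSeries.C (gen x))) = _
  rw [PowerSeries.map_C, ev_C, freeLift_gen]

theorem freeTop_algHom_ext {φ ψ : FreeTop l →ₐ[Ch] B} (h : ∀ x, φ (tgen x) = ψ (tgen x)) :
    φ = ψ := by
  have key : (φ : FreeTop l →+* B).comp PowerSeries.C =
      (ψ : FreeTop l →+* B).comp PowerSeries.C := by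
    refine free_ringHom_ext (fun a => ?_) h
    have ha : PowerSeries.C (algebraMap ℂ (Free l) a) =
        algebraMap Ch (FreeTop l) (PowerSeries.C a) := by
      rw [algebraMap_freeTop, PowerSeries.map_C]
    rw [RingHom.comp_apply, RingHom.comp_apply, ha]
    exact (φ.commutes _).trans (ψ.commutes _).symm
  ext1 p
  rw [← (isSum_map_C X_pow_smul_freeTop p).ev_eq, map_ev, map_ev]
  congr 1
  ext1 n
  simp only [PowerSeries.coeff_map]
  exact RingHom.congr_fun key _

end Universal

section Rep

variable {l : ℕ} {B B' : Type*} [Ring B] [Algebra Ch B] [HComplete B] [Ring B'] [Algebra Ch B']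
  [HComplete B']

/-- Elements `h_i, e_i, f_i` of a complete algebra that satisfy the defining relations of the
quantum group attached to `A`, `d` and `c`. In `cross_same` both the numerator and the denominator
of `(K_i - K_i⁻¹) / (q_i - q_i⁻¹)` are divided by `h`, which makes the denominator invertible. -/
structure IsRep (A : Matrix (Fin l) (Fin l) ℤ) (d : Fin l → ℕ) (c : Matrix (Fin l) (Fin l) ℂ)
    (h e f : Fin l → B) : Prop where
  cartan : ∀ i j, h i * h j = h j * h i
  raise : ∀ i j, h i * e j = e j * h i + (A i j : ℤ) • e j
  lower : ∀ i j, h i * f j = f j * h i - (A i j : ℤ) • f j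
  cross_same : ∀ i, e i * f i = qpow (c i i) • (f i * e i) +
    (divh (qpow (d i) - qpow (-(d i : ℂ))))⁻¹ • hsinh ((PowerSeries.C (d i : ℂ) : Ch) • h i)
  cross_ne : ∀ i j, i ≠ j → e i * f j = qpow (c j i) • (f j * e i)
  serre_raise : ∀ i j, i ≠ j → serreSum (d i) (1 - A i j).toNat (c i j) (e i) (e j) = 0
  serre_lower : ∀ i j, i ≠ j → serreSum (d i) (1 - A i j).toNat (c i j) (f i) (f j) = 0

variable {A : Matrix (Fin l) (Fin l) ℤ} {d : Fin l → ℕ} {c : Matrix (Fin l) (Fin l) ℂ}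

/-- The assignment of values to the symbols for the generators. -/
def genMap {X : Type*} (h e f : Fin l → X) : Gen l → X
  | .H i => h i
  | .E i => e i
  | .F i => f i

theorem C_smul_gen (t : ℂ) (x : Gen l) :
    (PowerSeries.C (t • gen x) : FreeTop l) = (PowerSeries.C t : Ch) • tgen x := by
  rw [Algebra.smul_def, Algebra.smul_def, algebraMap_freeTop, PowerSeries.map_C, map_mul, tgen]

/-- The homomorphism given by elements satisfying the relations kills not only the ideal generated
by the relators but, the target being Hausdorff, also its closure. -/
theorem IsRep.closedIdeal_le_ker {h e f : Fin l → B} (hr : IsRep A d c h e f) {x : FreeTop l}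
    (hx : x ∈ closedIdeal {x : FreeTop l | IsRelator A d c x}) :
    liftTop (genMap h e f) x = 0 := by
  have hker : ∀ y ∈ TwoSidedIdeal.span {x : FreeTop l | IsRelator A d c x},
      liftTop (genMap h e f) y = 0 := by
    intro y hy
    rw [← TwoSidedIdeal.mem_ker]
    refine TwoSidedIdeal.span_le.2 ?_ hy
    rintro _ (⟨i, j⟩ | ⟨i, j⟩ | ⟨i, j⟩ | i | ⟨i, j, hij⟩ | ⟨i, j, hij⟩ | ⟨i, j, hij⟩) <;>
      refine (TwoSidedIdeal.mem_ker _).2 ?_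
    · simp only [map_sub, map_mul, liftTop_tgen, genMap]
      rw [hr.cartan, sub_self]
    · simp only [map_sub, map_mul, map_zsmul, liftTop_tgen, genMap]
      rw [hr.raise]
      abel
    · simp only [map_add, map_sub, map_mul, map_zsmul, liftTop_tgen, genMap]
      rw [hr.lower]
      abel
    · rw [divh_fexp_eq_hsinh, C_smul_gen]
      simp only [map_sub, map_smul, map_mul, map_hsinh, liftTop_tgen, genMap]
      rw [hr.cross_same]
      abel
    · simp only [map_sub, map_smul, map_mul, liftTop_tgen, genMap]
      rw [hr.cross_ne i j hij, sub_self]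
    · refine (map_serreSum (liftTop (genMap h e f)) (d i) _ (c i j) _ _).trans ?_
      simp only [liftTop_tgen, genMap]
      exact hr.serre_raise i j hij
    · refine (map_serreSum (liftTop (genMap h e f)) (d i) _ (c i j) _ _).trans ?_
      simp only [liftTop_tgen, genMap]
      exact hr.serre_lower i j hij
  refine HComplete.haus _ fun n => ?_
  obtain ⟨y, hy, z, rfl⟩ := hx n
  exact ⟨liftTop (genMap h e f) z, by rw [map_add, hker y hy, zero_add, map_smul]⟩

instance : HComplete (Uq A d c) :=
  inferInstanceAs (HComplete (FreeTop l ⧸ closedIdeal {x : FreeTop l | IsRelator A d c x}))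

namespace Uq

theorem mk_surjective : Function.Surjective (mk A d c) := Ideal.Quotient.mk_surjective

theorem mk_relator {x : FreeTop l} (hx : IsRelator A d c x) : mk A d c x = 0 :=
  Ideal.Quotient.eq_zero_iff_mem.2 (subset_closedIdeal hx)

/-- The homomorphism to a complete algebra defined by elements satisfying the relations. -/
def lift {h e f : Fin l → B} (hr : IsRep A d c h e f) : Uq A d c →ₐ[Ch] B :=
  Ideal.Quotient.liftₐ (closedIdeal {x : FreeTop l | IsRelator A d c x})
    (liftTop (genMap h e f)) fun _ hx => hr.closedIdeal_le_ker hx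

variable {h e f : Fin l → B} (hr : IsRep A d c h e f)

theorem lift_H (i : Fin l) : lift hr (H A d c i) = h i := liftTop_tgen (genMap h e f) (.H i)
theorem lift_E (i : Fin l) : lift hr (E A d c i) = e i := liftTop_tgen (genMap h e f) (.E i)
theorem lift_F (i : Fin l) : lift hr (F A d c i) = f i := liftTop_tgen (genMap h e f) (.F i)

theorem algHom_ext {φ ψ : Uq A d c →ₐ[Ch] B} (hH : ∀ i, φ (H A d c i) = ψ (H A d c i))
    (hE : ∀ i, φ (E A d c i) = ψ (E A d c i)) (hF : ∀ i, φ (F A d c i) = ψ (F A d c i)) :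
    φ = ψ := by
  have key : φ.comp (mk A d c) = ψ.comp (mk A d c) := by
    refine freeTop_algHom_ext fun x => ?_
    cases x with
    | H i => exact hH i
    | E i => exact hE i
    | F i => exact hF i
  ext x
  obtain ⟨p, rfl⟩ := mk_surjective x
  exact DFunLike.congr_fun key p

/-- A closed subalgebra containing the generators is everything. -/
theorem mem_of_closed (V : Subalgebra Ch (Uq A d c)) (hH : ∀ i, H A d c i ∈ V)
    (hE : ∀ i, E A d c i ∈ V) (hF : ∀ i, F A d c i ∈ V)
    (hV : ∀ x, (∀ n : ℕ, ∃ v ∈ V, ∃ y, x = v + (PowerSeries.X ^ n : Ch) • y) → x ∈ V)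
    (x : Uq A d c) : x ∈ V := by
  obtain ⟨p, rfl⟩ := mk_surjective x
  have hC : ∀ y : Free l, mk A d c (PowerSeries.C y) ∈ V := by
    intro y
    induction y using FreeAlgebra.induction with
    | grade0 a =>
      have : (PowerSeries.C (algebraMap ℂ (Free l) a) : FreeTop l) =
          algebraMap Ch (FreeTop l) (PowerSeries.C a) := by
        rw [algebraMap_freeTop, PowerSeries.map_C]
      rw [this, AlgHom.commutes]
      exact V.algebraMap_mem _
    | grade1 x =>
      cases x with
      | H i => exact hH i
      | E i => exact hE i
      | F i => exact hF i
    | mul a b ha hb => rw [map_mul, map_mul]; exact V.mul_mem ha hb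
    | add a b ha hb => rw [map_add, map_add]; exact V.add_mem ha hb
  refine hV _ fun n => ?_
  obtain ⟨y, hy⟩ := isSum_map_C X_pow_smul_freeTop p n
  refine ⟨mk A d c (∑ k ∈ Finset.range n, (PowerSeries.X ^ k : Ch) •
    PowerSeries.coeff k (PowerSeries.map PowerSeries.C p)), ?_, mk A d c y, ?_⟩
  · rw [map_sum]
    refine V.sum_mem fun k _ => ?_
    rw [map_smul, PowerSeries.coeff_map]
    exact V.smul_mem (hC _) _
  · rw [← map_smul, ← map_add, ← hy]

theorem isRep : IsRep A d c (H A d c) (E A d c) (F A d c) where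
  cartan i j := by
    have := mk_relator (IsRelator.cartan (A := A) (d := d) (c := c) i j)
    rw [map_sub, map_mul, map_mul] at this
    exact sub_eq_zero.1 this
  raise i j := by
    have := mk_relator (IsRelator.raise (A := A) (d := d) (c := c) i j)
    rw [map_sub, map_sub, map_mul, map_mul, map_zsmul, sub_sub] at this
    exact sub_eq_zero.1 this
  lower i j := by
    have := mk_relator (IsRelator.lower (A := A) (d := d) (c := c) i j)
    rw [map_add, map_sub, map_mul, map_mul, map_zsmul, sub_add] at this
    exact sub_eq_zero.1 this
  cross_same i := by
    have := mk_relator (IsRelator.cross_same (A := A) (d := d) (c := c) i)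
    rw [divh_fexp_eq_hsinh, C_smul_gen, map_sub, map_sub, map_smul, map_smul, map_mul, map_mul,
      map_hsinh, map_smul, sub_sub] at this
    exact sub_eq_zero.1 this
  cross_ne i j hij := by
    have := mk_relator (IsRelator.cross_ne (A := A) (d := d) (c := c) i j hij)
    rw [map_sub, map_smul, map_mul, map_mul] at this
    exact sub_eq_zero.1 this
  serre_raise i j hij :=
    (map_serreSum (mk A d c) (d i) _ (c i j) _ _).symm.trans
      (mk_relator (IsRelator.serre_raise (A := A) (d := d) (c := c) i j hij))
  serre_lower i j hij :=
    (map_serreSum (mk A d c) (d i) _ (c i j) _ _).symm.trans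
      (mk_relator (IsRelator.serre_lower (A := A) (d := d) (c := c) i j hij))

end Uq

end Rep

/-! ### The Cartan part -/

section Torus

variable {l : ℕ}

/-- The element `∑ⱼ vⱼ Hⱼ` of the free algebra. -/
def cartanGen (v : Fin l → ℂ) : Free l := ∑ j, v j • gen (.H j)

theorem cartanGen_add (v w : Fin l → ℂ) : cartanGen (v + w) = cartanGen v + cartanGen w := by
  simp [cartanGen, add_smul, Finset.sum_add_distrib]

theorem cartanGen_smul (t : ℂ) (v : Fin l → ℂ) : cartanGen (t • v) = t • cartanGen v := by
  simp [cartanGen, Finset.smul_sum, smul_smul]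

theorem cartanGen_neg (v : Fin l → ℂ) : cartanGen (-v) = -cartanGen v := by
  simp [cartanGen]

theorem cartanGen_sum {ι : Type*} (s : Finset ι) (v : ι → Fin l → ℂ) :
    cartanGen (∑ i ∈ s, v i) = ∑ i ∈ s, cartanGen (v i) := by
  simp only [cartanGen, Finset.sum_apply, Finset.sum_smul]
  exact Finset.sum_comm

theorem cartanGen_single (i : Fin l) (t : ℂ) :
    cartanGen (Pi.single i t) = t • gen (.H i) := by
  rw [cartanGen, Finset.sum_eq_single i]
  · rw [Pi.single_eq_same]
  · intro j _ hj
    rw [Pi.single_eq_of_ne hj, zero_smul]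
  · intro hi
    exact absurd (Finset.mem_univ i) hi

/-- The value `∑ᵢ vᵢ αⱼ(Hᵢ)` of the simple root `αⱼ` on `∑ᵢ vᵢ Hᵢ`. -/
def rootVal (A : Matrix (Fin l) (Fin l) ℤ) (v : Fin l → ℂ) (j : Fin l) : ℂ :=
  ∑ i, v i * (A i j : ℂ)

theorem rootVal_add (A : Matrix (Fin l) (Fin l) ℤ) (v w : Fin l → ℂ) (j : Fin l) :
    rootVal A (v + w) j = rootVal A v j + rootVal A w j := by
  simp [rootVal, add_mul, Finset.sum_add_distrib]

theorem rootVal_smul (A : Matrix (Fin l) (Fin l) ℤ) (t : ℂ) (v : Fin l → ℂ) (j : Fin l) :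
    rootVal A (t • v) j = t * rootVal A v j := by
  simp [rootVal, Finset.mul_sum, mul_assoc]

theorem rootVal_neg (A : Matrix (Fin l) (Fin l) ℤ) (v : Fin l → ℂ) (j : Fin l) :
    rootVal A (-v) j = -rootVal A v j := by
  simp [rootVal]

theorem rootVal_sum (A : Matrix (Fin l) (Fin l) ℤ) {ι : Type*} (s : Finset ι)
    (v : ι → Fin l → ℂ) (j : Fin l) :
    rootVal A (∑ i ∈ s, v i) j = ∑ i ∈ s, rootVal A (v i) j := by
  simp only [rootVal, Finset.sum_apply, Finset.sum_mul]
  exact Finset.sum_comm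

theorem rootVal_single (A : Matrix (Fin l) (Fin l) ℤ) (i : Fin l) (t : ℂ) (j : Fin l) :
    rootVal A (Pi.single i t) j = t * A i j := by
  rw [rootVal, Finset.sum_eq_single i]
  · rw [Pi.single_eq_same]
  · intro k _ hk
    rw [Pi.single_eq_of_ne hk, zero_mul]
  · intro hi
    exact absurd (Finset.mem_univ i) hi

variable (A : Matrix (Fin l) (Fin l) ℤ) (d : Fin l → ℕ) (c : Matrix (Fin l) (Fin l) ℂ)

namespace Uq

/-- The element `∑ⱼ vⱼ Hⱼ` of the quantum group. -/
def cartanElt (v : Fin l → ℂ) : Uq A d c := mk A d c (PowerSeries.C (cartanGen v))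

/-- The exponential `e ^ {h ∑ⱼ vⱼ Hⱼ}`. -/
def torus (v : Fin l → ℂ) : Uq A d c := exp A d c (cartanGen v)

theorem torus_eq_hexp (v : Fin l → ℂ) : torus A d c v = hexp (cartanElt A d c v) := by
  rw [torus, exp, fexp_eq_hexp, map_hexp, cartanElt]

theorem cartanElt_eq_sum (v : Fin l → ℂ) :
    cartanElt A d c v = ∑ j, (PowerSeries.C (v j) : Ch) • H A d c j := by
  simp only [cartanElt, cartanGen, map_sum, C_smul_gen, map_smul]
  rfl

theorem cartanElt_add (v w : Fin l → ℂ) :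
    cartanElt A d c (v + w) = cartanElt A d c v + cartanElt A d c w := by
  rw [cartanElt, cartanGen_add, map_add, map_add, cartanElt, cartanElt]

theorem cartanElt_neg (v : Fin l → ℂ) : cartanElt A d c (-v) = -cartanElt A d c v := by
  rw [cartanElt, cartanGen_neg, map_neg, map_neg, cartanElt]

theorem cartanElt_smul (t : ℂ) (v : Fin l → ℂ) :
    cartanElt A d c (t • v) = (PowerSeries.C t : Ch) • cartanElt A d c v := by
  simp only [cartanElt_eq_sum, Pi.smul_apply, smul_eq_mul, map_mul, Finset.smul_sum, smul_smul]

theorem cartanElt_sum {ι : Type*} (s : Finset ι) (v : ι → Fin l → ℂ) :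
    cartanElt A d c (∑ i ∈ s, v i) = ∑ i ∈ s, cartanElt A d c (v i) := by
  simp only [cartanElt, cartanGen_sum, map_sum]

theorem cartanElt_zero : cartanElt A d c 0 = 0 := by
  simp [cartanElt_eq_sum]

theorem cartanElt_single (i : Fin l) (t : ℂ) :
    cartanElt A d c (Pi.single i t) = (PowerSeries.C t : Ch) • H A d c i := by
  rw [cartanElt, cartanGen_single, C_smul_gen, map_smul]
  rfl

theorem commute_cartanElt (v w : Fin l → ℂ) :
    Commute (cartanElt A d c v) (cartanElt A d c w) := by
  rw [cartanElt_eq_sum, cartanElt_eq_sum]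
  refine Commute.sum_left _ _ _ fun i _ => Commute.sum_right _ _ _ fun j _ => ?_
  exact (Commute.smul_left (isRep.cartan i j : Commute _ _) _).smul_right _

theorem torus_add (v w : Fin l → ℂ) :
    torus A d c (v + w) = torus A d c v * torus A d c w := by
  rw [torus_eq_hexp, cartanElt_add, hexp_add (commute_cartanElt A d c v w), ← torus_eq_hexp,
    ← torus_eq_hexp]

theorem torus_zero : torus A d c 0 = 1 := by
  rw [torus_eq_hexp, cartanElt_zero, hexp_zero]

theorem torus_mul_torus_neg (v : Fin l → ℂ) : torus A d c v * torus A d c (-v) = 1 := by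
  rw [← torus_add, add_neg_cancel, torus_zero]

theorem torus_neg_mul_torus (v : Fin l → ℂ) : torus A d c (-v) * torus A d c v = 1 := by
  rw [← torus_add, neg_add_cancel, torus_zero]

theorem commute_torus (v w : Fin l → ℂ) : Commute (torus A d c v) (torus A d c w) := by
  rw [Commute, SemiconjBy, ← torus_add, ← torus_add, add_comm]

theorem cartanElt_mul_E (v : Fin l → ℂ) (j : Fin l) :
    cartanElt A d c v * E A d c j = E A d c j *
      (cartanElt A d c v + algebraMap Ch _ (PowerSeries.C (rootVal A v j))) := by
  rw [cartanElt_eq_sum, mul_add, Finset.sum_mul, Finset.mul_sum, rootVal, map_sum, map_sum,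
    Finset.mul_sum, ← Finset.sum_add_distrib]
  refine Finset.sum_congr rfl fun i _ => ?_
  rw [smul_mul_assoc, isRep.raise, smul_add, mul_smul_comm, ← Algebra.commutes,
    ← Algebra.smul_def, ← Int.cast_smul_eq_zsmul Ch, smul_smul, map_mul, map_intCast]

theorem cartanElt_mul_F (v : Fin l → ℂ) (j : Fin l) :
    cartanElt A d c v * F A d c j = F A d c j *
      (cartanElt A d c v + algebraMap Ch _ (PowerSeries.C (-rootVal A v j))) := by
  rw [cartanElt_eq_sum, mul_add, Finset.sum_mul, Finset.mul_sum, rootVal, ← Finset.sum_neg_distrib,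
    map_sum, map_sum, Finset.mul_sum, ← Finset.sum_add_distrib]
  refine Finset.sum_congr rfl fun i _ => ?_
  rw [smul_mul_assoc, isRep.lower, smul_sub, mul_smul_comm, ← Algebra.commutes,
    ← Algebra.smul_def, ← Int.cast_smul_eq_zsmul Ch, smul_smul, map_neg, neg_smul, map_mul,
    map_intCast, sub_eq_add_neg]

theorem torus_mul_E (v : Fin l → ℂ) (j : Fin l) :
    torus A d c v * E A d c j = qpow (rootVal A v j) • (E A d c j * torus A d c v) := by
  rw [torus_eq_hexp, hexp_mul (cartanElt_mul_E A d c v j),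
    hexp_add (Algebra.commutes _ _).symm, hexp_algebraMap, ← Algebra.commutes,
    ← Algebra.smul_def, mul_smul_comm]

theorem torus_mul_F (v : Fin l → ℂ) (j : Fin l) :
    torus A d c v * F A d c j = qpow (-rootVal A v j) • (F A d c j * torus A d c v) := by
  rw [torus_eq_hexp, hexp_mul (cartanElt_mul_F A d c v j),
    hexp_add (Algebra.commutes _ _).symm, hexp_algebraMap, ← Algebra.commutes,
    ← Algebra.smul_def, mul_smul_comm]

theorem torus_mul_H (v : Fin l → ℂ) (j : Fin l) :
    torus A d c v * H A d c j = H A d c j * torus A d c v := by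
  have h : cartanElt A d c v * H A d c j = H A d c j * cartanElt A d c v := by
    have := (commute_cartanElt A d c v (Pi.single j 1)).eq
    rwa [cartanElt_single, map_one, one_smul] at this
  rw [torus_eq_hexp, hexp_mul h]

theorem E_mul_torus (v : Fin l → ℂ) (j : Fin l) :
    E A d c j * torus A d c v = qpow (-rootVal A v j) • (torus A d c v * E A d c j) := by
  rw [torus_mul_E, smul_smul, qpow_neg_mul_qpow, one_smul]

theorem F_mul_torus (v : Fin l → ℂ) (j : Fin l) :
    F A d c j * torus A d c v = qpow (rootVal A v j) • (torus A d c v * F A d c j) := by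
  rw [torus_mul_F, smul_smul, mul_comm, qpow_neg_mul_qpow, one_smul]

end Uq

/-- An algebra homomorphism out of the quantum group intertwines the exponentials of the Cartan
part. -/
theorem map_torus {B : Type*} [Ring B] [Algebra Ch B] [HComplete B]
    (φ : Uq A d c →ₐ[Ch] B) (v : Fin l → ℂ) :
    φ (Uq.torus A d c v) = hexp (∑ j, (PowerSeries.C (v j) : Ch) • φ (Uq.H A d c j)) := by
  rw [Uq.torus_eq_hexp, map_hexp, Uq.cartanElt_eq_sum]
  simp only [map_sum, map_smul]

end Torus

end QGroup
end

noncomputable section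

namespace HAdic

/-! ### Skew-primitive elements -/

section Skew

variable {A : Type*} [Ring A] [Algebra Ch A]

theorem IsSum.op {p : PowerSeries A} {p' : PowerSeries Aᵐᵒᵖ} {s : A} (hs : IsSum p s)
    (h : ∀ k, PowerSeries.coeff k p' = MulOpposite.op (PowerSeries.coeff k p)) :
    IsSum p' (MulOpposite.op s) := by
  intro n
  obtain ⟨y, hy⟩ := hs n
  refine ⟨MulOpposite.op y, MulOpposite.unop_injective ?_⟩
  simp only [MulOpposite.unop_op, MulOpposite.unop_add, MulOpposite.unop_smul,
    Finset.unop_sum, h]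
  exact hy

theorem coeff_expSeries_op (x : A) (k : ℕ) : PowerSeries.coeff k (expSeries (MulOpposite.op x)) =
    MulOpposite.op (PowerSeries.coeff k (expSeries x)) := by
  simp only [expSeries, PowerSeries.coeff_mk, MulOpposite.op_smul, MulOpposite.op_pow]

theorem hexp_op [HComplete A] (x : A) : hexp (MulOpposite.op x) = MulOpposite.op (hexp x) :=
  ((isSum_ev (expSeries x)).op (coeff_expSeries_op x)).ev_eq

theorem hsinh_op [HComplete A] (x : A) : hsinh (MulOpposite.op x) = MulOpposite.op (hsinh x) := by
  refine ((isSum_ev (sinhSeries x)).op fun k => ?_).ev_eq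
  simp only [sinhSeries, QGroup.divh, PowerSeries.coeff_mk, map_sub, ← MulOpposite.op_neg,
    coeff_expSeries_op, MulOpposite.op_sub]

variable {Δ : A →ₐ[Ch] Completion (A ⊗[Ch] A)} {ε : A →ₐ[Ch] Ch} {x g g' : A}

/-- Coassociativity holds at an element `x` with `Δ x = x ⊗ g + g' ⊗ x`, where `g` and `g'` are
group-like. -/
theorem coassoc_skew (hx : Δ x = of _ (x ⊗ₜ g + g' ⊗ₜ x)) (hg : Δ g = of _ (g ⊗ₜ g))
    (hg' : Δ g' = of _ (g' ⊗ₜ g')) :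
    mapHat (TensorProduct.assoc Ch A A A).toLinearMap
        (tensorHat Δ.toLinearMap (of A).toLinearMap (Δ x))
      = tensorHat (of A).toLinearMap Δ.toLinearMap (Δ x) := by
  rw [hx, map_add (of _), map_add (tensorHat _ _), map_add (tensorHat _ _), tensorHat_of,
    tensorHat_of, tensorHat_of, tensorHat_of]
  simp only [AlgHom.toLinearMap_apply]
  rw [hx, hg, hg', pairing_of, pairing_of, pairing_of, pairing_of, ← map_add (of _),
    ← map_add (of _), mapHat_of]
  congr 1
  simp only [TensorProduct.add_tmul, TensorProduct.tmul_add, map_add, LinearEquiv.coe_coe,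
    TensorProduct.assoc_tmul]
  abel

theorem counit_left_skew (hx : Δ x = of _ (x ⊗ₜ g + g' ⊗ₜ x)) (hε : ε x = 0) (hg' : ε g' = 1) :
    mapHat ((TensorProduct.lid Ch A).toLinearMap ∘ₗ
      TensorProduct.map ε.toLinearMap LinearMap.id) (Δ x) = of A x := by
  rw [hx, mapHat_of]
  simp [hε, hg']

theorem counit_right_skew (hx : Δ x = of _ (x ⊗ₜ g + g' ⊗ₜ x)) (hε : ε x = 0) (hg : ε g = 1) :
    mapHat ((TensorProduct.rid Ch A).toLinearMap ∘ₗ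
      TensorProduct.map LinearMap.id ε.toLinearMap) (Δ x) = of A x := by
  rw [hx, mapHat_of]
  simp [hε, hg]

/-- The map `a ⊗ b ↦ ε(a) b` as an algebra homomorphism. -/
def counitLeft (ε : A →ₐ[Ch] Ch) : A ⊗[Ch] A →ₐ[Ch] A :=
  (Algebra.TensorProduct.lid Ch A : Ch ⊗[Ch] A →ₐ[Ch] A).comp
    (Algebra.TensorProduct.map ε (AlgHom.id Ch A))

/-- The map `a ⊗ b ↦ ε(b) a` as an algebra homomorphism. -/
def counitRight (ε : A →ₐ[Ch] Ch) : A ⊗[Ch] A →ₐ[Ch] A :=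
  (Algebra.TensorProduct.rid Ch Ch A : A ⊗[Ch] Ch →ₐ[Ch] A).comp
    (Algebra.TensorProduct.map (AlgHom.id Ch A) ε)

theorem counitLeft_toLinearMap (ε : A →ₐ[Ch] Ch) : (counitLeft ε).toLinearMap =
    (TensorProduct.lid Ch A).toLinearMap ∘ₗ TensorProduct.map ε.toLinearMap LinearMap.id := by
  refine TensorProduct.ext' fun a b => ?_
  simp [counitLeft]

theorem counitRight_toLinearMap (ε : A →ₐ[Ch] Ch) : (counitRight ε).toLinearMap =
    (TensorProduct.rid Ch A).toLinearMap ∘ₗ TensorProduct.map LinearMap.id ε.toLinearMap := by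
  refine TensorProduct.ext' fun a b => ?_
  simp [counitRight]

variable {S : A →ₗ[Ch] A}

theorem antipode_left_skew (hx : Δ x = of _ (x ⊗ₜ g + g' ⊗ₜ x)) (hε : ε x = 0)
    (hS : S x * g + S g' * x = 0) :
    mapHat (LinearMap.mul' Ch A ∘ₗ TensorProduct.map S LinearMap.id) (Δ x)
      = of A (algebraMap Ch A (ε x)) := by
  rw [hx, mapHat_of, hε, map_zero]
  exact congrArg (of A) hS

theorem antipode_right_skew (hx : Δ x = of _ (x ⊗ₜ g + g' ⊗ₜ x)) (hε : ε x = 0)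
    (hS : x * S g + g' * S x = 0) :
    mapHat (LinearMap.mul' Ch A ∘ₗ TensorProduct.map LinearMap.id S) (Δ x)
      = of A (algebraMap Ch A (ε x)) := by
  rw [hx, mapHat_of, hε, map_zero]
  exact congrArg (of A) hS

end Skew

end HAdic

namespace QGroup

open HAdic Uq

/-! ### Cartan data and weights -/

section Datum

variable {l : ℕ}

/-- The properties of the Cartan matrix of a semisimple Lie algebra and of its symmetrisation
that are used for the quantum group. -/
structure IsCartanDatum (A : Matrix (Fin l) (Fin l) ℤ) (d : Fin l → ℕ) : Prop where
  diag : ∀ i, A i i = 2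
  nonpos : ∀ i j, i ≠ j → A i j ≤ 0
  pos : ∀ i, 0 < d i
  symm : ∀ i j, (d i : ℤ) * A i j = d j * A j i
  det_ne_zero : (A.map (Int.cast : ℤ → ℂ)).det ≠ 0

variable (A : Matrix (Fin l) (Fin l) ℤ) (d : Fin l → ℕ) (c : Matrix (Fin l) (Fin l) ℂ)

/-- The coordinates of `Y_i` with respect to the elements `H_j`. -/
def weight (i : Fin l) : Fin l → ℂ := fun j => (d i : ℂ) * (A.map (Int.cast : ℤ → ℂ))⁻¹ i j

theorem cartanGen_weight (i : Fin l) : cartanGen (weight A d i) = weightGen A d i := rfl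

/-- The coordinates of `d_i H_i`, the logarithm of `K_i`. -/
def logK (i : Fin l) : Fin l → ℂ := Pi.single i (d i : ℂ)

/-- The coordinates of `∑ⱼ (c_ij / d_j) Y_j`, the element on which the simple roots `αⱼ` take the
values `c_ij`. -/
def shift (i : Fin l) : Fin l → ℂ := ∑ j, (c i j / (d j : ℂ)) • weight A d j

theorem rootVal_logK (i j : Fin l) : rootVal A (logK d i) j = d i * A i j := rootVal_single A i _ j

theorem shift_zero (i : Fin l) : shift A d 0 i = 0 := by simp [shift]

variable {A d c}

theorem IsCartanDatum.rootVal_weight (hD : IsCartanDatum A d) (i j : Fin l) :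
    rootVal A (weight A d i) j = if i = j then (d i : ℂ) else 0 := by
  have h := Matrix.nonsing_inv_mul (A.map (Int.cast : ℤ → ℂ)) (isUnit_iff_ne_zero.2 hD.det_ne_zero)
  have h' := congrFun (congrFun h i) j
  rw [Matrix.mul_apply, Matrix.one_apply] at h'
  simp only [Matrix.map_apply] at h'
  simp only [rootVal, weight, mul_assoc]
  rw [← Finset.mul_sum, h', mul_ite, mul_one, mul_zero]

theorem IsCartanDatum.rootVal_sum_weight (hD : IsCartanDatum A d) (t : Fin l → ℂ) (j : Fin l) :
    rootVal A (∑ p, t p • weight A d p) j = t j * d j := by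
  rw [rootVal_sum, Finset.sum_eq_single j]
  · rw [rootVal_smul, hD.rootVal_weight, if_pos rfl]
  · intro p _ hp
    rw [rootVal_smul, hD.rootVal_weight, if_neg hp, mul_zero]
  · intro h
    exact absurd (Finset.mem_univ j) h

theorem IsCartanDatum.d_ne_zero (hD : IsCartanDatum A d) (i : Fin l) : (d i : ℂ) ≠ 0 := by
  exact_mod_cast (hD.pos i).ne'

theorem IsCartanDatum.rootVal_shift (hD : IsCartanDatum A d) (i j : Fin l) :
    rootVal A (shift A d c i) j = c i j := by
  rw [shift, hD.rootVal_sum_weight, div_mul_cancel₀ _ (hD.d_ne_zero j)]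

theorem IsCartanDatum.symm_complex (hD : IsCartanDatum A d) (i j : Fin l) :
    (d i : ℂ) * A i j = d j * A j i := by exact_mod_cast hD.symm i j

theorem IsCartanDatum.toNat_sub_one (hD : IsCartanDatum A d) {i j : Fin l} (hij : i ≠ j) :
    ((1 - A i j).toNat : ℂ) - 1 = -A i j := by
  have h : (((1 - A i j).toNat : ℤ) : ℂ) = ((1 - A i j : ℤ) : ℂ) := by
    rw [Int.toNat_of_nonneg (by linarith [hD.nonpos i j hij])]
  rw [Int.cast_natCast] at h
  rw [h]
  push_cast
  ring

end Datum

/-! ### The comultiplication -/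

section Hopf

variable {l : ℕ} {A : Matrix (Fin l) (Fin l) ℤ} {d : Fin l → ℕ} {c : Matrix (Fin l) (Fin l) ℂ}

/-- The quantum Serre relation survives tensoring its two arguments with commuting elements. -/
theorem serreSum_tmul_right {U V : Type*} [Ring U] [Algebra Ch U] [Ring V] [Algebra Ch V]
    {e m : ℕ} (he : 0 < e) {t : ℂ} {x z : U} {g g' : V}
    (h : serreSum e m t x z = 0) (hg : Commute g g') :
    serreSum e m t (x ⊗ₜ[Ch] g) (z ⊗ₜ[Ch] g') = 0 := by
  have h1 : ∀ (y : U) (k : V), ((1 : U) ⊗ₜ[Ch] k) * (y ⊗ₜ[Ch] (1 : V)) =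
      qpow 0 • ((y ⊗ₜ[Ch] (1 : V)) * ((1 : U) ⊗ₜ[Ch] k)) := by
    intro y k
    simp
  obtain ⟨κ, hκ⟩ := exists_serreSum_mul he (h1 z g) (h1 x g) (h1 x g')
    (by simp [Commute, SemiconjBy, hg.eq]) m t
  have h2 := map_serreSum (Algebra.TensorProduct.includeLeft : U →ₐ[Ch] U ⊗[Ch] V) e m t x z
  rw [h, map_zero] at h2
  simp only [Algebra.TensorProduct.includeLeft_apply] at h2
  rw [add_zero, sub_zero, ← h2, zero_mul, smul_zero] at hκ
  simpa using hκ

theorem serreSum_tmul_left {U V : Type*} [Ring U] [Algebra Ch U] [Ring V] [Algebra Ch V]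
    {e m : ℕ} (he : 0 < e) {t : ℂ} {x z : V} {g g' : U}
    (h : serreSum e m t x z = 0) (hg : Commute g g') :
    serreSum e m t (g ⊗ₜ[Ch] x) (g' ⊗ₜ[Ch] z) = 0 := by
  have := map_serreSum (Algebra.TensorProduct.comm Ch V U : V ⊗[Ch] U →ₐ[Ch] U ⊗[Ch] V)
    e m t (x ⊗ₜ g) (z ⊗ₜ g')
  rw [serreSum_tmul_right he h hg, map_zero] at this
  exact this.symm

theorem H_mul_E (i j : Fin l) :
    H A d c i * E A d c j = E A d c j * H A d c i + (A i j : Ch) • E A d c j := by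
  rw [isRep.raise, Int.cast_smul_eq_zsmul]

theorem H_mul_F (i j : Fin l) :
    H A d c i * F A d c j = F A d c j * H A d c i - (A i j : Ch) • F A d c j := by
  rw [isRep.lower, Int.cast_smul_eq_zsmul]

variable (A d c)

/-- The image `e_i ⊗ e ^ {h (d_i H_i + γ_i)} + 1 ⊗ e_i` of `e_i` under the comultiplication, where
`γ_i` is the Cartan element with coordinates `shift A d c i`. -/
def comulE (i : Fin l) : Uq A d c ⊗[Ch] Uq A d c :=
  E A d c i ⊗ₜ torus A d c (logK d i + shift A d c i) + 1 ⊗ₜ E A d c i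

/-- The image `f_i ⊗ e ^ {- h γ_i} + K_i⁻¹ ⊗ f_i` of `f_i` under the comultiplication, where `γ_i`
is the Cartan element with coordinates `shift A d c i`. -/
def comulF (i : Fin l) : Uq A d c ⊗[Ch] Uq A d c :=
  F A d c i ⊗ₜ torus A d c (-shift A d c i) + torus A d c (-logK d i) ⊗ₜ F A d c i

/-- The image of `H_i` under the comultiplication. -/
def comulH (i : Fin l) : Uq A d c ⊗[Ch] Uq A d c := H A d c i ⊗ₜ 1 + 1 ⊗ₜ H A d c i

variable {A d c}

/-- The relation between `e_i` and `f_j` after comultiplication. The mixed terms cancel because of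
the symmetry of `d_i a_ij` and the antisymmetry of `c`; the term `R`, which is zero for `i ≠ j`, is
carried along. -/
theorem IsCartanDatum.comulE_mul_comulF (hD : IsCartanDatum A d) (hc : ∀ i j, c i j = -c j i)
    {i j : Fin l} {R : Uq A d c}
    (hR : E A d c i * F A d c j = qpow (c j i) • (F A d c j * E A d c i) + R) :
    comulE A d c i * comulF A d c j = qpow (c j i) • (comulF A d c j * comulE A d c i) +
      (R ⊗ₜ torus A d c (logK d i + shift A d c i - shift A d c j) +
        torus A d c (-logK d j) ⊗ₜ R) := by
  have e1 : torus A d c (logK d i + shift A d c i) * torus A d c (-shift A d c j) =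
      torus A d c (logK d i + shift A d c i - shift A d c j) := by
    rw [← torus_add, sub_eq_add_neg]
  have e2 : torus A d c (-shift A d c j) * torus A d c (logK d i + shift A d c i) =
      torus A d c (logK d i + shift A d c i - shift A d c j) := by
    rw [(commute_torus A d c _ _).eq, e1]
  have e3 : (E A d c i * torus A d c (-logK d j)) ⊗ₜ[Ch]
      (torus A d c (logK d i + shift A d c i) * F A d c j) =
      qpow (c j i) • ((torus A d c (-logK d j) * E A d c i) ⊗ₜ[Ch]
      (F A d c j * torus A d c (logK d i + shift A d c i))) := by
    rw [E_mul_torus, torus_mul_F, TensorProduct.smul_tmul_smul, ← qpow_add, rootVal_neg,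
      rootVal_logK, rootVal_add, rootVal_logK, hD.rootVal_shift, hc i j, hD.symm_complex i j]
    congr 2
    ring
  have e4 : E A d c i * torus A d c (-shift A d c j) =
      qpow (c j i) • (torus A d c (-shift A d c j) * E A d c i) := by
    rw [E_mul_torus, rootVal_neg, hD.rootVal_shift, neg_neg]
  simp only [comulE, comulF, add_mul, mul_add, Algebra.TensorProduct.tmul_mul_tmul, one_mul,
    mul_one]
  rw [e1, e2, e3, e4, hR]
  simp only [TensorProduct.add_tmul, TensorProduct.tmul_add, TensorProduct.tmul_smul,
    TensorProduct.smul_tmul', smul_add]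
  abel

theorem IsCartanDatum.serreSum_comulE (hD : IsCartanDatum A d) (hc : ∀ i j, c i j = -c j i)
    {i j : Fin l} (hij : i ≠ j) :
    serreSum (d i) (1 - A i j).toNat (c i j) (comulE A d c i) (comulE A d c j) = 0 := by
  have hm := hD.toNat_sub_one hij
  have hs := hD.symm_complex i j
  have hcij := hc i j
  have hcii : c i i = 0 := self_eq_neg.1 (hc i i)
  have hAii : (A i i : ℂ) = 2 := by exact_mod_cast congrArg (Int.cast : ℤ → ℂ) (hD.diag i)
  rw [comulE, comulE, serreSum_add_add (hD.pos i),
    serreSum_tmul_right (hD.pos i) (isRep.serre_raise i j hij) (commute_torus A d c _ _),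
    serreSum_tmul_left (hD.pos i) (isRep.serre_raise i j hij) (Commute.one_right _), add_zero]
  · rw [Algebra.TensorProduct.tmul_mul_tmul, Algebra.TensorProduct.tmul_mul_tmul, E_mul_torus,
      one_mul, mul_one, TensorProduct.tmul_smul, rootVal_add, rootVal_logK, hD.rootVal_shift, hm]
    congr 2
    linear_combination hs - hcij
  · rw [Algebra.TensorProduct.tmul_mul_tmul, Algebra.TensorProduct.tmul_mul_tmul, E_mul_torus,
      one_mul, mul_one, TensorProduct.tmul_smul, rootVal_add, rootVal_logK, hD.rootVal_shift,
      hcii, hAii]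
    congr 2
    ring
  · rw [Algebra.TensorProduct.tmul_mul_tmul, Algebra.TensorProduct.tmul_mul_tmul, torus_mul_E,
      one_mul, mul_one, TensorProduct.tmul_smul, rootVal_add, rootVal_logK, hD.rootVal_shift, hm]
    congr 2
    ring

theorem IsCartanDatum.serreSum_comulF (hD : IsCartanDatum A d) (hc : ∀ i j, c i j = -c j i)
    {i j : Fin l} (hij : i ≠ j) :
    serreSum (d i) (1 - A i j).toNat (c i j) (comulF A d c i) (comulF A d c j) = 0 := by
  have hm := hD.toNat_sub_one hij
  have hs := hD.symm_complex i j
  have hcij := hc i j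
  have hcii : c i i = 0 := self_eq_neg.1 (hc i i)
  have hAii : (A i i : ℂ) = 2 := by exact_mod_cast congrArg (Int.cast : ℤ → ℂ) (hD.diag i)
  rw [comulF, comulF, add_comm (_ ⊗ₜ _), add_comm (F A d c j ⊗ₜ _),
    serreSum_add_add (hD.pos i),
    serreSum_tmul_right (hD.pos i) (isRep.serre_lower i j hij) (commute_torus A d c _ _),
    serreSum_tmul_left (hD.pos i) (isRep.serre_lower i j hij) (commute_torus A d c _ _), add_zero]
  · rw [Algebra.TensorProduct.tmul_mul_tmul, Algebra.TensorProduct.tmul_mul_tmul, F_mul_torus,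
      torus_mul_F A d c (-shift A d c i) j, TensorProduct.smul_tmul_smul, ← qpow_add,
      rootVal_neg, rootVal_neg, rootVal_logK, hD.rootVal_shift, hm]
    congr 2
    linear_combination hs
  · rw [Algebra.TensorProduct.tmul_mul_tmul, Algebra.TensorProduct.tmul_mul_tmul, F_mul_torus,
      torus_mul_F A d c (-shift A d c i) i, TensorProduct.smul_tmul_smul, ← qpow_add,
      rootVal_neg, rootVal_neg, rootVal_logK, hD.rootVal_shift, hcii, hAii]
    congr 2
    ring
  · rw [Algebra.TensorProduct.tmul_mul_tmul, Algebra.TensorProduct.tmul_mul_tmul, F_mul_torus,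
      torus_mul_F A d c (-logK d i) j, TensorProduct.smul_tmul_smul, ← qpow_add,
      rootVal_neg, rootVal_neg, rootVal_logK, hD.rootVal_shift, hm]
    congr 2
    linear_combination -hcij

/-- The exponential of a primitive element is group-like. -/
theorem hexp_of_tmul {U : Type*} [Ring U] [Algebra Ch U] [HComplete U] (x : U) :
    hexp (of _ (x ⊗ₜ[Ch] (1 : U) + (1 : U) ⊗ₜ[Ch] x)) = of _ (hexp x ⊗ₜ[Ch] hexp x) := by
  have h1 := map_hexp ((of (U ⊗[Ch] U)).comp Algebra.TensorProduct.includeLeft) x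
  have h2 := map_hexp ((of (U ⊗[Ch] U)).comp Algebra.TensorProduct.includeRight) x
  simp only [AlgHom.comp_apply, Algebra.TensorProduct.includeLeft_apply,
    Algebra.TensorProduct.includeRight_apply] at h1 h2
  rw [map_add, hexp_add, ← h1, ← h2, ← map_mul]
  · simp
  · simp [Commute, SemiconjBy, ← map_mul]

theorem hsinh_of_tmul {U : Type*} [Ring U] [Algebra Ch U] [HComplete U] (x : U) :
    hsinh (of _ (x ⊗ₜ[Ch] (1 : U) + (1 : U) ⊗ₜ[Ch] x)) =
      of _ (hsinh x ⊗ₜ[Ch] hexp x + hexp (-x) ⊗ₜ[Ch] hsinh x) := by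
  have h1 := fun y => map_hexp ((of (U ⊗[Ch] U)).comp Algebra.TensorProduct.includeLeft) y
  have h2 := map_hexp ((of (U ⊗[Ch] U)).comp Algebra.TensorProduct.includeRight) x
  have h3 := map_hsinh ((of (U ⊗[Ch] U)).comp Algebra.TensorProduct.includeLeft) x
  have h4 := map_hsinh ((of (U ⊗[Ch] U)).comp Algebra.TensorProduct.includeRight) x
  simp only [AlgHom.comp_apply, Algebra.TensorProduct.includeLeft_apply,
    Algebra.TensorProduct.includeRight_apply] at h1 h2 h3 h4
  rw [map_add, hsinh_add, ← map_neg (of _), ← TensorProduct.neg_tmul, ← h1, ← h2, ← h3, ← h4,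
    ← map_mul, ← map_mul, ← map_add]
  · simp
  · simp [Commute, SemiconjBy, ← map_mul]

/-- The comultiplied generators satisfy the defining relations. -/
theorem IsCartanDatum.isRep_comul (hD : IsCartanDatum A d) (hc : ∀ i j, c i j = -c j i) :
    IsRep A d c (fun i => of _ (comulH A d c i)) (fun i => of _ (comulE A d c i))
      (fun i => of _ (comulF A d c i)) where
  cartan i j := by
    rw [← map_mul, ← map_mul]
    congr 1
    simp only [comulH, add_mul, mul_add, Algebra.TensorProduct.tmul_mul_tmul, one_mul, mul_one,
      isRep.cartan i j]
    abel
  raise i j := by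
    rw [← map_mul, ← map_mul, ← map_zsmul, ← map_add]
    congr 1
    simp only [comulH, comulE, add_mul, mul_add, Algebra.TensorProduct.tmul_mul_tmul, one_mul,
      mul_one, H_mul_E, torus_mul_H, TensorProduct.add_tmul, TensorProduct.tmul_add,
      ← TensorProduct.smul_tmul', TensorProduct.tmul_smul, smul_add, ← Int.cast_smul_eq_zsmul Ch]
    abel
  lower i j := by
    rw [← map_mul, ← map_mul, ← map_zsmul, ← map_sub]
    congr 1
    simp only [comulH, comulF, add_mul, mul_add, Algebra.TensorProduct.tmul_mul_tmul, one_mul,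
      mul_one, H_mul_F, torus_mul_H, TensorProduct.sub_tmul, TensorProduct.tmul_sub,
      ← TensorProduct.smul_tmul', TensorProduct.tmul_smul, smul_add, ← Int.cast_smul_eq_zsmul Ch]
    abel
  cross_same i := by
    rw [← map_mul, hD.comulE_mul_comulF hc (isRep.cross_same i), map_add, map_smul, map_mul]
    congr 1
    have hH : (PowerSeries.C (d i : ℂ) : Ch) • comulH A d c i =
        ((PowerSeries.C (d i : ℂ) : Ch) • H A d c i) ⊗ₜ 1 +
          1 ⊗ₜ ((PowerSeries.C (d i : ℂ) : Ch) • H A d c i) := by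
      rw [comulH, smul_add, TensorProduct.tmul_smul, TensorProduct.smul_tmul']
    rw [← map_smul (of _), hH, hsinh_of_tmul, add_sub_cancel_right, ← map_smul (of _), smul_add,
      torus_eq_hexp, torus_eq_hexp, cartanElt_neg, logK, cartanElt_single,
      TensorProduct.tmul_smul, ← TensorProduct.smul_tmul']
  cross_ne i j hij := by
    have := hD.comulE_mul_comulF hc (R := 0) (i := i) (j := j)
      (by rw [add_zero]; exact isRep.cross_ne i j hij)
    rw [TensorProduct.zero_tmul, TensorProduct.tmul_zero, add_zero, add_zero] at this
    rw [← map_mul, this, map_smul, map_mul]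
  serre_raise i j hij := by
    rw [← map_serreSum, hD.serreSum_comulE hc hij, map_zero]
  serre_lower i j hij := by
    rw [← map_serreSum, hD.serreSum_comulF hc hij, map_zero]

end Hopf

end QGroup
end

noncomputable section

namespace QGroup

open HAdic Uq

/-! ### Counit, antipode and the Hopf algebra structure -/

section Hopf

variable {l : ℕ} {A : Matrix (Fin l) (Fin l) ℤ} {d : Fin l → ℕ} {c : Matrix (Fin l) (Fin l) ℂ}

theorem isRep_counit : IsRep (B := Ch) A d c 0 0 0 where
  cartan i j := rfl
  raise i j := by simp
  lower i j := by simp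
  cross_same i := by simp [hsinh_zero]
  cross_ne i j _ := by simp
  serre_raise i j _ := serreSum_zero_right _ _ _ _
  serre_lower i j _ := serreSum_zero_right _ _ _ _

variable (A d c)

/-- The image `- e_i e ^ {- h (d_i H_i + γ_i)}` of `e_i` under the antipode, where `γ_i` is the
Cartan element with coordinates `shift A d c i`. -/
def antipodeE (i : Fin l) : Uq A d c :=
  -(E A d c i * torus A d c (-(logK d i + shift A d c i)))

/-- The image `- K_i f_i e ^ {h γ_i}` of `f_i` under the antipode, where `γ_i` is the Cartan element
with coordinates `shift A d c i`. -/
def antipodeF (i : Fin l) : Uq A d c :=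
  -(torus A d c (logK d i) * F A d c i * torus A d c (shift A d c i))

variable {A d c}

theorem antipodeE_eq (i : Fin l) : antipodeE A d c i =
    E A d c i * ((-1 : Ch) • torus A d c (-(logK d i + shift A d c i))) := by
  rw [antipodeE, mul_smul_comm, neg_one_smul]

theorem antipodeF_eq (i : Fin l) : antipodeF A d c i = F A d c i *
    ((-qpow (-rootVal A (logK d i) i)) • torus A d c (logK d i + shift A d c i)) := by
  rw [antipodeF, torus_mul_F, smul_mul_assoc, mul_assoc, ← torus_add, mul_smul_comm, neg_smul]

/-- The relation between `e_i` and `f_j` after applying the antipode. For `i = j` the coefficient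
and the exponential at the term `R` are trivial, for `i ≠ j` the term `R` is zero. -/
theorem IsCartanDatum.antipodeF_mul_antipodeE (hD : IsCartanDatum A d)
    (hc : ∀ i j, c i j = -c j i) {i j : Fin l} {R : Uq A d c}
    (hR : E A d c i * F A d c j = qpow (c j i) • (F A d c j * E A d c i) + R) :
    antipodeF A d c j * antipodeE A d c i = qpow (c j i) • (antipodeE A d c i * antipodeF A d c j) -
      qpow (rootVal A (logK d i) j - rootVal A (logK d j) j) •
        (R * torus A d c (logK d j + shift A d c j - (logK d i + shift A d c i))) := by
  have h1 : antipodeF A d c j * antipodeE A d c i =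
      qpow (c j i + (rootVal A (logK d i) j - rootVal A (logK d j) j)) • (F A d c j * E A d c i *
        torus A d c (logK d j + shift A d c j - (logK d i + shift A d c i))) := by
    have e : F A d c j * torus A d c (logK d j + shift A d c j) *
        (E A d c i * torus A d c (-(logK d i + shift A d c i))) =
        F A d c j * (torus A d c (logK d j + shift A d c j) * E A d c i) *
        torus A d c (-(logK d i + shift A d c i)) := by simp only [mul_assoc]
    rw [antipodeF_eq, antipodeE_eq]
    simp only [mul_smul_comm, smul_mul_assoc, smul_smul, mul_neg, neg_mul, one_mul, neg_neg]
    rw [e, torus_mul_E, mul_smul_comm, smul_mul_assoc, smul_smul, ← qpow_add,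
      ← mul_assoc, mul_assoc _ (torus A d c _), ← torus_add, ← sub_eq_add_neg]
    congr 2
    rw [rootVal_add, hD.rootVal_shift, rootVal_logK, rootVal_logK, rootVal_logK,
      hD.symm_complex i j]
    ring
  have h2 : antipodeE A d c i * antipodeF A d c j =
      qpow (rootVal A (logK d i) j - rootVal A (logK d j) j - c j i) •
        (E A d c i * F A d c j *
        torus A d c (logK d j + shift A d c j - (logK d i + shift A d c i))) := by
    have e : E A d c i * torus A d c (-(logK d i + shift A d c i)) *
        (F A d c j * torus A d c (logK d j + shift A d c j)) =
        E A d c i * (torus A d c (-(logK d i + shift A d c i)) * F A d c j) *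
        torus A d c (logK d j + shift A d c j) := by simp only [mul_assoc]
    rw [antipodeF_eq, antipodeE_eq]
    simp only [mul_smul_comm, smul_mul_assoc, smul_smul, mul_neg, mul_one, neg_neg]
    rw [e, torus_mul_F, mul_smul_comm, smul_mul_assoc, smul_smul, ← qpow_add,
      ← mul_assoc, mul_assoc _ (torus A d c _), ← torus_add,
      neg_add_eq_sub (logK d i + shift A d c i)]
    congr 2
    rw [rootVal_neg, rootVal_add, hD.rootVal_shift, rootVal_logK, rootVal_logK, hc i j]
    ring
  rw [h1, h2, hR, smul_smul, ← qpow_add, add_mul, smul_add, smul_mul_assoc, smul_smul,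
    add_sub_cancel, ← qpow_add, add_sub_cancel_right]
  congr 2
  ring

theorem IsCartanDatum.serreSum_antipodeE (hD : IsCartanDatum A d) (hc : ∀ i j, c i j = -c j i)
    {i j : Fin l} (hij : i ≠ j) :
    serreSum (d i) (1 - A i j).toNat (-c i j) (antipodeE A d c i) (antipodeE A d c j) = 0 := by
  have hT : ∀ p q : Fin l, ((-1 : Ch) • torus A d c (-(logK d p + shift A d c p))) * E A d c q =
      qpow (-(rootVal A (logK d p) q + c p q)) •
        (E A d c q * ((-1 : Ch) • torus A d c (-(logK d p + shift A d c p)))) := by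
    intro p q
    rw [smul_mul_assoc, torus_mul_E, mul_smul_comm, smul_comm, rootVal_neg, rootVal_add,
      hD.rootVal_shift]
  obtain ⟨κ, hκ⟩ := exists_serreSum_mul (hD.pos i) (hT i j) (hT i i) (hT j i)
    (((commute_torus A d c _ _).smul_left _).smul_right _) (1 - A i j).toNat (-c i j)
  have e : -c i j + -(rootVal A (logK d j) i + c j i) - -(rootVal A (logK d i) j + c i j) =
      c i j := by
    rw [rootVal_logK, rootVal_logK, hc j i]
    linear_combination hD.symm_complex i j
  rw [antipodeE_eq, antipodeE_eq, hκ, e, isRep.serre_raise i j hij, zero_mul, smul_zero]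

theorem IsCartanDatum.serreSum_antipodeF (hD : IsCartanDatum A d) (hc : ∀ i j, c i j = -c j i)
    {i j : Fin l} (hij : i ≠ j) :
    serreSum (d i) (1 - A i j).toNat (-c i j) (antipodeF A d c i) (antipodeF A d c j) = 0 := by
  have hT : ∀ (p q : Fin l) (a : Ch), (a • torus A d c (logK d p + shift A d c p)) * F A d c q =
      qpow (-(rootVal A (logK d p) q + c p q)) •
        (F A d c q * (a • torus A d c (logK d p + shift A d c p))) := by
    intro p q a
    rw [smul_mul_assoc, torus_mul_F, mul_smul_comm, smul_comm, rootVal_add,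
      hD.rootVal_shift]
  obtain ⟨κ, hκ⟩ := exists_serreSum_mul (hD.pos i) (hT i j _) (hT i i _) (hT j i _)
    (((commute_torus A d c _ _).smul_left (-qpow (-rootVal A (logK d i) i))).smul_right
      (-qpow (-rootVal A (logK d j) j))) (1 - A i j).toNat (-c i j)
  have e : -c i j + -(rootVal A (logK d j) i + c j i) - -(rootVal A (logK d i) j + c i j) =
      c i j := by
    rw [rootVal_logK, rootVal_logK, hc j i]
    linear_combination hD.symm_complex i j
  rw [antipodeF_eq, antipodeF_eq, hκ, e, isRep.serre_lower i j hij, zero_mul, smul_zero]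

/-- The images of the generators under the antipode satisfy the defining relations in the opposite
algebra. -/
theorem IsCartanDatum.isRep_antipode (hD : IsCartanDatum A d) (hc : ∀ i j, c i j = -c j i) :
    IsRep A d c (fun i => MulOpposite.op (-H A d c i))
      (fun i => MulOpposite.op (antipodeE A d c i))
      (fun i => MulOpposite.op (antipodeF A d c i)) where
  cartan i j := by
    rw [← MulOpposite.op_mul, ← MulOpposite.op_mul, neg_mul_neg, neg_mul_neg, isRep.cartan j i]
  raise i j := by
    rw [← MulOpposite.op_mul, ← MulOpposite.op_mul, ← MulOpposite.op_smul, ← MulOpposite.op_add]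
    congr 1
    rw [antipodeE, neg_mul_neg, neg_mul_neg, mul_assoc, torus_mul_H, ← mul_assoc, ← mul_assoc,
      isRep.raise, add_mul, smul_mul_assoc, smul_neg]
    abel
  lower i j := by
    rw [← MulOpposite.op_mul, ← MulOpposite.op_mul, ← MulOpposite.op_smul, ← MulOpposite.op_sub]
    congr 1
    have h1 : H A d c i * (torus A d c (logK d j) * F A d c j * torus A d c (shift A d c j)) =
        torus A d c (logK d j) * (H A d c i * F A d c j) * torus A d c (shift A d c j) := by
      rw [← mul_assoc, ← mul_assoc, ← torus_mul_H]
      simp only [mul_assoc]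
    rw [antipodeF, neg_mul_neg, neg_mul_neg, h1, mul_assoc, torus_mul_H, isRep.lower, mul_sub,
      sub_mul, mul_smul_comm, smul_mul_assoc, smul_neg]
    simp only [mul_assoc]
    abel
  cross_same i := by
    have hcii : c i i = 0 := self_eq_neg.1 (hc i i)
    rw [← MulOpposite.op_mul, ← MulOpposite.op_mul, ← MulOpposite.op_smul, ← MulOpposite.op_smul,
      hsinh_op, ← MulOpposite.op_smul, ← MulOpposite.op_add,
      hD.antipodeF_mul_antipodeE hc (isRep.cross_same i)]
    congr 1
    rw [sub_self, sub_self, qpow_zero, one_smul, torus_zero, mul_one, smul_neg, hsinh_neg,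
      smul_neg, ← sub_eq_add_neg]
  cross_ne i j hij := by
    have := hD.antipodeF_mul_antipodeE hc (R := 0) (i := i) (j := j)
      (by rw [add_zero]; exact isRep.cross_ne i j hij)
    rw [zero_mul, smul_zero, sub_zero] at this
    rw [← MulOpposite.op_mul, ← MulOpposite.op_mul, this, MulOpposite.op_smul]
  serre_raise i j hij := serreSum_op (hD.serreSum_antipodeE hc hij)
  serre_lower i j hij := serreSum_op (hD.serreSum_antipodeF hc hij)

variable (hD : IsCartanDatum A d) (hc : ∀ i j, c i j = -c j i)

/-- The comultiplication. -/
def comul : Uq A d c →ₐ[Ch] Completion (Uq A d c ⊗[Ch] Uq A d c) := Uq.lift (hD.isRep_comul hc)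

variable (A d c) in
/-- The counit. -/
def counit : Uq A d c →ₐ[Ch] Ch := Uq.lift isRep_counit

/-- The antipode as a homomorphism to the opposite algebra. -/
def antipodeOp : Uq A d c →ₐ[Ch] (Uq A d c)ᵐᵒᵖ := Uq.lift (hD.isRep_antipode hc)

/-- The antipode. -/
def antipode : Uq A d c →ₗ[Ch] Uq A d c :=
  (MulOpposite.opLinearEquiv Ch).symm.toLinearMap ∘ₗ (antipodeOp hD hc).toLinearMap

theorem comul_H (i : Fin l) : comul hD hc (H A d c i) = of _ (comulH A d c i) := lift_H _ i
theorem comul_E (i : Fin l) : comul hD hc (E A d c i) = of _ (comulE A d c i) := lift_E _ i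
theorem comul_F (i : Fin l) : comul hD hc (F A d c i) = of _ (comulF A d c i) := lift_F _ i

theorem counit_H (i : Fin l) : counit A d c (H A d c i) = 0 := lift_H _ i
theorem counit_E (i : Fin l) : counit A d c (E A d c i) = 0 := lift_E _ i
theorem counit_F (i : Fin l) : counit A d c (F A d c i) = 0 := lift_F _ i

theorem antipode_apply (x : Uq A d c) :
    antipode hD hc x = (antipodeOp hD hc x).unop := rfl

theorem antipode_H (i : Fin l) : antipode hD hc (H A d c i) = -H A d c i :=
  congrArg MulOpposite.unop (lift_H (hD.isRep_antipode hc) i)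
theorem antipode_E (i : Fin l) : antipode hD hc (E A d c i) = antipodeE A d c i :=
  congrArg MulOpposite.unop (lift_E (hD.isRep_antipode hc) i)
theorem antipode_F (i : Fin l) : antipode hD hc (F A d c i) = antipodeF A d c i :=
  congrArg MulOpposite.unop (lift_F (hD.isRep_antipode hc) i)

theorem antipode_mul (x y : Uq A d c) :
    antipode hD hc (x * y) = antipode hD hc y * antipode hD hc x := by
  simp only [antipode_apply, map_mul, MulOpposite.unop_mul]

theorem antipode_algebraMap (r : Ch) :
    antipode hD hc (algebraMap Ch _ r) = algebraMap Ch _ r := by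
  rw [antipode_apply, AlgHom.commutes]
  rfl

/-- Exponentials of the Cartan part are group-like whenever the `H_i` are primitive. -/
theorem map_torus_of_primitive {Δ : Uq A d c →ₐ[Ch] Completion (Uq A d c ⊗[Ch] Uq A d c)}
    (hΔ : ∀ i, Δ (H A d c i) = of _ (comulH A d c i)) (v : Fin l → ℂ) :
    Δ (torus A d c v) = of _ (torus A d c v ⊗ₜ torus A d c v) := by
  have h : ∑ j, (PowerSeries.C (v j) : Ch) • of (Uq A d c ⊗[Ch] Uq A d c) (comulH A d c j) =
      of _ (cartanElt A d c v ⊗ₜ[Ch] (1 : Uq A d c) + (1 : Uq A d c) ⊗ₜ[Ch] cartanElt A d c v) := by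
    simp only [comulH, cartanElt_eq_sum, TensorProduct.sum_tmul, TensorProduct.tmul_sum,
      ← TensorProduct.smul_tmul', TensorProduct.tmul_smul, map_add, map_sum, map_smul, smul_add,
      Finset.sum_add_distrib]
  rw [map_torus]
  simp only [hΔ]
  rw [h, hexp_of_tmul, ← torus_eq_hexp]

theorem comul_torus (v : Fin l → ℂ) :
    comul hD hc (torus A d c v) = of _ (torus A d c v ⊗ₜ torus A d c v) :=
  map_torus_of_primitive (comul_H hD hc) v

theorem counit_torus (v : Fin l → ℂ) : counit A d c (torus A d c v) = 1 := by
  rw [map_torus]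
  simp [counit_H, hexp_zero]

theorem antipode_torus (v : Fin l → ℂ) :
    antipode hD hc (torus A d c v) = torus A d c (-v) := by
  have h : ∑ j, (PowerSeries.C (v j) : Ch) • antipodeOp hD hc (H A d c j) =
      MulOpposite.op (cartanElt A d c (-v)) := by
    rw [cartanElt_eq_sum, Finset.op_sum]
    refine Finset.sum_congr rfl fun j _ => ?_
    rw [antipodeOp, lift_H, ← MulOpposite.op_smul, Pi.neg_apply, map_neg, neg_smul, smul_neg]
  rw [antipode_apply, map_torus, h, hexp_op, MulOpposite.unop_op, ← torus_eq_hexp]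

theorem comul_H_eq (i : Fin l) : comul hD hc (H A d c i) =
    of _ (H A d c i ⊗ₜ 1 + 1 ⊗ₜ H A d c i) := comul_H hD hc i
theorem comul_E_eq (i : Fin l) : comul hD hc (E A d c i) =
    of _ (E A d c i ⊗ₜ torus A d c (logK d i + shift A d c i) + 1 ⊗ₜ E A d c i) :=
  comul_E hD hc i
theorem comul_F_eq (i : Fin l) : comul hD hc (F A d c i) =
    of _ (F A d c i ⊗ₜ torus A d c (-shift A d c i) + torus A d c (-logK d i) ⊗ₜ F A d c i) :=
  comul_F hD hc i

theorem comul_one_eq : comul hD hc 1 = of _ (1 ⊗ₜ 1) := by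
  rw [map_one, ← Algebra.TensorProduct.one_def, map_one]

theorem coassoc_comul (x : Uq A d c) :
    mapHat (TensorProduct.assoc Ch (Uq A d c) (Uq A d c) (Uq A d c)).toLinearMap
        (tensorHat (comul hD hc).toLinearMap (of (Uq A d c)).toLinearMap (comul hD hc x))
      = tensorHat (of (Uq A d c)).toLinearMap (comul hD hc).toLinearMap (comul hD hc x) := by
  have key : ((mapHatAlg (Algebra.TensorProduct.assoc Ch Ch Ch (Uq A d c) (Uq A d c)
      (Uq A d c)).toAlgHom).comp (tensorHatAlg (comul hD hc) (of (Uq A d c)))).comp (comul hD hc) =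
      (tensorHatAlg (of (Uq A d c)) (comul hD hc)).comp (comul hD hc) := by
    refine algHom_ext (fun i => ?_) (fun i => ?_) (fun i => ?_)
    · simp only [AlgHom.comp_apply, tensorHatAlg_apply, mapHatAlg_apply]
      exact coassoc_skew (comul_H_eq hD hc i) (comul_one_eq hD hc) (comul_one_eq hD hc)
    · simp only [AlgHom.comp_apply, tensorHatAlg_apply, mapHatAlg_apply]
      exact coassoc_skew (comul_E_eq hD hc i) (comul_torus hD hc _) (comul_one_eq hD hc)
    · simp only [AlgHom.comp_apply, tensorHatAlg_apply, mapHatAlg_apply]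
      exact coassoc_skew (comul_F_eq hD hc i) (comul_torus hD hc _) (comul_torus hD hc _)
  have := DFunLike.congr_fun key x
  simp only [AlgHom.comp_apply, tensorHatAlg_apply, mapHatAlg_apply] at this
  exact this

theorem counit_left_comul (x : Uq A d c) :
    mapHat ((TensorProduct.lid Ch (Uq A d c)).toLinearMap ∘ₗ
      TensorProduct.map (counit A d c).toLinearMap LinearMap.id) (comul hD hc x) = of _ x := by
  have key : (mapHatAlg (counitLeft (counit A d c))).comp (comul hD hc) = of (Uq A d c) := by
    refine algHom_ext (fun i => ?_) (fun i => ?_) (fun i => ?_) <;>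
      rw [AlgHom.comp_apply, mapHatAlg_apply, counitLeft_toLinearMap]
    · exact counit_left_skew (comul_H_eq hD hc i) (counit_H i) (map_one _)
    · exact counit_left_skew (comul_E_eq hD hc i) (counit_E i) (map_one _)
    · exact counit_left_skew (comul_F_eq hD hc i) (counit_F i) (counit_torus _)
  rw [← counitLeft_toLinearMap, ← mapHatAlg_apply, ← AlgHom.comp_apply, key]

theorem counit_right_comul (x : Uq A d c) :
    mapHat ((TensorProduct.rid Ch (Uq A d c)).toLinearMap ∘ₗ
      TensorProduct.map LinearMap.id (counit A d c).toLinearMap) (comul hD hc x) = of _ x := by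
  have key : (mapHatAlg (counitRight (counit A d c))).comp (comul hD hc) = of (Uq A d c) := by
    refine algHom_ext (fun i => ?_) (fun i => ?_) (fun i => ?_) <;>
      rw [AlgHom.comp_apply, mapHatAlg_apply, counitRight_toLinearMap]
    · exact counit_right_skew (comul_H_eq hD hc i) (counit_H i) (map_one _)
    · exact counit_right_skew (comul_E_eq hD hc i) (counit_E i) (counit_torus _)
    · exact counit_right_skew (comul_F_eq hD hc i) (counit_F i) (counit_torus _)
  rw [← counitRight_toLinearMap, ← mapHatAlg_apply, ← AlgHom.comp_apply, key]

/-- A linear identity `L (Δ x) = ε(x)` that is compatible with products holds as soon as it holds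
on the generators. -/
theorem eq_counit_of_generators
    {L : Completion (Uq A d c ⊗[Ch] Uq A d c) →ₗ[Ch] Completion (Uq A d c)}
    (hone : L 1 = 1)
    (hmul : ∀ x y : Uq A d c,
      L (comul hD hc x) = of _ (algebraMap Ch _ (counit A d c x)) →
      L (comul hD hc y) = of _ (algebraMap Ch _ (counit A d c y)) →
      L (comul hD hc (x * y)) = of _ (algebraMap Ch _ (counit A d c (x * y))))
    (hH : ∀ i, L (comul hD hc (H A d c i)) = of _ (algebraMap Ch _ (counit A d c (H A d c i))))
    (hE : ∀ i, L (comul hD hc (E A d c i)) = of _ (algebraMap Ch _ (counit A d c (E A d c i))))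
    (hF : ∀ i, L (comul hD hc (F A d c i)) = of _ (algebraMap Ch _ (counit A d c (F A d c i))))
    (x : Uq A d c) : L (comul hD hc x) = of _ (algebraMap Ch _ (counit A d c x)) := by
  let V : Subalgebra Ch (Uq A d c) :=
    { carrier := {x | L (comul hD hc x) = of _ (algebraMap Ch _ (counit A d c x))}
      mul_mem' := fun {x y} hx hy => hmul x y hx hy
      add_mem' := fun {x y} hx hy => by
        change L (comul hD hc (x + y)) = _
        rw [map_add, map_add, map_add (counit A d c), map_add, map_add]
        exact congrArg₂ (· + ·) hx hy
      algebraMap_mem' := fun r => by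
        change L (comul hD hc (algebraMap Ch _ r)) = _
        rw [AlgHom.commutes, AlgHom.commutes, Algebra.algebraMap_eq_smul_one, map_smul, hone]
        simp [Algebra.algebraMap_eq_smul_one] }
  refine mem_of_closed V hH hE hF (fun y hy => ?_) x
  refine eq_of_forall_sub fun n => ?_
  obtain ⟨v, hv, z, rfl⟩ := hy n
  have hv' : L (comul hD hc v) = of _ (algebraMap Ch _ (counit A d c v)) := hv
  refine ⟨L (comul hD hc z) - of _ (algebraMap Ch _ (counit A d c z)), ?_⟩
  have hz : algebraMap Ch (Uq A d c) (counit A d c ((PowerSeries.X ^ n : Ch) • z)) =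
      (PowerSeries.X ^ n : Ch) • algebraMap Ch (Uq A d c) (counit A d c z) := by
    rw [map_smul, smul_eq_mul, map_mul, Algebra.smul_def]
  rw [map_add, map_add, map_add (counit A d c), map_add, map_add, hv', hz, map_smul, map_smul,
    map_smul, smul_sub]
  abel

theorem antipode_one : antipode hD hc 1 = 1 := by
  rw [← map_one (algebraMap Ch (Uq A d c)), antipode_algebraMap]

theorem antipode_left_comul (x : Uq A d c) :
    mapHat (LinearMap.mul' Ch (Uq A d c) ∘ₗ TensorProduct.map (antipode hD hc) LinearMap.id)
      (comul hD hc x) = of _ (algebraMap Ch _ (counit A d c x)) := by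
  refine eq_counit_of_generators hD hc ?_ (fun x y hx hy => ?_) (fun i => ?_) (fun i => ?_)
    (fun i => ?_) x
  · rw [← map_one (of _), mapHat_of, Algebra.TensorProduct.one_def]
    simp [antipode_one]
  · rw [map_mul (comul hD hc), map_mul (counit A d c)]
    exact convolution_left_mul (antipode_mul hD hc) hx hy
  · refine antipode_left_skew (comul_H_eq hD hc i) (counit_H i) ?_
    rw [antipode_H, antipode_one, mul_one, one_mul, neg_add_cancel]
  · refine antipode_left_skew (comul_E_eq hD hc i) (counit_E i) ?_
    rw [antipode_E, antipode_one, antipodeE, neg_mul, mul_assoc, torus_neg_mul_torus, mul_one,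
      one_mul, neg_add_cancel]
  · refine antipode_left_skew (comul_F_eq hD hc i) (counit_F i) ?_
    rw [antipode_F, antipode_torus, antipodeF, neg_neg, neg_mul, mul_assoc, torus_mul_torus_neg,
      mul_one, neg_add_cancel]

theorem antipode_right_comul (x : Uq A d c) :
    mapHat (LinearMap.mul' Ch (Uq A d c) ∘ₗ TensorProduct.map LinearMap.id (antipode hD hc))
      (comul hD hc x) = of _ (algebraMap Ch _ (counit A d c x)) := by
  refine eq_counit_of_generators hD hc ?_ (fun x y hx hy => ?_) (fun i => ?_) (fun i => ?_)
    (fun i => ?_) x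
  · rw [← map_one (of _), mapHat_of, Algebra.TensorProduct.one_def]
    simp [antipode_one]
  · rw [map_mul (comul hD hc), map_mul (counit A d c)]
    exact convolution_right_mul (antipode_mul hD hc) hx hy
  · refine antipode_right_skew (comul_H_eq hD hc i) (counit_H i) ?_
    rw [antipode_H, antipode_one, mul_one, one_mul, add_neg_cancel]
  · refine antipode_right_skew (comul_E_eq hD hc i) (counit_E i) ?_
    rw [antipode_E, antipode_torus, antipodeE, one_mul, add_neg_cancel]
  · refine antipode_right_skew (comul_F_eq hD hc i) (counit_F i) ?_
    rw [antipode_F, antipode_torus, antipodeF, neg_neg, mul_neg, ← mul_assoc, ← mul_assoc,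
      torus_neg_mul_torus, one_mul, add_neg_cancel]

/-- The topological Hopf algebra structure on the quantum group with an antisymmetric exponent
matrix `c`. -/
def hopf : TopHopf (Uq A d c) where
  complete := HComplete.isAdicComplete
  comul := comul hD hc
  counit := counit A d c
  antipode := antipode hD hc
  coassoc := coassoc_comul hD hc
  counit_left := counit_left_comul hD hc
  counit_right := counit_right_comul hD hc
  antipode_left := antipode_left_comul hD hc
  antipode_right := antipode_right_comul hD hc

end Hopf

end QGroup
end

noncomputable section

namespace HAdic

/-! ### Inner automorphisms -/

/-- Conjugation by a unit as an algebra homomorphism. -/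
def conjAlg {B : Type*} [Ring B] [Algebra Ch B] (u : Bˣ) : B →ₐ[Ch] B :=
  AlgHom.ofLinearMap (LinearMap.mulLeft Ch (u : B) ∘ₗ LinearMap.mulRight Ch ((u⁻¹ : Bˣ) : B))
    (by simp)
    (by
      intro x y
      simp only [LinearMap.comp_apply, LinearMap.mulLeft_apply, LinearMap.mulRight_apply]
      simp [mul_assoc])

theorem conjAlg_apply {B : Type*} [Ring B] [Algebra Ch B] (u : Bˣ) (x : B) :
    conjAlg u x = u * x * (u⁻¹ : Bˣ) := (mul_assoc _ _ _).symm

/-- The unit `e ^ {h x}` with inverse `e ^ {- h x}`. -/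
def hexpUnit {B : Type*} [Ring B] [Algebra Ch B] [HComplete B] (x : B) : Bˣ where
  val := hexp x
  inv := hexp (-x)
  val_inv := hexp_mul_hexp_neg x
  inv_val := by simpa using hexp_mul_hexp_neg (-x)

end HAdic

namespace QGroup

open HAdic Uq

/-! ### Change of the exponent matrix -/

section Iso

variable {l : ℕ} {A : Matrix (Fin l) (Fin l) ℤ} {d : Fin l → ℕ}
  {c c' : Matrix (Fin l) (Fin l) ℂ}

variable (A d) in
/-- The coordinates of `∑ₚ n_ip Y_p`. -/
def weightSum (n : Matrix (Fin l) (Fin l) ℂ) (i : Fin l) : Fin l → ℂ :=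
  ∑ p, n i p • weight A d p

theorem weightSum_neg (n : Matrix (Fin l) (Fin l) ℂ) (i : Fin l) :
    weightSum A d (-n) i = -weightSum A d n i := by
  simp [weightSum]

theorem IsCartanDatum.rootVal_weightSum (hD : IsCartanDatum A d) (n : Matrix (Fin l) (Fin l) ℂ)
    (i j : Fin l) : rootVal A (weightSum A d n i) j = n i j * d j := hD.rootVal_sum_weight _ j

variable (A d c) in
/-- The element `e_i e ^ {h ∑ₚ n_ip Y_p}`. -/
def twistE (n : Matrix (Fin l) (Fin l) ℂ) (i : Fin l) : Uq A d c :=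
  E A d c i * torus A d c (weightSum A d n i)

variable (A d c) in
/-- The element `e ^ {- h ∑ₚ n_ip Y_p} f_i`. -/
def twistF (n : Matrix (Fin l) (Fin l) ℂ) (i : Fin l) : Uq A d c :=
  torus A d c (-weightSum A d n i) * F A d c i

theorem twistF_eq (n : Matrix (Fin l) (Fin l) ℂ) (i : Fin l) : twistF A d c n i =
    F A d c i * (qpow (rootVal A (weightSum A d n i) i) • torus A d c (-weightSum A d n i)) := by
  rw [twistF, torus_mul_F, rootVal_neg, neg_neg, mul_smul_comm]

/-- The relation between the twisted generators. For `i = j` the coefficient and the exponential at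
the term `R` are trivial, for `i ≠ j` the term `R` is zero. -/
theorem IsCartanDatum.twistE_mul_twistF (hD : IsCartanDatum A d)
    {n : Matrix (Fin l) (Fin l) ℂ} (hn : ∀ i j, d j * n i j - d i * n j i = c i j - c' i j)
    {i j : Fin l} {R : Uq A d c'}
    (hR : E A d c' i * F A d c' j = qpow (c' j i) • (F A d c' j * E A d c' i) + R) :
    twistE A d c' n i * twistF A d c' n j = qpow (c j i) • (twistF A d c' n j * twistE A d c' n i) +
      qpow (n j j * d j - n i j * d j) •
        (R * torus A d c' (weightSum A d n i - weightSum A d n j)) := by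
  have h1 : twistE A d c' n i * twistF A d c' n j = qpow (n j j * d j - n i j * d j) •
      (E A d c' i * F A d c' j * torus A d c' (weightSum A d n i - weightSum A d n j)) := by
    have e : E A d c' i * torus A d c' (weightSum A d n i) *
        (F A d c' j * torus A d c' (-weightSum A d n j)) =
        E A d c' i * (torus A d c' (weightSum A d n i) * F A d c' j) *
        torus A d c' (-weightSum A d n j) := by simp only [mul_assoc]
    rw [twistE, twistF_eq, mul_smul_comm, mul_smul_comm, e, torus_mul_F, mul_smul_comm,
      smul_mul_assoc, smul_smul, ← qpow_add, hD.rootVal_weightSum, hD.rootVal_weightSum,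
      ← sub_eq_add_neg, ← mul_assoc, mul_assoc _ (torus A d c' _), ← torus_add, ← sub_eq_add_neg]
  have h2 : twistF A d c' n j * twistE A d c' n i = qpow (n j j * d j - n j i * d i) •
      (F A d c' j * E A d c' i * torus A d c' (weightSum A d n i - weightSum A d n j)) := by
    have e : F A d c' j * torus A d c' (-weightSum A d n j) *
        (E A d c' i * torus A d c' (weightSum A d n i)) =
        F A d c' j * (torus A d c' (-weightSum A d n j) * E A d c' i) *
        torus A d c' (weightSum A d n i) := by simp only [mul_assoc]
    rw [twistE, twistF_eq, mul_smul_comm, smul_mul_assoc, e, torus_mul_E, mul_smul_comm,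
      smul_mul_assoc, smul_smul, ← qpow_add, rootVal_neg, hD.rootVal_weightSum,
      hD.rootVal_weightSum, ← sub_eq_add_neg, ← mul_assoc, mul_assoc _ (torus A d c' _),
      ← torus_add, neg_add_eq_sub (weightSum A d n j)]
  rw [h1, h2, hR, add_mul, smul_add, smul_mul_assoc, smul_smul, smul_smul, ← qpow_add, ← qpow_add]
  congr 3
  linear_combination hn j i

theorem IsCartanDatum.isRep_twist (hD : IsCartanDatum A d)
    {n : Matrix (Fin l) (Fin l) ℂ} (hn : ∀ i j, d j * n i j - d i * n j i = c i j - c' i j) :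
    IsRep A d c (H A d c') (twistE A d c' n) (twistF A d c' n) where
  cartan := isRep.cartan
  raise i j := by
    rw [twistE, ← mul_assoc, isRep.raise, mul_assoc _ _ (H A d c' i), torus_mul_H, add_mul,
      smul_mul_assoc, mul_assoc]
  lower i j := by
    rw [twistF, ← mul_assoc, ← torus_mul_H, mul_assoc, isRep.lower, mul_sub, mul_smul_comm,
      mul_assoc]
  cross_same i := by
    rw [hD.twistE_mul_twistF hn (isRep.cross_same i), sub_self, sub_self, qpow_zero, one_smul,
      torus_zero, mul_one]
  cross_ne i j hij := by
    have := hD.twistE_mul_twistF hn (R := 0) (i := i) (j := j)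
      (by rw [add_zero]; exact isRep.cross_ne i j hij)
    rwa [zero_mul, smul_zero, add_zero] at this
  serre_raise i j hij := by
    have hT : ∀ p q : Fin l, torus A d c' (weightSum A d n p) * E A d c' q =
        qpow (n p q * d q) • (E A d c' q * torus A d c' (weightSum A d n p)) := by
      intro p q
      rw [torus_mul_E, hD.rootVal_weightSum]
    obtain ⟨κ, hκ⟩ := exists_serreSum_mul (hD.pos i) (hT i j) (hT i i) (hT j i)
      (commute_torus A d c' _ _) (1 - A i j).toNat (c i j)
    have e : c i j + n j i * d i - n i j * d j = c' i j := by linear_combination -hn i j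
    rw [twistE, twistE, hκ, e, isRep.serre_raise i j hij, zero_mul, smul_zero]
  serre_lower i j hij := by
    have hT : ∀ (p q : Fin l) (a : Ch), (a • torus A d c' (-weightSum A d n p)) * F A d c' q =
        qpow (n p q * d q) • (F A d c' q * (a • torus A d c' (-weightSum A d n p))) := by
      intro p q a
      rw [smul_mul_assoc, torus_mul_F, rootVal_neg, neg_neg, hD.rootVal_weightSum, mul_smul_comm,
        smul_comm]
    obtain ⟨κ, hκ⟩ := exists_serreSum_mul (hD.pos i) (hT i j _) (hT i i _) (hT j i _)
      (((commute_torus A d c' _ _).smul_left (qpow (rootVal A (weightSum A d n i) i))).smul_right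
        (qpow (rootVal A (weightSum A d n j) j))) (1 - A i j).toNat (c i j)
    have e : c i j + n j i * d i - n i j * d j = c' i j := by linear_combination -hn i j
    rw [twistF_eq, twistF_eq, hκ, e, isRep.serre_lower i j hij, zero_mul, smul_zero]

theorem map_torus_of_map_H {φ : Uq A d c →ₐ[Ch] Uq A d c'}
    (hφ : ∀ i, φ (H A d c i) = H A d c' i) (v : Fin l → ℂ) :
    φ (torus A d c v) = torus A d c' v := by
  rw [map_torus, torus_eq_hexp, cartanElt_eq_sum]
  simp only [hφ]

/-- The homomorphism `e_i ↦ e_i e ^ {h ∑ₚ n_ip Y_p}`, `f_i ↦ e ^ {- h ∑ₚ n_ip Y_p} f_i`,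
`H_i ↦ H_i` between the algebras with exponent matrices `c` and `c'`. -/
def twistHom (hD : IsCartanDatum A d) {n : Matrix (Fin l) (Fin l) ℂ}
    (hn : ∀ i j, d j * n i j - d i * n j i = c i j - c' i j) : Uq A d c →ₐ[Ch] Uq A d c' :=
  Uq.lift (hD.isRep_twist hn)

section

variable (hD : IsCartanDatum A d) {n : Matrix (Fin l) (Fin l) ℂ}
  (hn : ∀ i j, d j * n i j - d i * n j i = c i j - c' i j)

theorem twistHom_H (i : Fin l) : twistHom hD hn (H A d c i) = H A d c' i := lift_H _ i
theorem twistHom_E (i : Fin l) : twistHom hD hn (E A d c i) = twistE A d c' n i := lift_E _ i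
theorem twistHom_F (i : Fin l) : twistHom hD hn (F A d c i) = twistF A d c' n i := lift_F _ i

theorem twistHom_torus (v : Fin l → ℂ) : twistHom hD hn (torus A d c v) = torus A d c' v :=
  map_torus_of_map_H (twistHom_H hD hn) v

theorem twistHom_comp (hn' : ∀ i j, d j * (-n) i j - d i * (-n) j i = c' i j - c i j) :
    (twistHom hD hn').comp (twistHom hD hn) = AlgHom.id Ch (Uq A d c) := by
  refine algHom_ext (fun i => ?_) (fun i => ?_) (fun i => ?_) <;>
    rw [AlgHom.comp_apply, AlgHom.id_apply]
  · rw [twistHom_H, twistHom_H]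
  · rw [twistHom_E, twistE, map_mul, twistHom_torus, twistHom_E, twistE, weightSum_neg,
      mul_assoc, torus_neg_mul_torus, mul_one]
  · rw [twistHom_F, twistF, map_mul, twistHom_torus, twistHom_F, twistF, weightSum_neg, neg_neg,
      ← mul_assoc, torus_neg_mul_torus, one_mul]

end

/-- The homomorphism `twistHom` is an isomorphism; its inverse is given by `-n`. -/
def twistIso (hD : IsCartanDatum A d) {n : Matrix (Fin l) (Fin l) ℂ}
    (hn : ∀ i j, d j * n i j - d i * n j i = c i j - c' i j) : Uq A d c ≃ₐ[Ch] Uq A d c' :=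
  have hn' : ∀ i j, d j * (-n) i j - d i * (-n) j i = c' i j - c i j := fun i j => by
    simp only [Matrix.neg_apply]
    linear_combination -hn i j
  AlgEquiv.ofAlgHom (twistHom hD hn) (twistHom hD hn')
    (by
      have h := twistHom_comp hD hn' (n := -n) (by simpa only [neg_neg] using hn)
      simpa only [neg_neg] using h)
    (twistHom_comp hD hn hn')

theorem prod_ofFn_torus {m : ℕ} (v : Fin m → Fin l → ℂ) :
    (List.ofFn fun p => torus A d c (v p)).prod = torus A d c (∑ p, v p) := by
  induction m with
  | zero => simp [torus_zero]
  | succ m ih => rw [List.ofFn_succ, List.prod_cons, ih, Fin.sum_univ_succ, torus_add]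

theorem Lpow_eq_torus (p : Fin l) (t : ℂ) : Lpow A d c p t = torus A d c (t • weight A d p) := by
  rw [torus, cartanGen_smul, cartanGen_weight, Lpow]

theorem prod_Lpow (n : Matrix (Fin l) (Fin l) ℂ) (i : Fin l) :
    (List.ofFn fun p => Lpow A d c p (n i p)).prod = torus A d c (weightSum A d n i) := by
  simp only [Lpow_eq_torus, prod_ofFn_torus, weightSum]

theorem K_eq_torus (i : Fin l) : K A d c i = torus A d c (logK d i) := by
  rw [K, torus, logK, cartanGen_single]

theorem Kinv_eq_torus (i : Fin l) : Kinv A d c i = torus A d c (-logK d i) := by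
  rw [Kinv, torus, cartanGen_neg, logK, cartanGen_single]

end Iso

end QGroup
end

noncomputable section

namespace QGroup

open HAdic Uq

/-! ### Conjugation by the twisting element -/

section Twist

variable {l : ℕ} {A : Matrix (Fin l) (Fin l) ℤ} {d : Fin l → ℕ} {c : Matrix (Fin l) (Fin l) ℂ}

variable (A d c) in
/-- The exponent `∑ m_ij Y_i ⊗ Y_j`. -/
def twistLog (m : Matrix (Fin l) (Fin l) ℂ) : Uq A d c ⊗[Ch] Uq A d c :=
  ∑ i, ∑ j, (PowerSeries.C (m i j) : Ch) •
    (cartanElt A d c (weight A d i) ⊗ₜ[Ch] cartanElt A d c (weight A d j))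

theorem twist_eq_hexp (n : Matrix (Fin l) (Fin l) ℂ) :
    twist A d n = hexp (of _ (twistLog A d 0 (Matrix.of fun i j => -(n j i / (d j : ℂ))))) := by
  rw [twist, expHat_eq_hexp, twistLog, ← Finset.sum_neg_distrib]
  simp only [← Finset.sum_neg_distrib, Matrix.of_apply, map_neg, neg_smul]
  rfl

theorem cartanElt_sum_weight (t : Fin l → ℂ) : cartanElt A d c (∑ p, t p • weight A d p) =
    ∑ p, (PowerSeries.C (t p) : Ch) • cartanElt A d c (weight A d p) := by
  rw [cartanElt_sum]
  simp only [cartanElt_smul]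

/-- The element `x` has weight `θ`: `[Y_p, x] = θ_p x`. -/
def HasWeight (x : Uq A d c) (θ : Fin l → ℂ) : Prop :=
  ∀ p, cartanElt A d c (weight A d p) * x = x * (cartanElt A d c (weight A d p) +
    algebraMap Ch _ (PowerSeries.C (θ p)))

theorem HasWeight.mul {x y : Uq A d c} {θ η : Fin l → ℂ} (hx : HasWeight x θ)
    (hy : HasWeight y η) : HasWeight (x * y) (θ + η) := by
  intro p
  rw [← mul_assoc, hx p, mul_assoc, add_mul, hy p, Algebra.commutes, ← mul_add, mul_assoc,
    Pi.add_apply, map_add, map_add, add_assoc, add_comm (algebraMap Ch _ (PowerSeries.C (η p)))]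

theorem hasWeight_torus (v : Fin l → ℂ) : HasWeight (torus A d c v) 0 := by
  intro p
  rw [Pi.zero_apply, map_zero, map_zero, add_zero, torus_eq_hexp,
    ← hexp_mul (commute_cartanElt A d c v _).eq]

theorem hasWeight_H (i : Fin l) : HasWeight (H A d c i) 0 := by
  intro p
  have := (commute_cartanElt A d c (weight A d p) (Pi.single i 1)).eq
  rw [cartanElt_single, map_one, one_smul] at this
  rw [Pi.zero_apply, map_zero, map_zero, add_zero, this]

theorem IsCartanDatum.hasWeight_E (hD : IsCartanDatum A d) (i : Fin l) :
    HasWeight (E A d c i) (Pi.single i (d i : ℂ)) := by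
  intro p
  rw [cartanElt_mul_E, hD.rootVal_weight, Pi.single_apply]
  by_cases h : p = i
  · rw [if_pos h, if_pos h, h]
  · rw [if_neg h, if_neg h]

theorem IsCartanDatum.hasWeight_F (hD : IsCartanDatum A d) (i : Fin l) :
    HasWeight (F A d c i) (-Pi.single i (d i : ℂ)) := by
  intro p
  rw [cartanElt_mul_F, hD.rootVal_weight, Pi.neg_apply, Pi.single_apply]
  by_cases h : p = i
  · rw [if_pos h, if_pos h, h]
  · rw [if_neg h, if_neg h]

/-- Commutation of `∑ m_ij Y_i ⊗ Y_j` with `x ⊗ 1`, where `x` has weight `θ`. -/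
theorem twistLog_mul_left {m : Matrix (Fin l) (Fin l) ℂ} {x : Uq A d c} {θ : Fin l → ℂ}
    (hx : HasWeight x θ) :
    twistLog A d c m * (x ⊗ₜ 1) = (x ⊗ₜ 1) * (twistLog A d c m +
      1 ⊗ₜ cartanElt A d c (∑ j, (∑ i, m i j * θ i) • weight A d j)) := by
  rw [cartanElt_sum_weight]
  simp only [map_sum, map_mul, Finset.sum_smul, TensorProduct.tmul_sum]
  rw [Finset.sum_comm, twistLog, ← Finset.sum_add_distrib, Finset.sum_mul, Finset.mul_sum]
  refine Finset.sum_congr rfl fun i _ => ?_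
  rw [← Finset.sum_add_distrib, Finset.sum_mul, Finset.mul_sum]
  refine Finset.sum_congr rfl fun j _ => ?_
  rw [smul_mul_assoc, Algebra.TensorProduct.tmul_mul_tmul, hx i, mul_one, mul_add,
    mul_add (x ⊗ₜ[Ch] (1 : Uq A d c)), mul_smul_comm, Algebra.TensorProduct.tmul_mul_tmul,
    Algebra.TensorProduct.tmul_mul_tmul, one_mul, mul_one, TensorProduct.add_tmul, smul_add,
    ← Algebra.commutes, ← Algebra.smul_def, one_mul, TensorProduct.tmul_smul,
    ← TensorProduct.smul_tmul', smul_smul]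

/-- Commutation of `∑ m_ij Y_i ⊗ Y_j` with `1 ⊗ x`, where `x` has weight `θ`. -/
theorem twistLog_mul_right {m : Matrix (Fin l) (Fin l) ℂ} {x : Uq A d c} {θ : Fin l → ℂ}
    (hx : HasWeight x θ) :
    twistLog A d c m * (1 ⊗ₜ x) = (1 ⊗ₜ x) * (twistLog A d c m +
      cartanElt A d c (∑ i, (∑ j, m i j * θ j) • weight A d i) ⊗ₜ 1) := by
  rw [cartanElt_sum_weight]
  simp only [map_sum, map_mul, Finset.sum_smul, TensorProduct.sum_tmul]
  rw [twistLog, ← Finset.sum_add_distrib, Finset.sum_mul, Finset.mul_sum]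
  refine Finset.sum_congr rfl fun i _ => ?_
  rw [← Finset.sum_add_distrib, Finset.sum_mul, Finset.mul_sum]
  refine Finset.sum_congr rfl fun j _ => ?_
  rw [smul_mul_assoc, Algebra.TensorProduct.tmul_mul_tmul, hx j, mul_one, mul_add,
    mul_add ((1 : Uq A d c) ⊗ₜ[Ch] x), mul_smul_comm, Algebra.TensorProduct.tmul_mul_tmul,
    Algebra.TensorProduct.tmul_mul_tmul, one_mul, mul_one, TensorProduct.tmul_add, smul_add,
    ← Algebra.commutes, ← Algebra.smul_def, one_mul, TensorProduct.tmul_smul,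
    ← TensorProduct.smul_tmul', smul_smul]

theorem hexp_of_one_tmul (v : Fin l → ℂ) :
    hexp (of (Uq A d c ⊗[Ch] Uq A d c) (1 ⊗ₜ cartanElt A d c v)) =
      of _ (1 ⊗ₜ torus A d c v) := by
  rw [torus_eq_hexp]
  exact (map_hexp ((of (Uq A d c ⊗[Ch] Uq A d c)).comp Algebra.TensorProduct.includeRight)
    (cartanElt A d c v)).symm

theorem hexp_of_tmul_one (v : Fin l → ℂ) :
    hexp (of (Uq A d c ⊗[Ch] Uq A d c) (cartanElt A d c v ⊗ₜ 1)) =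
      of _ (torus A d c v ⊗ₜ 1) := by
  rw [torus_eq_hexp]
  exact (map_hexp ((of (Uq A d c ⊗[Ch] Uq A d c)).comp Algebra.TensorProduct.includeLeft)
    (cartanElt A d c v)).symm

theorem commute_twistLog_left (m : Matrix (Fin l) (Fin l) ℂ) (v : Fin l → ℂ) :
    Commute (twistLog A d c m) (cartanElt A d c v ⊗ₜ 1) := by
  refine Commute.sum_left _ _ _ fun i _ => Commute.sum_left _ _ _ fun j _ =>
    Commute.smul_left ?_ _
  rw [Commute, SemiconjBy, Algebra.TensorProduct.tmul_mul_tmul,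
    Algebra.TensorProduct.tmul_mul_tmul, (commute_cartanElt A d c _ v).eq, mul_one, one_mul]

theorem commute_twistLog_right (m : Matrix (Fin l) (Fin l) ℂ) (v : Fin l → ℂ) :
    Commute (twistLog A d c m) (1 ⊗ₜ cartanElt A d c v) := by
  refine Commute.sum_left _ _ _ fun i _ => Commute.sum_left _ _ _ fun j _ =>
    Commute.smul_left ?_ _
  rw [Commute, SemiconjBy, Algebra.TensorProduct.tmul_mul_tmul,
    Algebra.TensorProduct.tmul_mul_tmul, (commute_cartanElt A d c _ v).eq, mul_one, one_mul]

theorem commute_hexp_hexp {B : Type*} [Ring B] [Algebra Ch B] [HComplete B] {x y : B}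
    (h : Commute x y) : Commute (hexp x) (hexp y) := by
  rw [Commute, SemiconjBy, ← hexp_add h, ← hexp_add h.symm, add_comm]

/-- Conjugation of `x ⊗ e ^ {h v}` by the exponential of `∑ m_ij Y_i ⊗ Y_j`. -/
theorem hexp_twistLog_mul_left {m : Matrix (Fin l) (Fin l) ℂ} {x : Uq A d c} {θ : Fin l → ℂ}
    (hx : HasWeight x θ) (v : Fin l → ℂ) :
    hexp (of _ (twistLog A d c m)) * of _ (x ⊗ₜ torus A d c v) =
      of _ (x ⊗ₜ torus A d c (∑ j, (∑ i, m i j * θ i) • weight A d j + v)) *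
        hexp (of _ (twistLog A d c m)) := by
  set w := ∑ j, (∑ i, m i j * θ i) • weight A d j with hw
  have h1 := congrArg (of (Uq A d c ⊗[Ch] Uq A d c)) (twistLog_mul_left (m := m) hx)
  rw [map_mul, map_mul, map_add, ← hw] at h1
  have h2 := (commute_twistLog_right (c := c) m w).map (of (Uq A d c ⊗[Ch] Uq A d c))
  have h3 := commute_hexp_hexp
    ((commute_twistLog_right (c := c) m v).map (of (Uq A d c ⊗[Ch] Uq A d c)))
  rw [hexp_of_one_tmul] at h3
  have e1 : x ⊗ₜ[Ch] torus A d c v = (x ⊗ₜ[Ch] (1 : Uq A d c)) * (1 ⊗ₜ torus A d c v) := by simp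
  have e2 : x ⊗ₜ[Ch] torus A d c (w + v) =
      (x ⊗ₜ[Ch] (1 : Uq A d c)) * ((1 ⊗ₜ torus A d c w) * (1 ⊗ₜ torus A d c v)) := by
    simp [torus_add]
  rw [e1, e2, map_mul, map_mul, map_mul, ← mul_assoc, hexp_mul h1, add_comm, hexp_add h2.symm,
    hexp_of_one_tmul, mul_assoc, mul_assoc, h3.eq]
  simp only [mul_assoc]

/-- Conjugation of `e ^ {h v} ⊗ x` by the exponential of `∑ m_ij Y_i ⊗ Y_j`. -/
theorem hexp_twistLog_mul_right {m : Matrix (Fin l) (Fin l) ℂ} {x : Uq A d c} {θ : Fin l → ℂ}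
    (hx : HasWeight x θ) (v : Fin l → ℂ) :
    hexp (of _ (twistLog A d c m)) * of _ (torus A d c v ⊗ₜ x) =
      of _ (torus A d c (∑ i, (∑ j, m i j * θ j) • weight A d i + v) ⊗ₜ x) *
        hexp (of _ (twistLog A d c m)) := by
  set w := ∑ i, (∑ j, m i j * θ j) • weight A d i with hw
  have h1 := congrArg (of (Uq A d c ⊗[Ch] Uq A d c)) (twistLog_mul_right (m := m) hx)
  rw [map_mul, map_mul, map_add, ← hw] at h1
  have h2 := (commute_twistLog_left (c := c) m w).map (of (Uq A d c ⊗[Ch] Uq A d c))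
  have h3 := commute_hexp_hexp
    ((commute_twistLog_left (c := c) m v).map (of (Uq A d c ⊗[Ch] Uq A d c)))
  rw [hexp_of_tmul_one] at h3
  have e1 : torus A d c v ⊗ₜ[Ch] x = ((1 : Uq A d c) ⊗ₜ[Ch] x) * (torus A d c v ⊗ₜ 1) := by simp
  have e2 : torus A d c (w + v) ⊗ₜ[Ch] x =
      ((1 : Uq A d c) ⊗ₜ[Ch] x) * ((torus A d c w ⊗ₜ 1) * (torus A d c v ⊗ₜ 1)) := by
    simp [torus_add]
  rw [e1, e2, map_mul, map_mul, map_mul, ← mul_assoc, hexp_mul h1, add_comm, hexp_add h2.symm,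
    hexp_of_tmul_one, mul_assoc, mul_assoc, h3.eq]
  simp only [mul_assoc]

/-- Conjugation of a skew-primitive coproduct `x ⊗ e ^ {h v} + e ^ {h w} ⊗ x`. -/
theorem conj_twist_skew {n : Matrix (Fin l) (Fin l) ℂ}
    {u : (Completion (Ustd A d ⊗[Ch] Ustd A d))ˣ}
    (hu : (u : Completion (Ustd A d ⊗[Ch] Ustd A d)) = twist A d n) {x : Ustd A d}
    {i : Fin l} {t : ℂ} (hx : HasWeight x (Pi.single i t)) (v w : Fin l → ℂ) :
    conjAlg u (of _ (x ⊗ₜ torus A d 0 v + torus A d 0 w ⊗ₜ x)) =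
      of _ (x ⊗ₜ torus A d 0 (v - ∑ j, (n j i / d j * t) • weight A d j) +
        torus A d 0 (w - ∑ j, (n i j / d i * t) • weight A d j) ⊗ₜ x) := by
  have hL := hexp_twistLog_mul_left (m := Matrix.of fun i j => -(n j i / (d j : ℂ))) hx v
  have hR := hexp_twistLog_mul_right (m := Matrix.of fun i j => -(n j i / (d j : ℂ))) hx w
  rw [← twist_eq_hexp, ← hu] at hL hR
  simp only [Matrix.of_apply, Pi.single_apply, mul_ite, mul_zero, Finset.sum_ite_eq',
    Finset.mem_univ, if_true, neg_mul, neg_smul, Finset.sum_neg_distrib, neg_add_eq_sub] at hL hR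
  rw [conjAlg_apply, map_add, mul_add, hL, hR, ← add_mul, mul_assoc, Units.mul_inv, mul_one,
    map_add]

end Twist

/-! ### The twisted Hopf algebra structure -/

section Main

variable {l : ℕ} {A : Matrix (Fin l) (Fin l) ℤ} {d : Fin l → ℕ} {c : Matrix (Fin l) (Fin l) ℂ}

theorem IsCartanDatum.hasWeight_twistE (hD : IsCartanDatum A d) (n : Matrix (Fin l) (Fin l) ℂ)
    (i : Fin l) : HasWeight (twistE A d c n i) (Pi.single i (d i : ℂ)) := by
  simpa [twistE] using (hD.hasWeight_E i).mul (hasWeight_torus (weightSum A d n i))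

theorem IsCartanDatum.hasWeight_twistF (hD : IsCartanDatum A d) (n : Matrix (Fin l) (Fin l) ℂ)
    (i : Fin l) : HasWeight (twistF A d c n i) (Pi.single i (-(d i : ℂ))) := by
  simpa [twistF, Pi.single_neg] using (hasWeight_torus (-weightSum A d n i)).mul (hD.hasWeight_F i)

theorem IsCartanDatum.sum_weight_eq (hD : IsCartanDatum A d) (n : Matrix (Fin l) (Fin l) ℂ)
    (i : Fin l) : ∑ j, (n i j / d i * d i) • weight A d j = weightSum A d n i := by
  refine Finset.sum_congr rfl fun j _ => ?_
  rw [div_mul_cancel₀ _ (hD.d_ne_zero i)]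

theorem IsCartanDatum.weightSum_sub (hD : IsCartanDatum A d) {n : Matrix (Fin l) (Fin l) ℂ}
    (hn : ∀ i j, (d j : ℂ) * n i j - d i * n j i = c i j) (i : Fin l) :
    weightSum A d n i - ∑ j, (n j i / d j * d i) • weight A d j = shift A d c i := by
  rw [weightSum, shift, ← Finset.sum_sub_distrib]
  refine Finset.sum_congr rfl fun j _ => ?_
  rw [← sub_smul, ← hn i j]
  congr 1
  have := hD.d_ne_zero j
  field_simp

/-- The twisted comultiplication is `comul`. Both are algebra homomorphisms, and on the generators
their agreement follows from `conj_twist_skew` and `IsCartanDatum.weightSum_sub`. -/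
theorem twisted_comul_eq {π : Equiv.Perm (Fin l)} (hD : IsCartanDatum A d)
    (hc : ∀ i j, cayleyCoeff A d π i j = -cayleyCoeff A d π j i)
    {n : Matrix (Fin l) (Fin l) ℂ}
    (hn : ∀ i j, (d j : ℂ) * n i j - d i * n j i = cayleyCoeff A d π i j)
    {S₀ : TopHopf (Ustd A d)} {ψ : Ucox A d π ≃ₐ[Ch] Ustd A d}
    {u : (Completion (Ustd A d ⊗[Ch] Ustd A d))ˣ} (hS₀ : IsStandardHopf S₀)
    (hψ : IsCoxeterIso n ψ) (hu : (u : Completion (Ustd A d ⊗[Ch] Ustd A d)) = twist A d n)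
    (x : Ucox A d π) :
    mapHat (TensorProduct.map ψ.symm.toLinearMap ψ.symm.toLinearMap)
      (u * S₀.comul (ψ x) * (u⁻¹ : (Completion (Ustd A d ⊗[Ch] Ustd A d))ˣ)) =
      comul hD hc x := by
  have hψE : ∀ i, ψ (E A d _ i) = twistE A d 0 n i := fun i => by
    rw [hψ.map_E, prod_Lpow, twistE]
  have hψF : ∀ i, ψ (F A d _ i) = twistF A d 0 n i := fun i => by
    rw [hψ.map_F, twistF, ← weightSum_neg, ← prod_Lpow]
    rfl
  have hT : ∀ v, ψ.symm (torus A d 0 v) = torus A d _ v := by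
    refine map_torus_of_map_H (φ := (ψ.symm : Ustd A d →ₐ[Ch] Ucox A d π)) fun i => ?_
    exact ψ.symm_apply_eq.2 (hψ.map_H i).symm
  have hΔT : ∀ v, S₀.comul (torus A d 0 v) = of _ (torus A d 0 v ⊗ₜ torus A d 0 v) :=
    map_torus_of_primitive hS₀.comul_H
  have key : (mapHatAlg (Algebra.TensorProduct.map (ψ.symm : Ustd A d →ₐ[Ch] Ucox A d π)
      (ψ.symm : Ustd A d →ₐ[Ch] Ucox A d π))).comp ((conjAlg u).comp (S₀.comul.comp
        (ψ : Ucox A d π →ₐ[Ch] Ustd A d))) = comul hD hc := by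
    refine algHom_ext (fun i => ?_) (fun i => ?_) (fun i => ?_) <;>
      rw [AlgHom.comp_apply, AlgHom.comp_apply, AlgHom.comp_apply, AlgEquiv.coe_toAlgHom]
    · have h := conj_twist_skew hu (x := H A d 0 i) (i := i) (t := 0)
        (by rw [Pi.single_zero]; exact hasWeight_H i) 0 0
      simp only [mul_zero, zero_smul, Finset.sum_const_zero, sub_zero, torus_zero] at h
      rw [hψ.map_H, hS₀.comul_H, h, mapHatAlg_of, comul_H_eq, ← hψ.map_H i]
      simp
    · have hΔ : S₀.comul (twistE A d 0 n i) = of _ (twistE A d 0 n i ⊗ₜ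
          torus A d 0 (logK d i + weightSum A d n i) +
            torus A d 0 (weightSum A d n i) ⊗ₜ twistE A d 0 n i) := by
        rw [twistE, map_mul, hS₀.comul_E, hΔT, ← map_mul, add_mul,
          Algebra.TensorProduct.tmul_mul_tmul, Algebra.TensorProduct.tmul_mul_tmul, one_mul,
          K_eq_torus, ← torus_add]
      rw [hψE, hΔ, conj_twist_skew hu (hD.hasWeight_twistE n i), hD.sum_weight_eq, sub_self,
        add_sub_assoc, hD.weightSum_sub hn, mapHatAlg_of, comul_E_eq, torus_zero, ← hψE i]
      simp [hT]
    · have hΔ : S₀.comul (twistF A d 0 n i) = of _ (twistF A d 0 n i ⊗ₜ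
          torus A d 0 (-weightSum A d n i) +
            torus A d 0 (-weightSum A d n i - logK d i) ⊗ₜ twistF A d 0 n i) := by
        rw [twistF, map_mul, hS₀.comul_F, hΔT, ← map_mul, mul_add,
          Algebra.TensorProduct.tmul_mul_tmul, Algebra.TensorProduct.tmul_mul_tmul, mul_one,
          Kinv_eq_torus, ← torus_add, ← sub_eq_add_neg]
      rw [hψF, hΔ, conj_twist_skew hu (hD.hasWeight_twistF n i)]
      simp only [mul_neg, neg_smul, Finset.sum_neg_distrib]
      have e1 : -weightSum A d n i - -∑ j, (n j i / d j * d i) • weight A d j =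
          -shift A d (cayleyCoeff A d π) i := by
        rw [← hD.weightSum_sub hn]
        abel
      have e2 : -weightSum A d n i - logK d i - -weightSum A d n i = -logK d i := by abel
      rw [hD.sum_weight_eq, e1, e2, mapHatAlg_of, comul_F_eq, ← hψF i]
      simp [hT]
  rw [← key, AlgHom.comp_apply, AlgHom.comp_apply, AlgHom.comp_apply, conjAlg_apply,
    mapHatAlg_apply]
  rfl

/-- The structure `hopf` for `c = 0` is the standard Hopf algebra structure. -/
theorem isStandardHopf_hopf (hD : IsCartanDatum A d)
    (hc : ∀ i j, (0 : Matrix (Fin l) (Fin l) ℂ) i j = -(0 : Matrix (Fin l) (Fin l) ℂ) j i) :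
    IsStandardHopf (hopf hD hc) where
  comul_H := comul_H_eq hD hc
  comul_E i := by
    refine (comul_E_eq hD hc i).trans ?_
    rw [shift_zero, add_zero, K_eq_torus]
  comul_F i := by
    refine (comul_F_eq hD hc i).trans ?_
    rw [shift_zero, neg_zero, torus_zero, Kinv_eq_torus]
  counit_H := counit_H
  counit_E := counit_E
  counit_F := counit_F
  antipode_H := antipode_H hD hc
  antipode_E i := by
    refine (antipode_E hD hc i).trans ?_
    rw [antipodeE, shift_zero, add_zero, Kinv_eq_torus]
  antipode_F i := by
    refine (antipode_F hD hc i).trans ?_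
    rw [antipodeF, shift_zero, torus_zero, mul_one, K_eq_torus]

theorem twisted_counit_eq {π : Equiv.Perm (Fin l)} {n : Matrix (Fin l) (Fin l) ℂ}
    {S₀ : TopHopf (Ustd A d)} {ψ : Ucox A d π ≃ₐ[Ch] Ustd A d} (hS₀ : IsStandardHopf S₀)
    (hψ : IsCoxeterIso n ψ) (x : Ucox A d π) :
    S₀.counit (ψ x) = counit A d (cayleyCoeff A d π) x := by
  have key : S₀.counit.comp (ψ : Ucox A d π →ₐ[Ch] Ustd A d) =
      counit A d (cayleyCoeff A d π) := by
    refine algHom_ext (fun i => ?_) (fun i => ?_) (fun i => ?_) <;>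
      rw [AlgHom.comp_apply, AlgEquiv.coe_toAlgHom]
    · rw [hψ.map_H, hS₀.counit_H, counit_H]
    · rw [hψ.map_E, map_mul, hS₀.counit_E, zero_mul, counit_E]
    · rw [hψ.map_F, map_mul, hS₀.counit_F, mul_zero, counit_F]
  rw [← key, AlgHom.comp_apply, AlgEquiv.coe_toAlgHom]

theorem isCoxeterIso_twistIso {π : Equiv.Perm (Fin l)} (hD : IsCartanDatum A d)
    {n : Matrix (Fin l) (Fin l) ℂ}
    (hn : ∀ i j, (d j : ℂ) * n i j - d i * n j i =
      cayleyCoeff A d π i j - (0 : Matrix (Fin l) (Fin l) ℂ) i j) :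
    IsCoxeterIso n (twistIso hD hn) where
  map_E i := (twistHom_E hD hn i).trans (by rw [prod_Lpow, twistE])
  map_F i := (twistHom_F hD hn i).trans (by
    rw [twistF, ← weightSum_neg, ← prod_Lpow]
    rfl)
  map_H i := twistHom_H hD hn i

/-- The structure `hopf` for the exponent matrix of a Coxeter element arises by twisting the standard
structure, realised by `hopf` for `c = 0`, along `twistIso`. -/
theorem isTwistedHopf_hopf {π : Equiv.Perm (Fin l)} (hD : IsCartanDatum A d)
    (hc : ∀ i j, cayleyCoeff A d π i j = -cayleyCoeff A d π j i)
    {n : Matrix (Fin l) (Fin l) ℂ}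
    (hn : ∀ i j, (d j : ℂ) * n i j - d i * n j i = cayleyCoeff A d π i j) :
    IsTwistedHopf n (hopf hD hc) := by
  have hn' : ∀ i j, (d j : ℂ) * n i j - d i * n j i =
      cayleyCoeff A d π i j - (0 : Matrix (Fin l) (Fin l) ℂ) i j := by simpa using hn
  have hS₀ := isStandardHopf_hopf hD (by simp)
  have hψ := isCoxeterIso_twistIso hD hn'
  have hu : ((hexpUnit (of _ (twistLog A d 0 (Matrix.of fun i j => -(n j i / (d j : ℂ))))) :
    (Completion (Ustd A d ⊗[Ch] Ustd A d))ˣ) : Completion (Ustd A d ⊗[Ch] Ustd A d)) =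
      twist A d n := (twist_eq_hexp n).symm
  exact ⟨_, _, _, hS₀, hψ, hu, fun x => (twisted_comul_eq hD hc hn hS₀ hψ hu x).symm,
    fun x => (twisted_counit_eq hS₀ hψ x).symm⟩

/-- The square of the antipode of the explicit structure, computed on the generators. -/
theorem antipode_antipode (hD : IsCartanDatum A d) (hc : ∀ i j, c i j = -c j i)
    (u : (Uq A d c)ˣ)
    (hu : (u : Uq A d c) = torus A d c ((2 : ℂ) • ∑ p, weight A d p))
    (hu' : ((u⁻¹ : (Uq A d c)ˣ) : Uq A d c) = torus A d c (-((2 : ℂ) • ∑ p, weight A d p)))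
    (x : Uq A d c) : antipode hD hc (antipode hD hc x) = u * x * (u⁻¹ : (Uq A d c)ˣ) := by
  have hcii : ∀ i, c i i = 0 := fun i => self_eq_neg.1 (hc i i)
  -- every simple root takes the value `αᵢ(2ρ^∨) = 2 dᵢ = dᵢ aᵢᵢ`
  have hρ : ∀ i, rootVal A ((2 : ℂ) • ∑ p, weight A d p) i = d i * A i i := fun i => by
    have h := hD.rootVal_sum_weight 1 i
    simp only [Pi.one_apply, one_smul, one_mul] at h
    rw [rootVal_smul, h, hD.diag, mul_comm]
    norm_num
  let φ : Uq A d c →ₐ[Ch] Uq A d c := AlgHom.ofLinearMap (antipode hD hc ∘ₗ antipode hD hc)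
    (by simp [antipode_one]) (by simp [antipode_mul])
  have key : φ = conjAlg u := by
    refine algHom_ext (fun i => ?_) (fun i => ?_) (fun i => ?_) <;>
      rw [conjAlg_apply, hu, hu']
    · change antipode hD hc (antipode hD hc _) = _
      rw [antipode_H, map_neg, antipode_H, neg_neg, torus_mul_H, mul_assoc, torus_mul_torus_neg,
        mul_one]
    · change antipode hD hc (antipode hD hc _) = _
      rw [antipode_E, antipodeE, map_neg, antipode_mul, antipode_torus, antipode_E, antipodeE,
        mul_neg, neg_neg, neg_neg, ← mul_assoc, torus_mul_E, torus_mul_E, smul_mul_assoc,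
        smul_mul_assoc, mul_assoc, mul_assoc, torus_mul_torus_neg, torus_mul_torus_neg, hρ,
        rootVal_add, rootVal_logK, hD.rootVal_shift, hcii, add_zero]
    · change antipode hD hc (antipode hD hc _) = _
      have e : torus A d c (-shift A d c i) * (torus A d c (logK d i) * F A d c i *
          torus A d c (shift A d c i) * torus A d c (-logK d i)) =
          torus A d c (logK d i - shift A d c i) * F A d c i *
            torus A d c (-(logK d i - shift A d c i)) := by
        rw [neg_sub, sub_eq_add_neg (shift A d c i), torus_add, sub_eq_neg_add, torus_add]
        simp only [mul_assoc]
      rw [antipode_F, antipodeF, map_neg, antipode_mul, antipode_mul, antipode_torus,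
        antipode_torus, antipode_F, antipodeF, neg_mul, mul_neg, neg_neg, e, torus_mul_F,
        torus_mul_F, smul_mul_assoc, smul_mul_assoc, mul_assoc, mul_assoc, torus_mul_torus_neg,
        torus_mul_torus_neg, hρ, sub_eq_add_neg, rootVal_add, rootVal_neg, rootVal_logK,
        hD.rootVal_shift, hcii, neg_zero, add_zero]
  rw [← conjAlg_apply, ← key]
  rfl

/-- The Cartan matrix is nondegenerate because it is the Cartan matrix of a root system over a field
of characteristic zero. -/
theorem isCartanDatum_cartanMatrix {𝔤 : Type*} [LieRing 𝔤] [LieAlgebra ℂ 𝔤]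
    [FiniteDimensional ℂ 𝔤] [LieAlgebra.IsKilling ℂ 𝔤] {𝔥 : LieSubalgebra ℂ 𝔤}
    [𝔥.IsCartanSubalgebra] (b : (LieAlgebra.IsKilling.rootSystem 𝔥).Base) (e : Fin l ≃ b.support)
    (hd : ∀ i, 0 < d i)
    (hsymm : ∀ i j, (d i : ℤ) * cartanMatrix b e i j = d j * cartanMatrix b e j i) :
    IsCartanDatum (cartanMatrix b e) d where
  diag i := b.cartanMatrix_apply_same (e i)
  nonpos i j hij := b.cartanMatrix_le_zero_of_ne _ _ fun h => hij (e.injective h).symm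
  pos := hd
  symm := hsymm
  det_ne_zero := by
    classical
    have h : cartanMatrix b e = (Matrix.reindex e.symm e.symm b.cartanMatrix).transpose := rfl
    have hdet : (cartanMatrix b e).det ≠ 0 := by
      rw [h, Matrix.det_transpose, Matrix.det_reindex_self]
      exact Matrix.nondegenerate_iff_det_ne_zero.1 b.cartanMatrix_nondegenerate
    have hmap := RingHom.map_det (Int.castRingHom ℂ) (cartanMatrix b e)
    have : (cartanMatrix b e).map (Int.cast : ℤ → ℂ) =
      (Int.castRingHom ℂ).mapMatrix (cartanMatrix b e) := rfl
    rw [this, ← hmap]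
    simpa using hdet

end Main

end QGroup
end

theorem mainTheorem11
    {𝔤 : Type*} [LieRing 𝔤] [LieAlgebra ℂ 𝔤] [FiniteDimensional ℂ 𝔤] [LieAlgebra.IsSimple ℂ 𝔤]
    (𝔥 : LieSubalgebra ℂ 𝔤) [𝔥.IsCartanSubalgebra]
    (b : (LieAlgebra.IsKilling.rootSystem 𝔥).Base) {l : ℕ} (e : Fin l ≃ b.support)
    (A : Matrix (Fin l) (Fin l) ℤ) (hA : A = QGroup.cartanMatrix b e)
    (d : Fin l → ℕ) (hd : ∀ i, 0 < d i) (hgcd : Finset.univ.gcd d = 1)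
    (hsymm : ∀ i j, (d i : ℤ) * A i j = d j * A j i)
    (π : Equiv.Perm (Fin l)) (n : Matrix (Fin l) (Fin l) ℂ)
    (hn : ∀ i j, (d j : ℂ) * n i j - d i * n j i = QGroup.cayleyCoeff A d π i j) :
    (∃ S : HAdic.TopHopf (QGroup.Ucox A d π), QGroup.IsTwistedHopf n S) ∧
    ∀ S : HAdic.TopHopf (QGroup.Ucox A d π), QGroup.IsTwistedHopf n S →
      ∃ u : (QGroup.Ucox A d π)ˣ,
        (u : QGroup.Ucox A d π) =
          QGroup.Uq.exp A d _ ((2 : ℂ) • ∑ i, QGroup.weightGen A d i) ∧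
        ((u⁻¹ : (QGroup.Ucox A d π)ˣ) : QGroup.Ucox A d π) =
          QGroup.Uq.exp A d _ (-((2 : ℂ) • ∑ i, QGroup.weightGen A d i)) ∧
        ∀ x, S.antipode (S.antipode x) = u * x * (u⁻¹ : (QGroup.Ucox A d π)ˣ) := by
  have hD : QGroup.IsCartanDatum A d := by
    subst hA
    exact QGroup.isCartanDatum_cartanMatrix b e hd hsymm
  -- the left-hand side of the equation solved by `n` is antisymmetric, hence so is `c`
  have hc : ∀ i j, QGroup.cayleyCoeff A d π i j = -QGroup.cayleyCoeff A d π j i := by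
    intro i j
    rw [← hn i j, ← hn j i]
    ring
  refine ⟨⟨QGroup.hopf hD hc, QGroup.isTwistedHopf_hopf hD hc hn⟩, ?_⟩
  rintro S ⟨S₀, ψ, u, hS₀, hψ, hu, hΔ, hε⟩
  have hanti : S.antipode = QGroup.antipode hD hc := by
    refine HAdic.TopHopf.antipode_unique (S' := QGroup.hopf hD hc) ?_ ?_
    · ext1 x
      rw [hΔ, QGroup.twisted_comul_eq hD hc hn hS₀ hψ hu]
      rfl
    · ext1 x
      rw [hε, QGroup.twisted_counit_eq hS₀ hψ]
      rfl
  have hρ : QGroup.cartanGen ((2 : ℂ) • ∑ p, QGroup.weight A d p) =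
      (2 : ℂ) • ∑ i, QGroup.weightGen A d i := by
    rw [QGroup.cartanGen_smul, QGroup.cartanGen_sum]
    rfl
  let v : (QGroup.Ucox A d π)ˣ :=
    ⟨QGroup.Uq.torus A d _ ((2 : ℂ) • ∑ p, QGroup.weight A d p),
      QGroup.Uq.torus A d _ (-((2 : ℂ) • ∑ p, QGroup.weight A d p)),
      QGroup.Uq.torus_mul_torus_neg A d _ _, QGroup.Uq.torus_neg_mul_torus A d _ _⟩
  refine ⟨v, ?_, ?_, fun x => ?_⟩
  · rw [← hρ]
    rfl
  · rw [← hρ, ← QGroup.cartanGen_neg]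
    rfl
  · rw [hanti]
    exact QGroup.antipode_antipode hD hc v rfl rfl x
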